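/- Let $A=\mathbb{Z}[t]$ be the additive group of integer polynomials, ordered by $\alpha<\beta$ iff $\beta-\alpha$ has positive leading coefficient. Let $G$ be a group generated by a finite set $\Sigma\subseteq G$ with $1\notin\Sigma$, let $\Gamma=\Sigma\cup\Sigma^{-1}\subseteq G$, and let $\pi:\Gamma^*\to G$ be the canonical homomorphism. A (closed) $A$-word over $\Gamma$ is a map $x:[1,\alpha]\to\Gamma$, where $0\le\alpha\in A$ and $[1,\alpha]=\{\gamma\in A: 1\le\gamma\le\alpha\}$; the $A$-words form a monoid $W(A,\Gamma)$ under concatenation, which contains $\Gamma^*$ as the submonoid of words of finite length and carries the involution $x\mapsto\overline{x}$ (read from right to left and invert every letter). The word $x$ is $G$-reduced if no finite factor $x[\beta,\beta+n]$ with $n\in\mathbb{N}$, $n\ge 1$, represents $1$ in $G$. Let $R(A,G)$ be the set of $G$-reduced $A$-words, $R^*(A,G)$ the submonoid of $W(A,\Gamma)$ generated by it, and $$M(A,G)=W(A,\Gamma)/\{u\,\ell\,\overline{r}\,\overline{u}=1 : u\in R(A,G),\ \ell,r\in\Gamma^*,\ \pi(\ell)=\pi(r)\}.$$ The group $\mathrm{Ext}(A,G)$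 is the image of $R^*(A,G)$ in $M(A,G)$. Then the following assertions are equivalent: (i) For each $v\in\Gamma^*$ there is an algorithm which decides on input $u\in\Gamma^*$ whether $\pi(u)$ belongs to the cyclic subgroup $\langle\pi(v)\rangle$ of $G$. (ii) For each finite subset $\Delta\subseteq W(A,\Gamma)$ there is an algorithm which decides on input $w=g_1\cdots g_n\in\Delta^*$ (given as the sequence $g_1,\dots,g_n$ of elements of $\Delta$) whether $w=1$ in $\mathrm{Ext}(A,G)$, i.e. whether the image of $w$ in $M(A,G)$ lies in $\mathrm{Ext}(A,G)$ and is its identity element. -/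

import Mathlib

namespace NonArch

/-! # The discretely ordered abelian group `ℤ[t]` -/

theorem leadingCoeff_add_pos {p q : Polynomial ℤ} (hp : 0 < p.leadingCoeff)
    (hq : 0 < q.leadingCoeff) : 0 < (p + q).leadingCoeff := by
  rcases lt_trichotomy p.degree q.degree with h | h | h
  · rwa [Polynomial.leadingCoeff_add_of_degree_lt h]
  · rw [Polynomial.leadingCoeff_add_of_degree_eq h (by lia)]
    lia
  · rwa [Polynomial.leadingCoeff_add_of_degree_lt' h]

/-- The order on `ℤ[t]`: `α ≤ β` iff `α = β` or `β - α` has a positive leading coefficient. -/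
noncomputable instance instLinearOrderPolynomialInt : LinearOrder (Polynomial ℤ) where
  le α β := α = β ∨ 0 < (β - α).leadingCoeff
  le_refl α := Or.inl rfl
  le_trans α β γ h₁ h₂ := by
    rcases h₁ with rfl | h₁
    · exact h₂
    · rcases h₂ with rfl | h₂
      · exact Or.inr h₁
      · right
        have := leadingCoeff_add_pos h₁ h₂
        rwa [show β - α + (γ - β) = γ - α by ring] at this
  le_antisymm α β h₁ h₂ := by
    rcases h₁ with h₁ | h₁
    · exact h₁
    · rcases h₂ with h₂ | h₂
      · exact h₂.symm
      · have := leadingCoeff_add_pos h₁ h₂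
        simp at this
  le_total α β := by
    by_cases h : α = β
    · exact Or.inl (Or.inl h)
    · have h0 : (β - α).leadingCoeff ≠ 0 := by
        rw [Ne, Polynomial.leadingCoeff_eq_zero, sub_eq_zero]
        exact fun e => h e.symm
      rcases lt_or_gt_of_ne h0 with h1 | h1
      · right; right
        rw [← neg_sub, Polynomial.leadingCoeff_neg]
        lia
      · exact Or.inl (Or.inr h1)
  toDecidableLE := Classical.decRel _

theorem poly_le_iff {α β : Polynomial ℤ} : α ≤ β ↔ α = β ∨ 0 < (β - α).leadingCoeff := Iff.rfl

instance instIsOrderedAddMonoidPolynomialInt : IsOrderedAddMonoid (Polynomial ℤ) where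
  add_le_add_left α β h γ := by
    rw [poly_le_iff] at h ⊢
    rcases h with rfl | h
    · exact Or.inl rfl
    · right
      rwa [show β + γ - (α + γ) = β - α by ring]

theorem poly_zero_lt_one : (0 : Polynomial ℤ) < 1 :=
  lt_of_le_of_ne (poly_le_iff.2 (Or.inr (by simp))) zero_ne_one

/-- `1` is the least positive element. -/
theorem poly_one_le_of_pos {α : Polynomial ℤ} (h : 0 < α) : 1 ≤ α := by
  have hα : 0 < α.leadingCoeff := by
    rcases poly_le_iff.1 h.le with h' | h'
    · exact absurd h' h.ne
    · simpa using h'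
  rw [poly_le_iff]
  rcases Nat.eq_zero_or_pos α.natDegree with hd | hd
  · obtain ⟨c, rfl⟩ := Polynomial.natDegree_eq_zero.1 hd
    rw [Polynomial.leadingCoeff_C] at hα
    rcases (show c = 1 ∨ 0 < c - 1 by lia) with rfl | hc
    · left; simp
    · right
      rwa [← Polynomial.C_1, ← Polynomial.C_sub, Polynomial.leadingCoeff_C]
  · right
    rwa [Polynomial.leadingCoeff_sub_of_degree_lt]
    rw [Polynomial.degree_one]
    exact Polynomial.natDegree_pos_iff_degree_pos.1 hd

theorem poly_add_one_le_iff {α β : Polynomial ℤ} : α + 1 ≤ β ↔ α < β := by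
  constructor
  · exact fun h => lt_of_lt_of_le (lt_add_of_pos_right α poly_zero_lt_one) h
  · intro h
    have := poly_one_le_of_pos (sub_pos.2 h)
    rwa [le_sub_iff_add_le, add_comm] at this

/-! # Closed `ℤ[t]`-words -/

/-- A closed `ℤ[t]`-word over the alphabet `Γ`, in standard representation: a map
`[1, len] → Γ` with `0 ≤ len`, given as a partial map on `ℤ[t]` with domain `[1, len]`. -/
structure AWord (Γ : Type*) where
  len : Polynomial ℤ
  len_nonneg : 0 ≤ len
  letter : Polynomial ℤ → Option Γ
  isSome_letter_iff : ∀ β, (letter β).isSome = true ↔ 1 ≤ β ∧ β ≤ len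

namespace AWord

variable {Γ : Type*}

theorem letter_eq_none_iff (p : AWord Γ) (β : Polynomial ℤ) :
    p.letter β = none ↔ ¬ (1 ≤ β ∧ β ≤ p.len) := by
  rw [← p.isSome_letter_iff]; simp

theorem ext_letter {p q : AWord Γ} (hl : p.len = q.len)
    (h : ∀ β, p.letter β = q.letter β) : p = q := by
  cases p; cases q
  obtain rfl : _ = _ := hl
  obtain rfl : _ = _ := funext h
  rfl

/-- The empty word. -/
noncomputable instance : One (AWord Γ) where
  one :=
    { len := 0
      len_nonneg := le_rfl
      letter := fun _ => none
      isSome_letter_iff := fun β => by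
        simp only [Option.isSome_none, Bool.false_eq_true, false_iff, not_and, not_le]
        exact fun h => lt_of_lt_of_le poly_zero_lt_one h }

/-- Concatenation. -/
noncomputable instance : Mul (AWord Γ) where
  mul p q :=
    { len := p.len + q.len
      len_nonneg := add_nonneg p.len_nonneg q.len_nonneg
      letter := fun β => if β ≤ p.len then p.letter β else q.letter (β - p.len)
      isSome_letter_iff := fun β => by
        by_cases h : β ≤ p.len
        · rw [if_pos h, p.isSome_letter_iff]
          exact and_congr_right fun _ =>
            ⟨fun _ => h.trans (le_add_of_nonneg_right q.len_nonneg), fun _ => h⟩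
        · rw [if_neg h, q.isSome_letter_iff, sub_le_iff_le_add', le_sub_iff_add_le, add_comm,
            poly_add_one_le_iff]
          have h' := not_le.1 h
          refine and_congr_left fun _ => ⟨fun _ => ?_, fun _ => h'⟩
          have := poly_add_one_le_iff.2 (lt_of_le_of_lt p.len_nonneg h')
          rwa [zero_add] at this }

@[simp] theorem len_one : (1 : AWord Γ).len = 0 := rfl

@[simp] theorem letter_one (β : Polynomial ℤ) : (1 : AWord Γ).letter β = none := rfl

@[simp] theorem len_mul (p q : AWord Γ) : (p * q).len = p.len + q.len := rfl

theorem letter_mul (p q : AWord Γ) (β : Polynomial ℤ) :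
    (p * q).letter β = if β ≤ p.len then p.letter β else q.letter (β - p.len) := rfl

/-- The monoid `W(ℤ[t], Γ)` of closed words. -/
noncomputable instance : Monoid (AWord Γ) where
  mul_assoc p q r := by
    refine ext_letter (by simp [add_assoc]) fun β => ?_
    simp only [letter_mul, len_mul]
    by_cases h : β ≤ p.len
    · rw [if_pos h, if_pos h, if_pos (h.trans (le_add_of_nonneg_right q.len_nonneg))]
    · simp only [if_neg h, sub_le_iff_le_add', sub_sub]
  one_mul p := by
    refine ext_letter (by simp) fun β => ?_
    rw [letter_mul]
    by_cases h : β ≤ 0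
    · rw [len_one, if_pos h, letter_one, eq_comm, letter_eq_none_iff]
      exact fun h' => absurd (poly_zero_lt_one.trans_le (h'.1.trans h)) (lt_irrefl _)
    · rw [len_one, if_neg h, sub_zero]
  mul_one p := by
    refine ext_letter (by simp) fun β => ?_
    rw [letter_mul]
    by_cases h : β ≤ p.len
    · rw [if_pos h]
    · rw [if_neg h, letter_one, eq_comm, letter_eq_none_iff]
      exact fun h' => h h'.2

/-- The word of length `1` with the single letter `a`. -/
noncomputable def single (a : Γ) : AWord Γ where
  len := 1
  len_nonneg := poly_zero_lt_one.le
  letter β := if β = 1 then some a else none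
  isSome_letter_iff β := by
    by_cases h : β = 1
    · simp [h]
    · simp only [if_neg h, Option.isSome_none, Bool.false_eq_true, false_iff]
      exact fun h' => h (le_antisymm h'.2 h'.1)

/-- The identification of `Γ*` with the finite words in `W(ℤ[t], Γ)`. -/
noncomputable def ofList (l : List Γ) : AWord Γ := (l.map single).prod

/-- The involution of `W(ℤ[t], Γ)` induced by an involution `a ↦ a⁻¹` of the alphabet: the word is
read from right to left, and every letter is inverted. -/
noncomputable def bar [InvolutiveInv Γ] (p : AWord Γ) : AWord Γ where
  len := p.len
  len_nonneg := p.len_nonneg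
  letter β := (p.letter (p.len + 1 - β)).map (fun a => a⁻¹)
  isSome_letter_iff β := by
    rw [Option.isSome_map, p.isSome_letter_iff, le_sub_iff_add_le, add_comm 1 β,
      add_le_add_iff_right, sub_le_iff_le_add, add_le_add_iff_left, and_comm]

section Bar

variable [InvolutiveInv Γ]

@[simp] theorem len_bar (p : AWord Γ) : p.bar.len = p.len := rfl

theorem letter_bar (p : AWord Γ) (β : Polynomial ℤ) :
    p.bar.letter β = (p.letter (p.len + 1 - β)).map (fun a => a⁻¹) := rfl

theorem bar_bar (p : AWord Γ) : p.bar.bar = p := by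
  refine ext_letter rfl fun β => ?_
  simp only [letter_bar, len_bar, Option.map_map, sub_sub_cancel]
  rw [show ((fun a : Γ => a⁻¹) ∘ fun a => a⁻¹) = id from funext fun a => inv_inv a, Option.map_id]
  rfl

theorem bar_one : (1 : AWord Γ).bar = 1 := ext_letter rfl fun _ => rfl

theorem bar_mul (p q : AWord Γ) : (p * q).bar = q.bar * p.bar := by
  refine ext_letter (by simp [add_comm]) fun β => ?_
  rw [letter_bar, letter_mul, letter_mul, len_mul, letter_bar, letter_bar]
  by_cases h : β ≤ q.len
  · rw [if_pos (show β ≤ q.bar.len from h), if_neg]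
    · congr 2; ring
    · rw [not_le, ← poly_add_one_le_iff]
      have := sub_nonneg.2 h
      rw [← sub_nonneg]; convert this using 1; ring
  · rw [if_neg (show ¬ β ≤ q.bar.len from h), if_pos]
    · rw [len_bar]; congr 2; ring
    · have := poly_add_one_le_iff.2 (not_le.1 h)
      rw [← sub_nonneg] at this ⊢; convert this using 1; ring

theorem bar_single (a : Γ) : (single a).bar = single a⁻¹ := by
  refine ext_letter rfl fun β => ?_
  rw [letter_bar]
  simp only [single]
  by_cases h : β = 1
  · simp [h]
  · have : ¬ ((1 : Polynomial ℤ) + 1 - β = 1) := fun h' => h (by linear_combination -h')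
    simp [h, this]

theorem bar_ofList (l : List Γ) : (ofList l).bar = ofList (l.reverse.map (·⁻¹)) := by
  induction l with
  | nil => exact bar_one
  | cons a l ih =>
    have : ofList (a :: l) = single a * ofList l := by simp [ofList]
    rw [this, bar_mul, ih, bar_single]
    simp [ofList]

end Bar

end AWord

/-! # The group `Ext(ℤ[t], G)` -/

section Ext

variable {G : Type*} [Group G]

/-- The alphabet `Γ = Σ ∪ Σ⁻¹ ⊆ G` belonging to a generating set `Σ`. -/
abbrev Letters (S : Set G) : Type _ := ↥(S ∪ S⁻¹)

instance (S : Set G) : InvolutiveInv (Letters S) where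
  inv a := ⟨(a : G)⁻¹, by
    rcases a.2 with h | h
    · exact Or.inr (by simpa using h)
    · exact Or.inl h⟩
  inv_inv a := Subtype.ext (inv_inv (a : G))

/-- The canonical homomorphism `π : Γ* → G`. -/
def eval {S : Set G} (l : List (Letters S)) : G := (l.map Subtype.val).prod

/-- A word is `G`-reduced if no finite factor `x[α, α+n]` with `n ≥ 1` represents `1` in `G`. -/
def IsGReduced {S : Set G} (x : AWord (Letters S)) : Prop :=
  ∀ (p q : AWord (Letters S)) (f : List (Letters S)),
    x = p * AWord.ofList f * q → 2 ≤ f.length → eval f ≠ 1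

/-- The defining relations `u ℓ r̄ ū = 1` of `M(ℤ[t], G)`, for `u` `G`-reduced and finite words
`ℓ`, `r` with `π(ℓ) = π(r)`. -/
def Rel (S : Set G) (x y : AWord (Letters S)) : Prop :=
  ∃ (u : AWord (Letters S)) (l r : List (Letters S)), IsGReduced u ∧ eval l = eval r ∧
    x = u * AWord.ofList l * (AWord.ofList r).bar * u.bar ∧ y = 1

/-- The quotient monoid `M(ℤ[t], G)` of `W(ℤ[t], Γ)`. -/
abbrev QuotMonoid (S : Set G) : Type _ := (conGen (Rel S)).Quotient

/-- The canonical epimorphism `W(ℤ[t], Γ) → M(ℤ[t], G)`. -/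
noncomputable abbrev toQuot (S : Set G) : AWord (Letters S) →* QuotMonoid S := (conGen (Rel S)).mk'

/-- `R*(ℤ[t], G)`, the submonoid of `W(ℤ[t], Γ)` generated by the `G`-reduced words. -/
noncomputable def RStar (S : Set G) : Submonoid (AWord (Letters S)) :=
  Submonoid.closure {u | IsGReduced u}

/-- `Ext(ℤ[t], G)`, the image of `R*(ℤ[t], G)` in `M(ℤ[t], G)`. -/
noncomputable def Ext (S : Set G) : Submonoid (QuotMonoid S) := (RStar S).map (toQuot S)

theorem eval_rev {S : Set G} (l : List (Letters S)) :
    eval (l.reverse.map (·⁻¹)) = (eval l)⁻¹ := by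
  unfold eval
  rw [List.prod_inv_reverse]
  congr 1
  rw [List.map_map, List.map_reverse, List.map_map]
  rfl

theorem IsGReduced.bar {S : Set G} {x : AWord (Letters S)} (h : IsGReduced x) :
    IsGReduced x.bar := by
  intro p q f hx hf he
  refine h q.bar p.bar (f.reverse.map (·⁻¹)) ?_ (by simpa using hf) ?_
  · rw [← AWord.bar_ofList, ← x.bar_bar, hx, AWord.bar_mul, AWord.bar_mul, mul_assoc]
  · rw [eval_rev, he, inv_one]

theorem red_mul_bar {S : Set G} {x : AWord (Letters S)} (h : IsGReduced x) :
    toQuot S x * toQuot S x.bar = 1 := by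
  rw [← map_mul, ← map_one (toQuot S)]
  refine (Con.eq _).2 (ConGen.Rel.of _ _ ⟨x, [], [], h, rfl, ?_, rfl⟩)
  simp [AWord.ofList, AWord.bar_one]

theorem Ext.isUnit {S : Set G} (x : Ext S) : IsUnit x := by
  obtain ⟨_, w, hw, rfl⟩ := x
  have key : ∀ w ∈ RStar S, ∃ w' ∈ RStar S, toQuot S w * toQuot S w' = 1 ∧
      toQuot S w' * toQuot S w = 1 := by
    intro w hw
    refine Submonoid.closure_induction (motive := fun w _ => ∃ w' ∈ RStar S,
      toQuot S w * toQuot S w' = 1 ∧ toQuot S w' * toQuot S w = 1) ?_ ?_ ?_ hw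
    · intro u hu
      have hu' : IsGReduced u := hu
      refine ⟨u.bar, Submonoid.subset_closure hu'.bar, red_mul_bar hu', ?_⟩
      have := red_mul_bar hu'.bar
      rwa [AWord.bar_bar] at this
    · exact ⟨1, one_mem _, by simp, by simp⟩
    · rintro a b _ _ ⟨a', ha', h1, h2⟩ ⟨b', hb', h3, h4⟩
      refine ⟨b' * a', mul_mem hb' ha', ?_, ?_⟩
      · simp only [map_mul]
        rw [mul_assoc, ← mul_assoc (toQuot S b), h3, one_mul, h1]
      · simp only [map_mul]
        rw [mul_assoc, ← mul_assoc (toQuot S a'), h2, one_mul, h4]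
  obtain ⟨w', hw', h1, h2⟩ := key w hw
  exact ⟨⟨⟨_, w, hw, rfl⟩, ⟨_, w', hw', rfl⟩, Subtype.ext h1, Subtype.ext h2⟩, rfl⟩

/-- `Ext(ℤ[t], G)` is a group: `ū` is an inverse of `u` for every `G`-reduced word `u`. -/
noncomputable instance (S : Set G) : Group (Ext S) := groupOfIsUnit Ext.isUnit

/-- The word `w` represents an element of `Ext(ℤ[t], G)`, and this element is `1`. -/
def EqOneInExt (S : Set G) (w : AWord (Letters S)) : Prop :=
  ∃ h : toQuot S w ∈ Ext S, (⟨toQuot S w, h⟩ : Ext S) = 1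

end Ext

/-! # Decidability -/

/-- There is an algorithm which decides, on input a word over the finite alphabet `X`, whether it
satisfies `P`. Letters are handed to the algorithm through a numbering of `X`; which numbering is
used does not matter, since any two differ by a permutation of a finite set. -/
def DecidableOnWords {X : Type*} (P : List X → Prop) : Prop :=
  ∃ (n : ℕ) (e : Fin n ≃ X), ComputablePred fun l : List (Fin n) => P (l.map e)

end NonArch

namespace NonArch

/-! # The ordered ring `ℤ[t]` -/

/-! The foundation is a description of the words that equal `1` in the quotient monoid: they are
exactly the words built from the empty word by inserting factors `u ū` with `u` reduced and
infinite, and finite words of value `1` (`Triv`, `toQuot_eq_one_iff`). The difficulty is that this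
class must also be closed under deleting `u ℓ r̄ ū`. An overlap analysis proves it:
`Triv.exchangeable` replaces finite factors by others of the same value, and `Triv.deletable` then
handles the relations themselves. Hence `G` embeds into `Ext`, words equal to `1` lie in `R*`, and a
trivial word of degree at least `d` contains some `y m ȳ` with `y` reduced of degree at least `d`
and `m` trivial of smaller degree.

Let `K_d` be the subgroup of elements represented by words of degree less than `d` (`degSubgroup`).
`K_{d+1}` is generated by `K_d` and by the reduced words `s` of length `t ^ d + ⋯`, which behave
like stable letters: the mirror `y m ȳ` yields an analogue of Britton's lemma (`exists_pinch`). The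
elements `h ∈ K_d` with `s h s⁻¹ ∈ K_d` arise by sliding a long factor `z` of `s` along itself, that
is, from periods of `z` of degree less than `d`. These periods form a subgroup of a Noetherian
module, so one factor `z` with maximal period group accounts for all of them, and the stabiliser is
conjugate to the image of a finitely generated group of periods (`exists_cut_stabilizer`).

From (i) to (ii): by induction on `d`, membership in every image of a group of periods is decidable
(`decOn_periodRange`); the word problem is the case of the trivial group. For `d = 1` these images
are cyclic subgroups of `G`. In the step, pinches are computable because stabilisers are decidable
(`decOn_union`), and a new period of degree `d` contributes one cyclic factor whose exponents are
bounded by a length estimate (`Triv.exists_len_le`). A finite `Δ` has bounded degree, and which of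
its members lie in `R*` is a finite table.

From (ii) to (i): the word problem of `G` is contained in (ii) and settles elements of finite order.
For `g` of infinite order, let `c` be a shortest nonempty word having a positive power conjugate to
a positive power of `g`. The periodic word `x = c c c ⋯` of length `t` is reduced, and `x u x̄ ū =
1` holds exactly if `u` represents a power of `c` (`IsMinimalPeriodic.mem_zpowers_iff`).
Decidability passes from `⟨c⟩` to `⟨g⟩` because the two are conjugate up to finite index
(`decOn_zpowers_of_virtuallyConj`). -/

theorem poly_pos_iff {α : Polynomial ℤ} : 0 < α ↔ 0 < α.leadingCoeff := by
  constructor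
  · intro h
    rcases poly_le_iff.1 h.le with h' | h'
    · exact absurd h' h.ne
    · simpa using h'
  · intro h
    refine lt_of_le_of_ne (poly_le_iff.2 (Or.inr (by simpa using h))) ?_
    rintro rfl
    simp at h

instance instIsStrictOrderedRingPolynomialInt : IsStrictOrderedRing (Polynomial ℤ) := by
  have : ZeroLEOneClass (Polynomial ℤ) := ⟨poly_zero_lt_one.le⟩
  refine IsStrictOrderedRing.of_mul_pos fun a b ha hb => ?_
  rw [poly_pos_iff] at *
  rw [Polynomial.leadingCoeff_mul]
  exact mul_pos ha hb

/-- Convexity: polynomials of degree less than `d` are infinitely small compared with positive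
polynomials of larger degree. -/
theorem mem_degreeLT_of_le {d : ℕ} {α β : Polynomial ℤ} (h0 : 0 ≤ α) (h : α ≤ β)
    (hβ : β ∈ Polynomial.degreeLT ℤ d) : α ∈ Polynomial.degreeLT ℤ d := by
  rw [Polynomial.mem_degreeLT] at *
  by_contra hα
  have hlt : β.degree < α.degree := lt_of_lt_of_le hβ (not_lt.1 hα)
  have h1 : (β - α).leadingCoeff = - α.leadingCoeff := by
    rw [← neg_sub, Polynomial.leadingCoeff_neg, Polynomial.leadingCoeff_sub_of_degree_lt hlt]
  have hα0 : 0 < α := lt_of_le_of_ne h0 (by rintro rfl; simp at hlt)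
  have h3 := poly_pos_iff.1 hα0
  rcases h.lt_or_eq with h | h
  · have h2 := poly_pos_iff.1 (sub_pos.2 h)
    lia
  · rw [h] at hlt; exact lt_irrefl _ hlt

theorem coeff_nonneg_of_mem_degreeLT {d : ℕ} {α : Polynomial ℤ} (h0 : 0 ≤ α)
    (hα : α ∈ Polynomial.degreeLT ℤ (d + 1)) : 0 ≤ α.coeff d := by
  by_contra hc
  push Not at hc
  rw [Polynomial.mem_degreeLT] at hα
  have hd : α.natDegree = d := by
    refine le_antisymm ?_ (Polynomial.le_natDegree_of_ne_zero hc.ne)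
    rcases eq_or_ne α 0 with rfl | h
    · simp
    · rw [← Polynomial.natDegree_lt_iff_degree_lt h] at hα
      lia
  rcases h0.lt_or_eq with h | h
  · have := poly_pos_iff.1 h
    rw [Polynomial.leadingCoeff, hd] at this
    lia
  · subst h; simp at hc

theorem mem_degreeLT_iff_coeff {d : ℕ} {α : Polynomial ℤ}
    (hα : α ∈ Polynomial.degreeLT ℤ (d + 1)) :
    α ∈ Polynomial.degreeLT ℤ d ↔ α.coeff d = 0 := by
  rw [Polynomial.mem_degreeLT, Polynomial.degree_lt_iff_coeff_zero] at *
  constructor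
  · exact fun h => h d le_rfl
  · intro h m hm
    rcases hm.eq_or_lt with rfl | hm
    · exact h
    · exact hα m hm

/-- Modulo lower degrees, the order is that of the coefficients of `t ^ d`. -/
theorem lt_of_coeff_lt {d : ℕ} {α β : Polynomial ℤ} (hα : α ∈ Polynomial.degreeLT ℤ (d + 1))
    (hβ : β ∈ Polynomial.degreeLT ℤ (d + 1)) (h : α.coeff d < β.coeff d) : α < β := by
  by_contra hc
  have := coeff_nonneg_of_mem_degreeLT (sub_nonneg.2 (not_lt.1 hc)) (sub_mem hα hβ)
  rw [Polynomial.coeff_sub] at this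
  lia

theorem natCast_mem_degreeLT_one (n : ℕ) : (n : Polynomial ℤ) ∈ Polynomial.degreeLT ℤ 1 := by
  rw [Polynomial.mem_degreeLT]
  have := Polynomial.degree_natCast_le (R := ℤ) n
  exact lt_of_le_of_lt this (by norm_num)

theorem exists_natCast_of_mem_degreeLT_one {α : Polynomial ℤ} (h0 : 0 ≤ α)
    (hα : α ∈ Polynomial.degreeLT ℤ 1) : ∃ n : ℕ, α = n := by
  have hc := coeff_nonneg_of_mem_degreeLT h0 hα
  refine ⟨(α.coeff 0).toNat, ?_⟩
  rw [Polynomial.mem_degreeLT, Polynomial.degree_lt_iff_coeff_zero] at hα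
  ext n
  rw [Polynomial.coeff_natCast_ite]
  split_ifs with h
  · subst h; simp [hc]
  · simpa using hα n (by lia)

namespace AWord

/-! # Factorisations of words -/

variable {Γ : Type*}

theorem eq_one_of_len_eq_zero {p : AWord Γ} (h : p.len = 0) : p = 1 := by
  refine ext_letter h fun β => ?_
  rw [letter_one, letter_eq_none_iff, h]
  exact fun h' => absurd (poly_zero_lt_one.trans_le (h'.1.trans h'.2)) (lt_irrefl _)

theorem len_eq_zero_iff {p : AWord Γ} : p.len = 0 ↔ p = 1 :=
  ⟨eq_one_of_len_eq_zero, fun h => by rw [h]; rfl⟩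

theorem letter_mul_left (p q : AWord Γ) {β : Polynomial ℤ} (h : β ≤ p.len) :
    (p * q).letter β = p.letter β := by rw [letter_mul, if_pos h]

theorem letter_mul_right (p q : AWord Γ) {β : Polynomial ℤ} (h : 1 ≤ β) :
    (p * q).letter (p.len + β) = q.letter β := by
  have := poly_zero_lt_one
  rw [letter_mul, if_neg (by intro h'; linarith), add_sub_cancel_left]

theorem mul_cancel {p q p' q' : AWord Γ} (h : p * q = p' * q') (hl : p.len = p'.len) :
    p = p' ∧ q = q' := by
  have hlen : p.len + q.len = p'.len + q'.len := by rw [← len_mul, ← len_mul, h]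
  constructor
  · refine ext_letter hl fun β => ?_
    by_cases hβ : β ≤ p.len
    · rw [← letter_mul_left p q hβ, h, letter_mul_left _ _ (hl ▸ hβ)]
    · rw [(letter_eq_none_iff _ _).2 (fun h => hβ h.2),
        (letter_eq_none_iff _ _).2 (fun h => hβ (hl ▸ h.2))]
  · refine ext_letter (by linarith) fun β => ?_
    by_cases hβ : 1 ≤ β
    · rw [← letter_mul_right p q hβ, h, hl, letter_mul_right _ _ hβ]
    · rw [(letter_eq_none_iff _ _).2 (fun h => hβ h.1), (letter_eq_none_iff _ _).2 (fun h => hβ h.1)]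

theorem mul_left_cancel_word {p q q' : AWord Γ} (h : p * q = p * q') : q = q' :=
  (mul_cancel h rfl).2

theorem exists_split (w : AWord Γ) {α : Polynomial ℤ} (h0 : 0 ≤ α) (h : α ≤ w.len) :
    ∃ p q, w = p * q ∧ p.len = α := by
  have h01 := poly_zero_lt_one
  refine ⟨⟨α, h0, fun β => if β ≤ α then w.letter β else none, fun β => ?_⟩,
    ⟨w.len - α, sub_nonneg.2 h, fun β => if 1 ≤ β then w.letter (β + α) else none, fun β => ?_⟩,
    ?_, rfl⟩
  · by_cases hβ : β ≤ α
    · simp only [hβ, if_true, isSome_letter_iff, and_true, and_iff_left_iff_imp]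
      exact fun _ => hβ.trans h
    · simp [hβ]
  · by_cases hβ : 1 ≤ β
    · simp only [hβ, if_true, isSome_letter_iff, true_and]
      constructor
      · intro h'; linarith [h'.2]
      · intro h'; constructor <;> linarith
    · simp [hβ]
  · refine ext_letter (by simp) fun β => ?_
    rw [letter_mul]
    by_cases hβ : β ≤ α
    · simp [hβ]
    · have : 1 ≤ β - α := poly_one_le_of_pos (sub_pos.2 (not_le.1 hβ))
      simp [hβ, this]

theorem exists_split_right (w : AWord Γ) {α : Polynomial ℤ} (h0 : 0 ≤ α) (h : α ≤ w.len) :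
    ∃ p q, w = p * q ∧ q.len = α := by
  obtain ⟨p, q, rfl, hp⟩ := w.exists_split (sub_nonneg.2 h) (by linarith : w.len - α ≤ w.len)
  refine ⟨p, q, rfl, ?_⟩
  rw [len_mul] at hp
  linarith

/-- Levi's lemma, the source of all case distinctions in the overlap arguments. -/
theorem levi {p q p' q' : AWord Γ} (h : p * q = p' * q') (hl : p.len ≤ p'.len) :
    ∃ m, p' = p * m ∧ q = m * q' := by
  obtain ⟨p1, m, rfl, hp1⟩ := p'.exists_split p.len_nonneg hl
  rw [mul_assoc] at h
  obtain ⟨rfl, rfl⟩ := mul_cancel h hp1.symm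
  exact ⟨m, rfl, rfl⟩

theorem levi' {p q p' q' : AWord Γ} (h : p * q = p' * q') :
    (∃ m, p' = p * m ∧ q = m * q') ∨ (∃ m, p = p' * m ∧ q' = m * q) := by
  rcases le_total p.len p'.len with hl | hl
  · exact Or.inl (levi h hl)
  · exact Or.inr (levi h.symm hl)

theorem levi_right {p q p' q' : AWord Γ} (h : p * q = p' * q') (hl : q'.len ≤ q.len) :
    ∃ m, p' = p * m ∧ q = m * q' := by
  refine levi h ?_
  have : p.len + q.len = p'.len + q'.len := by rw [← len_mul, ← len_mul, h]
  linarith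

theorem eq_one_of_mul_eq_one {p q : AWord Γ} (h : p * q = 1) : p = 1 ∧ q = 1 := by
  have h1 : p.len + q.len = 0 := by rw [← len_mul, h]; rfl
  have := p.len_nonneg
  have := q.len_nonneg
  exact ⟨eq_one_of_len_eq_zero (by linarith), eq_one_of_len_eq_zero (by linarith)⟩

/-! # Finite words and words of bounded degree -/

/-- The length of the word has degree less than `d`. -/
def DegLT (d : ℕ) (w : AWord Γ) : Prop := w.len ∈ Polynomial.degreeLT ℤ d

theorem degLT_mul {d : ℕ} {p q : AWord Γ} : DegLT d (p * q) ↔ DegLT d p ∧ DegLT d q := by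
  constructor
  · intro h
    have hp := p.len_nonneg
    have hq := q.len_nonneg
    exact ⟨mem_degreeLT_of_le hp (by rw [len_mul]; linarith) h,
      mem_degreeLT_of_le hq (by rw [len_mul]; linarith) h⟩
  · exact fun h => add_mem h.1 h.2

theorem degLT_one (d : ℕ) : DegLT d (1 : AWord Γ) := zero_mem _

theorem DegLT.mono {d e : ℕ} (h : d ≤ e) {w : AWord Γ} (hw : DegLT d w) : DegLT e w :=
  Polynomial.degreeLT_mono h hw

theorem exists_degLT (w : AWord Γ) : ∃ d, DegLT d w :=
  ⟨w.len.natDegree + 1, by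
    rw [DegLT, Polynomial.mem_degreeLT]
    exact lt_of_le_of_lt Polynomial.degree_le_natDegree (by exact_mod_cast Nat.lt_succ_self _)⟩

theorem DegLT.len_lt {d : ℕ} {p q : AWord Γ} (hp : DegLT d p) (hq : ¬ DegLT d q) :
    p.len < q.len := by
  by_contra h
  exact hq (mem_degreeLT_of_le q.len_nonneg (not_lt.1 h) hp)

@[simp] theorem ofList_nil : ofList ([] : List Γ) = 1 := rfl

theorem ofList_cons (a : Γ) (l : List Γ) : ofList (a :: l) = single a * ofList l := by
  simp [ofList]

theorem ofList_append (l r : List Γ) : ofList (l ++ r) = ofList l * ofList r := by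
  simp [ofList]

theorem len_ofList (l : List Γ) : (ofList l).len = l.length := by
  induction l with
  | nil => simp
  | cons a l ih => rw [ofList_cons, len_mul, ih]; simp [single, add_comm]

theorem degLT_ofList (l : List Γ) : DegLT 1 (ofList l) := by
  rw [DegLT, len_ofList]; exact natCast_mem_degreeLT_one _

theorem exists_single_of_len_eq_one {w : AWord Γ} (h : w.len = 1) : ∃ a, w = single a := by
  have h1 : (w.letter 1).isSome = true := by rw [isSome_letter_iff, h]; exact ⟨le_rfl, le_rfl⟩
  obtain ⟨a, ha⟩ := Option.isSome_iff_exists.1 h1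
  refine ⟨a, ext_letter h fun β => ?_⟩
  simp only [single]
  split_ifs with hb
  · rw [hb, ha]
  · rw [letter_eq_none_iff, h]
    exact fun h' => hb (le_antisymm h'.2 h'.1)

theorem exists_ofList_of_len_eq {n : ℕ} {w : AWord Γ} (h : w.len = n) :
    ∃ l : List Γ, w = ofList l ∧ l.length = n := by
  induction n generalizing w with
  | zero => exact ⟨[], by rw [ofList_nil]; exact eq_one_of_len_eq_zero (by simpa using h), rfl⟩
  | succ n ih =>
    have : (0 : Polynomial ℤ) ≤ n := Nat.cast_nonneg n
    obtain ⟨p, q, rfl, hp⟩ := w.exists_split zero_le_one (by rw [h]; push_cast; linarith)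
    obtain ⟨a, rfl⟩ := exists_single_of_len_eq_one hp
    obtain ⟨l, rfl, hl⟩ := @ih q (by rw [len_mul, hp] at h; push_cast at h; linarith)
    exact ⟨a :: l, (ofList_cons a l).symm, by simp [hl]⟩

theorem degLT_one_iff {w : AWord Γ} : DegLT 1 w ↔ ∃ l, w = ofList l := by
  constructor
  · intro h
    obtain ⟨n, hn⟩ := exists_natCast_of_mem_degreeLT_one w.len_nonneg h
    obtain ⟨l, hl, -⟩ := exists_ofList_of_len_eq hn
    exact ⟨l, hl⟩
  · rintro ⟨l, rfl⟩
    exact degLT_ofList l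

theorem single_injective : Function.Injective (single : Γ → AWord Γ) := by
  intro a b h
  have := congrArg (fun w => w.letter 1) h
  simpa [single] using this

theorem ofList_injective : Function.Injective (ofList : List Γ → AWord Γ) := by
  intro l
  induction l with
  | nil =>
    intro r h
    have := congrArg AWord.len h
    rw [len_ofList, len_ofList] at this
    have : r.length = 0 := by exact_mod_cast this.symm
    rw [List.eq_nil_of_length_eq_zero this]
  | cons a l ih =>
    intro r h
    cases r with
    | nil =>
      have := congrArg AWord.len h
      rw [len_ofList, len_ofList] at this
      have : (a :: l).length = 0 := by exact_mod_cast this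
      simp at this
    | cons b r =>
      rw [ofList_cons, ofList_cons] at h
      obtain ⟨h1, h2⟩ := mul_cancel h rfl
      rw [single_injective h1, ih h2]

theorem eq_bar_iff [InvolutiveInv Γ] {p q : AWord Γ} : p = q.bar ↔ p.bar = q :=
  ⟨fun h => by rw [h, bar_bar], fun h => by rw [← h, bar_bar]⟩

theorem bar_eq_one_iff [InvolutiveInv Γ] {p : AWord Γ} : p.bar = 1 ↔ p = 1 := by
  rw [← len_eq_zero_iff, ← len_eq_zero_iff, len_bar]

end AWord

/-! # Values of finite words -/

section Values

variable {G : Type*} [Group G] {S : Set G}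

open AWord

@[simp] theorem eval_nil : eval ([] : List (Letters S)) = 1 := rfl

theorem eval_append (l r : List (Letters S)) : eval (l ++ r) = eval l * eval r := by
  simp [eval]

/-- The word `w` is finite and represents `g`. -/
def HasValue (w : AWord (Letters S)) (g : G) : Prop := ∃ l, w = ofList l ∧ eval l = g

theorem HasValue.unique {w : AWord (Letters S)} {g h : G} (hg : HasValue w g)
    (hh : HasValue w h) : g = h := by
  obtain ⟨l, rfl, rfl⟩ := hg
  obtain ⟨r, hr, rfl⟩ := hh
  rw [ofList_injective hr]

theorem HasValue.degLT {w : AWord (Letters S)} {g : G} (hg : HasValue w g) : DegLT 1 w := by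
  obtain ⟨l, rfl, rfl⟩ := hg
  exact degLT_ofList l

theorem hasValue_ofList (l : List (Letters S)) : HasValue (ofList l) (eval l) := ⟨l, rfl, rfl⟩

theorem hasValue_one : HasValue (1 : AWord (Letters S)) 1 := ⟨[], rfl, rfl⟩

theorem exists_hasValue {w : AWord (Letters S)} (h : DegLT 1 w) : ∃ g, HasValue w g := by
  obtain ⟨l, rfl⟩ := degLT_one_iff.1 h
  exact ⟨_, hasValue_ofList l⟩

theorem HasValue.mul {p q : AWord (Letters S)} {g h : G} (hp : HasValue p g)
    (hq : HasValue q h) : HasValue (p * q) (g * h) := by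
  obtain ⟨l, rfl, rfl⟩ := hp
  obtain ⟨r, rfl, rfl⟩ := hq
  exact ⟨l ++ r, (ofList_append l r).symm, eval_append l r⟩

theorem HasValue.bar {p : AWord (Letters S)} {g : G} (hp : HasValue p g) :
    HasValue p.bar g⁻¹ := by
  obtain ⟨l, rfl, rfl⟩ := hp
  exact ⟨_, bar_ofList l, eval_rev l⟩

theorem HasValue.split {p q : AWord (Letters S)} {g : G} (h : HasValue (p * q) g) :
    ∃ g₁ g₂, HasValue p g₁ ∧ HasValue q g₂ ∧ g = g₁ * g₂ := by
  have ⟨h1, h2⟩ := degLT_mul.1 h.degLT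
  obtain ⟨g₁, h1⟩ := exists_hasValue h1
  obtain ⟨g₂, h2⟩ := exists_hasValue h2
  exact ⟨g₁, g₂, h1, h2, h.unique (h1.mul h2)⟩

theorem IsGReduced.of_mul {p x q : AWord (Letters S)} (h : IsGReduced (p * x * q)) :
    IsGReduced x := by
  intro p' q' f hx
  exact h (p * p') (q' * q) f (by simp only [hx, mul_assoc])

theorem IsGReduced.left {p q : AWord (Letters S)} (h : IsGReduced (p * q)) : IsGReduced p :=
  IsGReduced.of_mul (p := 1) (q := q) (by simpa using h)

theorem IsGReduced.right {p q : AWord (Letters S)} (h : IsGReduced (p * q)) : IsGReduced q :=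
  IsGReduced.of_mul (p := p) (q := 1) (by simpa using h)

theorem IsGReduced.of_bar {p : AWord (Letters S)} (h : IsGReduced p.bar) : IsGReduced p := by
  have := h.bar; rwa [bar_bar] at this

theorem isGReduced_one : IsGReduced (1 : AWord (Letters S)) := by
  intro p q f h hf
  obtain ⟨h1, -⟩ := eq_one_of_mul_eq_one h.symm
  obtain ⟨-, h2⟩ := eq_one_of_mul_eq_one h1
  have := ofList_injective (h2.trans ofList_nil.symm)
  simp [this] at hf

/-- A reduced word contains no nonempty finite factor of value `1`. -/
theorem IsGReduced.eq_one_of_hasValue (h1 : (1 : G) ∉ S) {x : AWord (Letters S)}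
    (hx : IsGReduced x) (hv : HasValue x 1) : x = 1 := by
  obtain ⟨l, rfl, hl⟩ := hv
  match l, hl with
  | [], _ => rfl
  -- Reducedness tests only factors with at least two letters; a single letter of value `1` is
  -- excluded by `1 ∉ S`.
  | [a], hl =>
    have ha : (a : G) = 1 := by simpa [eval] using hl
    rcases a.2 with h | h
    · exact absurd (ha ▸ h) h1
    · rw [ha] at h; exact absurd (by simpa using h) h1
  | a :: b :: l, hl => exact absurd hl (hx 1 1 (a :: b :: l) (by simp) (by simp))

theorem isGReduced_single (a : Letters S) : IsGReduced (single a) := by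
  intro p q f h hf
  have := congrArg AWord.len h
  rw [len_mul, len_mul, len_ofList] at this
  have h0 := p.len_nonneg
  have h0' := q.len_nonneg
  have h2 : (2 : Polynomial ℤ) ≤ f.length := by exact_mod_cast hf
  have h01 := poly_zero_lt_one
  simp only [single] at this
  linarith

/-- At the centre of `u ū` the last letter of `u` meets its own inverse. -/
theorem mul_bar_reduced {u : AWord (Letters S)} (h : IsGReduced (u * u.bar)) : u = 1 := by
  by_contra hu
  have hpos : 0 < u.len := lt_of_le_of_ne u.len_nonneg (fun h => hu (eq_one_of_len_eq_zero h.symm))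
  obtain ⟨p, q, rfl, hq⟩ := u.exists_split_right zero_le_one (poly_one_le_of_pos hpos)
  obtain ⟨a, rfl⟩ := exists_single_of_len_eq_one hq
  refine h p p.bar [a, a⁻¹] ?_ (by simp) ?_
  · rw [bar_mul, bar_single]; simp only [ofList_cons, ofList_nil, mul_one, mul_assoc]
  · simp only [eval, List.map_cons, List.map_nil, List.prod_cons, List.prod_nil, mul_one]
    exact mul_inv_cancel (a : G)

end Values


/-! ### Words equal to `1` in the quotient monoid -/

section Confluence

variable {G : Type*} [Group G] {S : Set G}

open AWord

theorem HasValue.of_eq {w : AWord (Letters S)} {g h : G} (hw : HasValue w g) (e : g = h) :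
    HasValue w h := e ▸ hw

/-- The words obtained from the empty word by inserting factors `u ū` with `u` reduced and
infinite, and finite factors of value `1`. -/
inductive Triv : AWord (Letters S) → Prop
  | one : Triv 1
  | ins (p q u : AWord (Letters S)) : IsGReduced u → ¬ DegLT 1 u → Triv (p * q) →
      Triv (p * (u * u.bar) * q)
  | fin (p q a : AWord (Letters S)) : HasValue a (1 : G) → Triv (p * q) → Triv (p * a * q)

/-- A finite `u` is covered by `Triv.fin`. Reserving `Triv.ins` for infinite `u` guarantees, in
inductions over `Triv`, that finite factors are shorter than `u`. -/
theorem Triv.insert_bar {p q u : AWord (Letters S)} (hu : IsGReduced u) (h : Triv (p * q)) :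
    Triv (p * (u * u.bar) * q) := by
  by_cases hs : DegLT 1 u
  · obtain ⟨g, hg⟩ := exists_hasValue hs
    exact h.fin _ _ _ ((hg.mul hg.bar).of_eq (mul_inv_cancel g))
  · exact h.ins _ _ _ hu hs

theorem Triv.insert_bar' {p q u : AWord (Letters S)} (hu : IsGReduced u.bar) (h : Triv (p * q)) :
    Triv (p * (u.bar * u) * q) := by
  have := h.insert_bar hu
  rwa [bar_bar] at this

theorem Triv.bar {w : AWord (Letters S)} (h : Triv w) : Triv w.bar := by
  induction h with
  | one => rw [bar_one]; exact Triv.one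
  | ins p q u hu hs _ ih =>
    rw [bar_mul] at ih
    have := ih.ins _ _ u hu hs
    simpa only [bar_mul, bar_bar, mul_assoc] using this
  | fin p q a ha _ ih =>
    rw [bar_mul] at ih
    have := ih.fin _ _ a.bar (ha.bar.of_eq inv_one)
    simpa only [bar_mul, bar_bar, mul_assoc] using this

theorem Triv.of_bar {w : AWord (Letters S)} (h : Triv w.bar) : Triv w := by
  have := h.bar; rwa [bar_bar] at this

/-- Finite factors of `w` may be replaced by finite words of the same value. -/
def Exchangeable (w : AWord (Letters S)) : Prop :=
  ∀ (p l r q : AWord (Letters S)) (g : G), w = p * l * q → HasValue l g → HasValue r g →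
    Triv (p * r * q)

theorem Exchangeable.bar {w : AWord (Letters S)} (h : Exchangeable w) : Exchangeable w.bar := by
  intro p l r q g hw hl hr
  have := h q.bar l.bar r.bar p.bar g⁻¹ (by
    rw [eq_comm, ← eq_bar_iff.1 hw.symm.symm] at *
    rw [hw]; simp only [bar_mul, bar_bar, mul_assoc]) hl.bar hr.bar
  apply Triv.of_bar
  simpa only [bar_mul, bar_bar, mul_assoc] using this

/-- If `a` and `l` overlap, what remains of `l` in `P * Q` is exchanged for `r` together with what
remains of `a`. The values match because `a` has value `1`. -/
theorem exchange_fin {P Q a : AWord (Letters S)} (ha : HasValue a (1 : G))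
    (ih : Exchangeable (P * Q)) : Exchangeable (P * a * Q) := by
  intro p l r q g hw hl hr
  rw [mul_assoc, mul_assoc] at hw
  rcases levi' hw with ⟨m, rfl, h1⟩ | ⟨m, rfl, h1⟩
  · rcases levi' h1 with ⟨m', rfl, rfl⟩ | ⟨m', rfl, h2⟩
    · have := ih (P * m') l r q g (by simp only [mul_assoc]) hl hr
      have := Triv.fin P (m' * r * q) a ha (by simpa only [mul_assoc] using this)
      simpa only [mul_assoc] using this
    · rcases levi' h2 with ⟨m'', rfl, rfl⟩ | ⟨l2, rfl, rfl⟩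
      · obtain ⟨g1, g2, k1, k2, e1⟩ := ha.split
        obtain ⟨g3, g4, k3, k4, rfl⟩ := k2.split
        obtain rfl := k3.unique hl
        have h0 := ih P 1 (m * (r * m'')) Q 1 (by simp) hasValue_one
          ((k1.mul (hr.mul k4)).of_eq e1.symm)
        simpa only [mul_assoc] using h0
      · obtain ⟨g1, g2, k1, k2, e1⟩ := ha.split
        obtain ⟨g3, g4, k3, k4, rfl⟩ := hl.split
        obtain rfl := k3.unique k2
        have := ih P l2 (m * r) q g4 (by simp only [mul_assoc]) k4
          ((k1.mul hr).of_eq (by rw [← mul_assoc, ← e1, one_mul]))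
        simpa only [mul_assoc] using this
  · rcases levi' h1 with ⟨m', rfl, rfl⟩ | ⟨l2, rfl, h2⟩
    · have := ih p l r (m' * Q) g (by simp only [mul_assoc]) hl hr
      have := Triv.fin (p * r * m') Q a ha (by simpa only [mul_assoc] using this)
      simpa only [mul_assoc] using this
    · rcases levi' h2 with ⟨l3, rfl, rfl⟩ | ⟨a2, rfl, rfl⟩
      · obtain ⟨g1, g2, k1, k2, rfl⟩ := hl.split
        obtain ⟨g3, g4, k3, k4, rfl⟩ := k2.split
        obtain rfl := k3.unique ha
        have := ih p (m * l3) r q (g1 * g4) (by simp only [mul_assoc]) (k1.mul k4)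
          (hr.of_eq (by simp))
        simpa only [mul_assoc] using this
      · obtain ⟨g1, g2, k1, k2, rfl⟩ := hl.split
        obtain ⟨g3, g4, k3, k4, e⟩ := ha.split
        obtain rfl := k3.unique k2
        have := ih p m (r * a2) Q g1 (by simp only [mul_assoc]) k1
          ((hr.mul k4).of_eq (by rw [mul_assoc, ← e, mul_one]))
        simpa only [mul_assoc] using this

/-- The factor `l` ends no later than the centre of `v v̄`. If `l` is inside `v = m₂ l m`, the new
word is rebuilt by inserting `m₂ m₂̄`, then `r l̄` of value `1`, then `m m̄`. If `l` reaches into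
`v` from the left, the part outside is exchanged for `r` times the inverse of the part inside. -/
theorem exchange_before {P Q v p l r q : AWord (Letters S)} {g : G} (hv : IsGReduced v)
    (ih : Exchangeable (P * Q)) (hT : Triv (P * Q)) (hw : P * (v * v.bar) * Q = p * l * q)
    (hl : HasValue l g) (hr : HasValue r g) (hle : (p * l).len ≤ (P * v).len) :
    Triv (p * r * q) := by
  obtain ⟨m, hm, rfl⟩ := levi (p := p * l) (q := q) (p' := P * v) (q' := v.bar * Q)
    (by rw [← hw]; simp only [mul_assoc]) hle
  rcases levi' hm with ⟨m1, h1, rfl⟩ | ⟨m1, rfl, rfl⟩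
  · rcases levi' h1.symm with ⟨m2, rfl, rfl⟩ | ⟨m2, rfl, rfl⟩
    · have r2 : IsGReduced m2 := hv.left.left
      have r3 : IsGReduced m := hv.right
      have s1 := hT.insert_bar r2
      have s2 := Triv.fin (P * m2) (m2.bar * Q) (r * l.bar)
        ((hr.mul hl.bar).of_eq (mul_inv_cancel g)) (by simpa only [mul_assoc] using s1)
      have s3 := Triv.insert_bar (p := P * m2 * r) (q := l.bar * m2.bar * Q) r3
        (by simpa only [mul_assoc] using s2)
      simpa only [mul_assoc, bar_mul] using s3
    · obtain ⟨g1, g2, k1, k2, rfl⟩ := hl.split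
      have s1 := ih p m2 (r * m1.bar) Q g1 rfl k1 ((hr.mul k2.bar).of_eq (by group))
      have r3 : IsGReduced m := hv.right
      have s2 := Triv.insert_bar (p := p * r) (q := m1.bar * Q) r3
        (by simpa only [mul_assoc] using s1)
      simpa only [mul_assoc, bar_mul] using s2
  · have s1 := ih p l r (m1 * Q) g (by simp only [mul_assoc]) hl hr
    have s2 := Triv.insert_bar (p := p * r * m1) (q := Q) hv
        (by simpa only [mul_assoc] using s1)
    simpa only [mul_assoc, bar_mul] using s2

theorem exchange_ins {P Q v : AWord (Letters S)} (hv : IsGReduced v) (hs : ¬ DegLT 1 v)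
    (hT : Triv (P * Q)) (ih : Exchangeable (P * Q)) : Exchangeable (P * (v * v.bar) * Q) := by
  intro p l r q g hw hl hr
  by_cases c1 : (p * l).len ≤ (P * v).len
  · exact exchange_before hv ih hT hw hl hr c1
  by_cases c2 : (P * v).len ≤ p.len
  · apply Triv.of_bar
    have hw' : Q.bar * (v * v.bar) * P.bar = q.bar * l.bar * p.bar := by
      have := congrArg AWord.bar hw
      simpa only [bar_mul, bar_bar, mul_assoc] using this
    have h2 := congrArg AWord.len hw'
    have ih' := ih.bar
    have hT' := hT.bar
    rw [bar_mul] at ih' hT'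
    have := exchange_before hv ih' hT' hw' hl.bar hr.bar (by
      simp only [len_mul, len_bar] at *
      linarith)
    simpa only [bar_mul, bar_bar, mul_assoc] using this
  -- Now `l = c * d` straddles the centre: `c` ends `v` and `d` begins `v̄`. Both are finite, hence
  -- shorter than `v`, so `c` and `d̄` are suffixes of `v` and one of them extends the other.
  · obtain ⟨c, hc, h1⟩ := levi (p := p) (q := l * q) (p' := P * v) (q' := v.bar * Q)
      (by simpa only [mul_assoc] using hw.symm) (not_le.1 c2).le
    obtain ⟨d, rfl, h2⟩ := levi (p := c) (q := v.bar * Q) (p' := l) (q' := q) h1.symm (by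
      rw [hc] at c1
      simp only [len_mul] at c1
      linarith)
    obtain ⟨g1, g2, k1, k2, rfl⟩ := hl.split
    obtain ⟨n, rfl, rfl⟩ := levi_right hc (k1.degLT.len_lt hs).le
    obtain ⟨n2, h3, rfl⟩ := levi h2.symm (k2.degLT.len_lt (q := (n * c).bar) hs).le
    have h4 : n * c = n2.bar * d.bar := by rw [← bar_mul, ← h3, bar_bar]
    rcases levi' h4 with ⟨e, h5, rfl⟩ | ⟨e, rfl, h5⟩
    · have h6 : n2 = e.bar * n.bar := by rw [← bar_mul, ← h5, bar_bar]
      subst h6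
      obtain ⟨g3, g4, k3, k4, rfl⟩ := k1.split
      obtain rfl := k4.unique k2.bar
      have s1 := hT.insert_bar hv.left
      have s2 := Triv.fin (P * n) (n.bar * Q) (r * e.bar)
        ((hr.mul k3.bar).of_eq (by group)) (by simpa only [mul_assoc] using s1)
      simpa only [mul_assoc, bar_mul] using s2
    · have h6 : d = c.bar * e.bar := by rw [← bar_mul, ← h5, bar_bar]
      subst h6
      obtain ⟨g3, g4, k3, k4, rfl⟩ := k2.split
      obtain rfl := k3.unique k1.bar
      have s1 := hT.insert_bar (u := n2.bar) hv.left.left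
      have k5 := k4.bar
      rw [bar_bar] at k5
      have s2 := Triv.fin (P * n2.bar) (n2 * Q) (e * r)
        ((k5.mul hr).of_eq (by group)) (by simpa only [mul_assoc, bar_bar] using s1)
      simpa only [mul_assoc, bar_mul] using s2

theorem Triv.exchangeable {w : AWord (Letters S)} (h : Triv w) : Exchangeable w := by
  induction h with
  | one =>
    intro p l r q g hw hl hr
    obtain ⟨h1, rfl⟩ := eq_one_of_mul_eq_one hw.symm
    obtain ⟨rfl, rfl⟩ := eq_one_of_mul_eq_one h1
    obtain rfl := hl.unique hasValue_one
    exact Triv.fin 1 1 r hr (by simpa using Triv.one)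
  | ins p q u hu hs hT ih => exact exchange_ins hu hs hT ih
  | fin p q a ha _ ih => exact exchange_fin ha ih

theorem Triv.exchange {p l r q : AWord (Letters S)} {g : G} (h : Triv (p * l * q))
    (hl : HasValue l g) (hr : HasValue r g) : Triv (p * r * q) :=
  h.exchangeable p l r q g rfl hl hr

/-- Factors `u ℓ ū` of `w` with `u` reduced and `ℓ` finite of value `1` may be deleted. -/
def Deletable (w : AWord (Letters S)) : Prop :=
  ∀ p u l q : AWord (Letters S), w = p * u * l * u.bar * q → IsGReduced u →
    HasValue l (1 : G) → Triv (p * q)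

theorem Deletable.bar {w : AWord (Letters S)} (h : Deletable w) : Deletable w.bar := by
  intro p u l q hw hu hl
  have := h q.bar u l.bar p.bar (by
    have := congrArg AWord.bar hw
    rw [bar_bar] at this
    rw [this]; simp only [bar_mul, bar_bar, mul_assoc]) hu (hl.bar.of_eq inv_one)
  apply Triv.of_bar
  simpa only [bar_mul, bar_bar, mul_assoc] using this

/-- The factor `a` ends no later than `p * u`. Inside `u` it is empty, since `u` is reduced. If it
overlaps the start of `u`, with `a = k n` and `u = n m'`, deleting `m' l m̄'` leaves `n̄`, which has
the value of `k`. -/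
theorem delete_fin_before {P Q a p u l q : AWord (Letters S)} (h1 : (1 : G) ∉ S)
    (ha : HasValue a (1 : G)) (ih : Deletable (P * Q)) (hu : IsGReduced u)
    (hl : HasValue l (1 : G)) (hw : P * a * Q = p * u * l * u.bar * q)
    (hle : (P * a).len ≤ (p * u).len) : Triv (p * q) := by
  obtain ⟨m', h2, rfl⟩ := levi (p := P * a) (q := Q) (p' := p * u) (q' := l * u.bar * q)
    (by rw [hw]; simp only [mul_assoc]) hle
  rcases levi' h2 with ⟨n, h3, rfl⟩ | ⟨k, rfl, rfl⟩
  · rcases levi' h3 with ⟨k, rfl, rfl⟩ | ⟨k, rfl, rfl⟩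
    · have s1 := ih P m' l (n.bar * q) (by simp only [mul_assoc, bar_mul]) hu.right hl
      obtain ⟨g1, g2, k1, k2, e⟩ := ha.split
      have s2 := Triv.exchange (p := P) (l := n.bar) (r := k) (q := q)
        (by simpa only [mul_assoc] using s1) k2.bar (k1.of_eq (eq_inv_of_mul_eq_one_left e.symm))
      exact s2
    · obtain rfl := IsGReduced.eq_one_of_hasValue h1 hu.left.right ha
      exact ih p (k * m') l q (by simp only [mul_assoc, mul_one]) (by simpa using hu) hl
  · have s1 := ih (P * k) u l q (by simp only [mul_assoc]) hu hl
    have s2 := Triv.fin P (k * q) a ha (by simpa only [mul_assoc] using s1)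
    simpa only [mul_assoc] using s2

theorem delete_fin {P Q a : AWord (Letters S)} (h1 : (1 : G) ∉ S) (ha : HasValue a (1 : G))
    (hT : Triv (P * Q)) (ih : Deletable (P * Q)) : Deletable (P * a * Q) := by
  intro p u l q hw hu hl
  by_cases hs : DegLT 1 u
  · obtain ⟨g, hg⟩ := exists_hasValue hs
    have s1 := hT.fin _ _ _ ha
    rw [hw] at s1
    have s2 := Triv.exchange (p := p) (l := u * l * u.bar) (r := 1) (q := q)
      (by simpa only [mul_assoc] using s1) (((hg.mul hl).mul hg.bar).of_eq (by group)) hasValue_one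
    simpa using s2
  by_cases c1 : (P * a).len ≤ (p * u).len
  · exact delete_fin_before h1 ha ih hu hl hw c1
  by_cases c2 : (p * u * l).len ≤ P.len
  · have hw' : Q.bar * a.bar * P.bar = q.bar * u * l.bar * u.bar * p.bar := by
      have := congrArg AWord.bar hw
      simpa only [bar_mul, bar_bar, mul_assoc] using this
    have h2 := congrArg AWord.len hw'
    have ih' := ih.bar
    rw [bar_mul] at ih'
    have := delete_fin_before h1 (ha.bar.of_eq inv_one) ih' hu (hl.bar.of_eq inv_one) hw' (by
      simp only [len_mul, len_bar] at *
      linarith)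
    apply Triv.of_bar
    rwa [bar_mul]
  · push Not at c1 c2
    have hlt := ha.degLT.len_lt hs
    -- Since `a` ends after `p * u` and starts before the end of `p * u * l`, a suffix `c` of `u` of
    -- the length of `a` makes enough room: `a` lies inside `c l c̄`, and the rest of `c l c̄` still
    -- has value `1`.
    obtain ⟨u', c, rfl, hc⟩ := u.exists_split_right a.len_nonneg hlt.le
    simp only [len_mul] at c1 c2 hlt
    obtain ⟨m1, rfl, h2⟩ := levi (p := p * u') (q := c * l * c.bar * (u'.bar * q)) (p' := P)
      (q' := a * Q) (by simpa only [mul_assoc, bar_mul] using hw.symm) (by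
        rw [len_mul]; linarith)
    obtain ⟨m2, h3, rfl⟩ := levi (p := m1 * a) (q := Q) (p' := c * l * c.bar) (q' := u'.bar * q)
      (by rw [h2]; simp only [mul_assoc]) (by
        simp only [len_mul, len_bar] at *; linarith)
    obtain ⟨g, hg⟩ : ∃ g : G, HasValue c g := exists_hasValue (by
      rw [DegLT, hc]; exact ha.degLT)
    have k := (hg.mul hl).mul hg.bar
    rw [h3] at k
    obtain ⟨g1, g2, k1, k2, e1⟩ := k.split
    obtain ⟨g3, g4, k3, k4, rfl⟩ := k1.split
    obtain rfl := k4.unique ha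
    refine ih p u' (m1 * m2) q (by simp only [mul_assoc]) hu.left ((k3.mul k2).of_eq ?_)
    rw [mul_one, mul_one, mul_inv_cancel] at e1
    exact e1.symm

/-- The centre of `v v̄` lies to the left of `u`. Unless `u` starts after `v̄`, cut `v̄ = m m'` at
the start of `u`. It then suffices to make `P m'̄ q` trivial, because `m̄ m` can be inserted
afterwards. -/
theorem delete_ins_before {P Q v p u l q : AWord (Letters S)} (h1 : (1 : G) ∉ S)
    (hv : IsGReduced v) (ih : Deletable (P * Q)) (hT : Triv (P * Q)) (hu : IsGReduced u)
    (hus : ¬ DegLT 1 u) (hl : HasValue l (1 : G))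
    (hw : P * (v * v.bar) * Q = p * u * l * u.bar * q) (hle : (P * v).len ≤ p.len) :
    Triv (p * q) := by
  obtain ⟨m, rfl, h2⟩ := levi (p := P * v) (q := v.bar * Q) (p' := p) (q' := u * l * u.bar * q)
    (by simpa only [mul_assoc] using hw) hle
  rcases levi' h2 with ⟨m', rfl, rfl⟩ | ⟨m', hv', h3⟩
  · have s1 := ih (P * m') u l q (by simp only [mul_assoc]) hu hl
    have s2 := Triv.insert_bar (p := P) (q := m' * q) hv (by simpa only [mul_assoc] using s1)
    simpa only [mul_assoc] using s2
  have hv2 : v = m'.bar * m.bar := by rw [← bar_mul, ← hv', bar_bar]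
  have hvb := hv.bar
  rw [hv'] at hvb
  have hm : IsGReduced m.bar := hvb.left.bar
  rw [mul_assoc, mul_assoc] at h3
  rcases levi' h3 with ⟨m'', rfl, h4⟩ | ⟨u2, rfl, rfl⟩
  · have key : Triv (P * (m''.bar * u.bar) * q) := by
      rcases levi' h4 with ⟨m3, rfl, h5⟩ | ⟨l2, rfl, rfl⟩
      · have hl1 : l = 1 := IsGReduced.eq_one_of_hasValue h1 hvb.right.right.left hl
        subst hl1
        rcases levi' h5 with ⟨m4, rfl, rfl⟩ | ⟨m4, hum, rfl⟩
        · exfalso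
          apply hus
          have := hvb.right
          rw [one_mul, ← mul_assoc] at this
          rw [mul_bar_reduced this.left]
          exact degLT_one _
        · have hu2 : u = m4.bar * m3.bar := by rw [← bar_mul, ← hum, bar_bar]
          rw [one_mul, hu2, mul_assoc] at hvb
          have h6 : IsGReduced (m3.bar * m3.bar.bar) := by rw [bar_bar]; exact hvb.right.right
          have h7 := bar_eq_one_iff.1 (mul_bar_reduced h6)
          subst h7
          rw [one_mul] at hum
          subst hum
          simpa only [mul_one, one_mul, bar_one, mul_assoc] using hT
      · obtain ⟨g1, g2, k1, k2, e⟩ := hl.split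
        have s1 := Triv.exchange (p := P) (l := l2) (r := m''.bar) (q := u.bar * q)
          (by simpa only [mul_assoc] using hT) k2
          (k1.bar.of_eq (inv_eq_of_mul_eq_one_right e.symm))
        simpa only [mul_assoc] using s1
    have s2 := Triv.insert_bar' (p := P * m''.bar * u.bar) (u := m) (q := q) hm
      (by simpa only [mul_assoc] using key)
    rw [bar_mul] at hv2
    rw [hv2]
    simpa only [mul_assoc] using s2
  · have s1 := ih P u2 l (m'.bar * q) (by simp only [mul_assoc, bar_mul]) hu.right hl
    have s2 := Triv.insert_bar' (p := P * m'.bar) (u := m) (q := q) hm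
      (by simpa only [mul_assoc] using s1)
    rw [hv2]
    simpa only [mul_assoc] using s2

/-- The centre of `v v̄` cannot lie in the interior of a reduced word: the letters on its two sides
are mutually inverse. -/
theorem not_reduced_of_centre {P Q v p m n R : AWord (Letters S)} (hr : IsGReduced (m * n))
    (hv : v ≠ 1) (hm : m ≠ 1) (hn : n ≠ 1) (h1 : P * v = p * m) (h2 : v.bar * Q = n * R) :
    False := by
  have aux : ∀ w : AWord (Letters S), w ≠ 1 → 1 ≤ w.len := fun w hw => poly_one_le_of_pos
    (lt_of_le_of_ne w.len_nonneg (fun h => hw (eq_one_of_len_eq_zero h.symm)))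
  obtain ⟨m', a, rfl, ha⟩ := m.exists_split_right zero_le_one (aux m hm)
  obtain ⟨b, n', rfl, hb⟩ := n.exists_split zero_le_one (aux n hn)
  rw [← mul_assoc] at h1
  obtain ⟨v', -, rfl⟩ := levi_right h1 (by rw [ha]; exact aux v hv)
  rw [bar_mul, mul_assoc, mul_assoc] at h2
  obtain ⟨rfl, -⟩ := mul_cancel h2 (by rw [len_bar, ha, hb])
  have h3 : IsGReduced (a * a.bar) := by
    refine IsGReduced.of_mul (p := m') (q := n') ?_
    simpa only [mul_assoc] using hr
  rw [mul_bar_reduced h3] at ha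
  exact zero_ne_one ha

theorem delete_ins {P Q v : AWord (Letters S)} (h1 : (1 : G) ∉ S) (hv : IsGReduced v)
    (hvs : ¬ DegLT 1 v) (hT : Triv (P * Q)) (ih : Deletable (P * Q)) :
    Deletable (P * (v * v.bar) * Q) := by
  intro p u l q hw hu hl
  by_cases hs : DegLT 1 u
  · obtain ⟨g, hg⟩ := exists_hasValue hs
    have s1 := hT.insert_bar hv
    rw [hw] at s1
    have s2 := Triv.exchange (p := p) (l := u * l * u.bar) (r := 1) (q := q)
      (by simpa only [mul_assoc] using s1) (((hg.mul hl).mul hg.bar).of_eq (by group)) hasValue_one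
    simpa using s2
  have hv1 : v ≠ 1 := by rintro rfl; exact hvs (degLT_one _)
  by_cases c1 : (P * v).len ≤ p.len
  · exact delete_ins_before h1 hv ih hT hu hs hl hw c1
  by_cases c2 : (p * u * l * u.bar).len ≤ (P * v).len
  · have hw' : Q.bar * (v * v.bar) * P.bar = q.bar * u * l.bar * u.bar * p.bar := by
      have := congrArg AWord.bar hw
      simpa only [bar_mul, bar_bar, mul_assoc] using this
    have h2 := congrArg AWord.len hw'
    have ih' := ih.bar
    have hT' := hT.bar
    rw [bar_mul] at ih' hT'
    have := delete_ins_before h1 hv ih' hT' hu hs (hl.bar.of_eq inv_one) hw' (by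
      simp only [len_mul, len_bar] at *
      linarith)
    apply Triv.of_bar
    rwa [bar_mul]
  push Not at c1 c2
  by_cases c3 : (P * v).len < (p * u).len
  · exfalso
    obtain ⟨m, hm, h3⟩ := levi (p := p) (q := u * (l * u.bar * q)) (p' := P * v)
      (q' := v.bar * Q) (by simpa only [mul_assoc] using hw.symm) c1.le
    obtain ⟨n, rfl, h4⟩ := levi (p := m) (q := v.bar * Q) (p' := u) (q' := l * u.bar * q) h3.symm
      (by rw [hm] at c3; simp only [len_mul] at c3; linarith)
    refine not_reduced_of_centre hu hv1 ?_ ?_ hm h4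
    · rintro rfl; rw [hm, mul_one] at c1; exact lt_irrefl _ c1
    · rintro rfl; rw [hm, mul_one] at c3; exact lt_irrefl _ c3
  by_cases c4 : (p * u * l).len < (P * v).len
  · exfalso
    obtain ⟨m, hm, h3⟩ := levi (p := p * u * l) (q := u.bar * q) (p' := P * v)
      (q' := v.bar * Q) (by simpa only [mul_assoc] using hw.symm) c4.le
    obtain ⟨n, hun, h4⟩ := levi (p := m) (q := v.bar * Q) (p' := u.bar) (q' := q) h3.symm
      (by rw [hm] at c2; simp only [len_mul] at c2 ⊢; linarith)
    refine not_reduced_of_centre (hun ▸ hu.bar) hv1 ?_ ?_ hm h4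
    · rintro rfl; rw [hm, mul_one] at c4; exact lt_irrefl _ c4
    · rintro rfl; rw [mul_one] at hun; rw [hm, ← hun] at c2; exact lt_irrefl _ c2
  push Not at c3 c4
  -- The centre of `v v̄` lies in `l = c * d`. The suffixes `c` and `d̄` of `v` have the same value,
  -- as `l` has value `1`. Since `v` is reduced, the piece by which one exceeds the other is empty.
  -- What is left of `v` and `u` are two mirrors around the same centre, which are compared by
  -- length.
  obtain ⟨c, hc, h2⟩ := levi (p := p * u) (q := l * (u.bar * q)) (p' := P * v)
    (q' := v.bar * Q) (by simpa only [mul_assoc] using hw.symm) c3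
  obtain ⟨d, rfl, h3⟩ := levi (p := c) (q := v.bar * Q) (p' := l) (q' := u.bar * q) h2.symm (by
    rw [hc] at c4; simp only [len_mul] at c4; linarith)
  obtain ⟨g1, g2, k1, k2, e⟩ := hl.split
  obtain ⟨n, h4, rfl⟩ := levi_right hc (k1.degLT.len_lt hvs).le
  obtain ⟨k, h5, h6⟩ := levi h3.symm (k2.degLT.len_lt (q := (n * c).bar) hvs).le
  have h7 : n * c = k.bar * d.bar := by rw [← bar_mul, ← h5, bar_bar]
  have h8 : n = k.bar := by
    rcases levi' h7 with ⟨f, h9, rfl⟩ | ⟨f, h9, h10⟩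
    · obtain ⟨g3, g4, k3, k4, rfl⟩ := k1.split
      obtain rfl := k4.unique k2.bar
      have hf : f = 1 := by
        refine IsGReduced.eq_one_of_hasValue h1 ?_ (k3.of_eq (by rw [e]; group))
        rw [h7, h9] at hv
        exact hv.left.right
      rw [h9, hf, mul_one]
    · have k3 := k2.bar
      rw [h10] at k3
      obtain ⟨g3, g4, k3, k4, e2⟩ := k3.split
      obtain rfl := k4.unique k1
      have hf : f = 1 := by
        refine IsGReduced.eq_one_of_hasValue h1 ?_ (k3.of_eq ?_)
        · rw [h9] at hv
          exact hv.left.right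
        · have : g4 = g2⁻¹ := eq_inv_of_mul_eq_one_left e.symm
          rw [this] at e2
          exact (mul_eq_right.1 e2.symm)
      rw [h9, hf, mul_one]
  have h9 : k = n.bar := by rw [h8, bar_bar]
  subst h9
  rcases levi' h4.symm with ⟨f, rfl, rfl⟩ | ⟨f, rfl, rfl⟩
  · have : q = f.bar * Q := by
      rw [bar_mul, mul_assoc] at h6
      exact mul_left_cancel_word h6
    subst this
    have s1 := hT.insert_bar (hv.left.left)
    simpa only [mul_assoc] using s1
  · have : Q = f.bar * q := by
      rw [bar_mul, mul_assoc] at h6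
      exact mul_left_cancel_word h6.symm
    subst this
    exact ih p f 1 q (by simp only [mul_assoc, one_mul]) hu.left hasValue_one

theorem Triv.deletable (h1 : (1 : G) ∉ S) {w : AWord (Letters S)} (h : Triv w) :
    Deletable w := by
  induction h with
  | one =>
    intro p u l q hw _ _
    obtain ⟨h1, rfl⟩ := eq_one_of_mul_eq_one hw.symm
    obtain ⟨h1, -⟩ := eq_one_of_mul_eq_one h1
    obtain ⟨h1, -⟩ := eq_one_of_mul_eq_one h1
    obtain ⟨rfl, -⟩ := eq_one_of_mul_eq_one h1
    simpa using Triv.one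
  | ins p q u hu hs hT ih => exact delete_ins h1 hu hs hT ih
  | fin p q a ha hT ih => exact delete_fin h1 ha hT ih

/-- Words are equivalent if they are interchangeable as factors of trivial words. -/
def trivCon (S : Set G) : Con (AWord (Letters S)) where
  r x y := ∀ p q, Triv (p * x * q) ↔ Triv (p * y * q)
  iseqv := ⟨fun _ _ _ => Iff.rfl, fun h p q => (h p q).symm, fun h k p q => (h p q).trans (k p q)⟩
  mul' {a b c d} h k p q := by
    have h1 := h p (c * q)
    have h2 := k (p * b) q
    simp only [mul_assoc] at *
    exact h1.trans h2

/-- One direction is deletability. The other inserts `u ū` and then a finite word of value `1` at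
its centre. -/
theorem rel_le_trivCon (h1 : (1 : G) ∉ S) : conGen (Rel S) ≤ trivCon S := by
  rw [Con.conGen_le]
  rintro x y ⟨u, l, r, hu, he, rfl, rfl⟩ p q
  have hv : HasValue (ofList l * (ofList r).bar) (1 : G) :=
    ((hasValue_ofList l).mul (hasValue_ofList r).bar).of_eq (by rw [he, mul_inv_cancel])
  rw [mul_one]
  constructor
  · intro h
    exact h.deletable h1 p u _ q (by simp only [mul_assoc]) hu hv
  · intro h
    have s1 := h.insert_bar hu
    have s2 := Triv.fin (p * u) (u.bar * q) _ hv (by simpa only [mul_assoc] using s1)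
    simpa only [mul_assoc] using s2

theorem toQuot_bar_mul {u : AWord (Letters S)} (hu : IsGReduced u) :
    toQuot S u.bar * toQuot S u = 1 := by
  have := red_mul_bar hu.bar
  rwa [bar_bar] at this

theorem toQuot_hasValue {w : AWord (Letters S)} (hw : HasValue w (1 : G)) : toQuot S w = 1 := by
  obtain ⟨l, rfl, hl⟩ := hw
  rw [← map_one (toQuot S)]
  refine (Con.eq _).2 (ConGen.Rel.of _ _ ⟨1, l, [], isGReduced_one, hl, ?_, rfl⟩)
  simp [AWord.bar_one]

/-- `trivCon` is a congruence containing the relations, and a word congruent to `1` under it is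
trivial because `1` is. -/
theorem toQuot_eq_one_iff (h1 : (1 : G) ∉ S) {w : AWord (Letters S)} :
    toQuot S w = 1 ↔ Triv w := by
  constructor
  · intro h
    rw [← map_one (toQuot S)] at h
    have h2 := rel_le_trivCon h1 ((Con.eq _).1 h) 1 1
    simp only [one_mul, mul_one] at h2
    exact h2.2 Triv.one
  · intro h
    induction h with
    | one => exact map_one _
    | ins p q u hu _ _ ih =>
      rw [map_mul] at ih
      rw [map_mul, map_mul, map_mul, red_mul_bar hu, mul_one, ih]
    | fin p q a ha _ ih =>
      rw [map_mul] at ih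
      rw [map_mul, map_mul, toQuot_hasValue ha, mul_one, ih]

end Confluence

/-! ### Mirror factors and an analogue of Britton's lemma -/

section Britton

variable {G : Type*} [Group G] {S : Set G}

open AWord

theorem Triv.hasValue_eq_one {w : AWord (Letters S)} (h : Triv w) {g : G} (hw : HasValue w g) :
    g = 1 := by
  induction h generalizing g with
  | one => exact hw.unique hasValue_one
  | ins p q u hu hs _ ih =>
    exact absurd (degLT_mul.1 (degLT_mul.1 (degLT_mul.1 hw.degLT).1).2).1 hs
  | fin p q a ha _ ih =>
    obtain ⟨g1, g2, k1, k2, rfl⟩ := hw.split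
    obtain ⟨g3, g4, k3, k4, rfl⟩ := k1.split
    obtain rfl := k4.unique ha
    have := ih (k3.mul k2)
    rwa [mul_one]

theorem ofList_mem_RStar (l : List (Letters S)) : ofList l ∈ RStar S := by
  induction l with
  | nil => exact one_mem _
  | cons a l ih =>
    rw [ofList_cons]
    exact mul_mem (Submonoid.subset_closure (isGReduced_single a)) ih

theorem IsGReduced.mem_RStar {u : AWord (Letters S)} (h : IsGReduced u) : u ∈ RStar S :=
  Submonoid.subset_closure h

/-- Factors of reduced words are reduced, so `R*` is closed under taking factors. Membership of a
product in `R*` thereby becomes a condition on each factor separately. -/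
theorem mul_mem_RStar {p q : AWord (Letters S)} :
    p * q ∈ RStar S ↔ p ∈ RStar S ∧ q ∈ RStar S := by
  refine ⟨fun h => ?_, fun h => mul_mem h.1 h.2⟩
  have key : ∀ w ∈ RStar S, ∀ p q, w = p * q → p ∈ RStar S ∧ q ∈ RStar S := by
    intro w hw
    refine Submonoid.closure_induction (motive := fun w _ => ∀ p q, w = p * q →
      p ∈ RStar S ∧ q ∈ RStar S) ?_ ?_ ?_ hw
    · rintro u hu p q rfl
      have hu : IsGReduced (p * q) := hu
      exact ⟨hu.left.mem_RStar, hu.right.mem_RStar⟩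
    · intro p q h
      obtain ⟨rfl, rfl⟩ := eq_one_of_mul_eq_one h.symm
      exact ⟨one_mem _, one_mem _⟩
    · intro x y _ _ hx hy p q h
      rcases levi' h with ⟨m, rfl, rfl⟩ | ⟨m, rfl, rfl⟩
      · obtain ⟨h1, h2⟩ := hy m q rfl
        exact ⟨mul_mem (hx x 1 (by simp)).1 h1, h2⟩
      · obtain ⟨h1, h2⟩ := hx p m rfl
        exact ⟨h1, mul_mem h2 (hy y 1 (by simp)).1⟩
  exact key _ h p q rfl

theorem bar_mem_RStar {w : AWord (Letters S)} (h : w ∈ RStar S) : w.bar ∈ RStar S := by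
  refine Submonoid.closure_induction (motive := fun w _ => w.bar ∈ RStar S) ?_ ?_ ?_ h
  · intro u hu
    exact IsGReduced.mem_RStar (IsGReduced.bar hu)
  · rw [bar_one]; exact one_mem _
  · intro x y _ _ hx hy
    rw [bar_mul]; exact mul_mem hy hx

theorem Triv.mem_RStar {w : AWord (Letters S)} (h : Triv w) : w ∈ RStar S := by
  induction h with
  | one => exact one_mem _
  | ins p q u hu _ _ ih =>
    obtain ⟨h1, h2⟩ := mul_mem_RStar.1 ih
    exact mul_mem (mul_mem h1 (mul_mem hu.mem_RStar hu.bar.mem_RStar)) h2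
  | fin p q a ha _ ih =>
    obtain ⟨h1, h2⟩ := mul_mem_RStar.1 ih
    obtain ⟨l, rfl, -⟩ := ha
    exact mul_mem (mul_mem h1 (ofList_mem_RStar l)) h2

theorem Triv.conj (h1 : (1 : G) ∉ S) {m u : AWord (Letters S)} (h : Triv m) (hu : IsGReduced u) :
    Triv (u * m * u.bar) := by
  rw [← toQuot_eq_one_iff h1] at *
  rw [map_mul, map_mul, h, mul_one, red_mul_bar hu]

theorem Triv.mul {m n : AWord (Letters S)} (hm : Triv m) (hn : Triv n) (h1 : (1 : G) ∉ S) :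
    Triv (m * n) := by
  rw [← toQuot_eq_one_iff h1] at *
  rw [map_mul, hm, hn, mul_one]

/-- Some infinite factor of `w` is cancelled against its inverse. -/
def HasMirror (d : ℕ) (w : AWord (Letters S)) : Prop :=
  ∃ p y m q : AWord (Letters S), w = p * y * m * y.bar * q ∧ IsGReduced y ∧ ¬ DegLT d y ∧
    DegLT d m ∧ Triv m

theorem HasMirror.bar {d : ℕ} {w : AWord (Letters S)} (h : HasMirror d w) :
    HasMirror d w.bar := by
  obtain ⟨p, y, m, q, rfl, hy, hs, hm, ht⟩ := h
  exact ⟨q.bar, y, m.bar, p.bar, by simp only [bar_mul, bar_bar, mul_assoc], hy, hs, hm, ht.bar⟩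

/-- The interesting case is an insertion into `y = y₁ k`. If `k` has degree less than `d`, then `y₁`
is mirrored around the new middle `a k m k̄`; otherwise `k` itself is long enough to take the place
of `y`. -/
theorem hasMirror_insert_left {d : ℕ} (h1 : (1 : G) ∉ S) {P Q a p y m q : AWord (Letters S)}
    (ha : DegLT d a) (hat : Triv a) (hw : P * Q = p * y * m * y.bar * q) (hy : IsGReduced y)
    (hs : ¬ DegLT d y) (hm : DegLT d m) (hmt : Triv m) (hle : P.len ≤ (p * y * m).len) :
    HasMirror d (P * a * Q) := by
  obtain ⟨n, h2, rfl⟩ := levi (p := P) (q := Q) (p' := p * y * m) (q' := y.bar * q)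
    (by simpa only [mul_assoc] using hw) hle
  rcases levi' h2 with ⟨k, rfl, rfl⟩ | ⟨k, h3, rfl⟩
  rotate_left
  · rcases levi' h3.symm with ⟨l, rfl, rfl⟩ | ⟨y1, rfl, rfl⟩
    · exact ⟨P * a * l, y, m, q, by simp only [mul_assoc], hy, hs, hm, hmt⟩
    · by_cases hk : DegLT d k
      · refine ⟨p, y1, a * k * m * k.bar, q, by simp only [mul_assoc, bar_mul], hy.left,
          fun h => hs (degLT_mul.2 ⟨h, hk⟩), ?_, ?_⟩
        · exact degLT_mul.2 ⟨degLT_mul.2 ⟨degLT_mul.2 ⟨ha, hk⟩, hm⟩, hk⟩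
        · have := hat.mul (hmt.conj h1 hy.right) h1
          simpa only [mul_assoc] using this
      · exact ⟨p * y1 * a, k, m, y1.bar * q, by simp only [mul_assoc, bar_mul], hy.right, hk,
          hm, hmt⟩
  · refine ⟨p, y, k * a * n, q, by simp only [mul_assoc], hy, hs, ?_, ?_⟩
    · exact degLT_mul.2 ⟨degLT_mul.2 ⟨(degLT_mul.1 hm).1, ha⟩, (degLT_mul.1 hm).2⟩
    · rw [← toQuot_eq_one_iff h1] at *
      rw [map_mul] at hmt
      rw [map_mul, map_mul, hat, mul_one, hmt]

theorem hasMirror_insert {d : ℕ} (h1 : (1 : G) ∉ S) {P Q a : AWord (Letters S)}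
    (ha : DegLT d a) (hat : Triv a) (h : HasMirror d (P * Q)) : HasMirror d (P * a * Q) := by
  obtain ⟨p, y, m, q, hw, hy, hs, hm, hmt⟩ := h
  by_cases c : P.len ≤ (p * y * m).len
  · exact hasMirror_insert_left h1 ha hat hw hy hs hm hmt c
  · have hw' : Q.bar * P.bar = q.bar * y * m.bar * y.bar * p.bar := by
      have := congrArg AWord.bar hw
      simpa only [bar_mul, bar_bar, mul_assoc] using this
    have h2 := congrArg AWord.len hw
    have := hasMirror_insert_left h1 (a := a.bar) ha hat.bar hw' hy hs hm hmt.bar (by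
      simp only [len_mul, len_bar] at *
      have := m.len_nonneg
      linarith)
    have := this.bar
    simpa only [bar_mul, bar_bar, mul_assoc] using this

/-- Along the construction of a trivial word, an insertion of degree at least `d` creates a mirror,
and an insertion of smaller degree preserves an existing one. -/
theorem Triv.hasMirror {d : ℕ} (hd : 1 ≤ d) (h1 : (1 : G) ∉ S) {w : AWord (Letters S)}
    (h : Triv w) (hw : ¬ DegLT d w) : HasMirror d w := by
  induction h with
  | one => exact absurd (degLT_one d) hw
  | ins p q u hu _ _ ih =>
    by_cases hus : DegLT d u
    · refine hasMirror_insert h1 (degLT_mul.2 ⟨hus, hus⟩) ?_ (ih fun h => hw ?_)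
      · simpa using Triv.one.conj h1 hu
      · rw [degLT_mul] at h
        exact degLT_mul.2 ⟨degLT_mul.2 ⟨h.1, degLT_mul.2 ⟨hus, hus⟩⟩, h.2⟩
    · exact ⟨p, u, 1, q, by simp only [mul_assoc, one_mul], hu, hus, degLT_one d, Triv.one⟩
  | fin p q a ha _ ih =>
    have has := ha.degLT.mono hd
    refine hasMirror_insert h1 has ?_ (ih fun h => hw ?_)
    · simpa using Triv.fin 1 1 a ha (by simpa using Triv.one)
    · rw [degLT_mul] at h
      exact degLT_mul.2 ⟨degLT_mul.2 ⟨h.1, has⟩, h.2⟩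

/-- A reduced word whose length has the form `t ^ d + ⋯`. -/
def SingleCut (d : ℕ) (s : AWord (Letters S)) : Prop :=
  IsGReduced s ∧ DegLT (d + 1) s ∧ s.len.coeff d = 1

theorem AWord.DegLT.coeff_eq_zero {d : ℕ} {w : AWord (Letters S)} (h : DegLT d w) :
    w.len.coeff d = 0 :=
  (mem_degreeLT_iff_coeff (Polynomial.degreeLT_mono (Nat.le_succ d) h)).1 h

theorem degLT_of_coeff {d : ℕ} {w : AWord (Letters S)} (h : DegLT (d + 1) w)
    (h0 : w.len.coeff d = 0) : DegLT d w := (mem_degreeLT_iff_coeff h).2 h0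

theorem coeff_len_nonneg {d : ℕ} {w : AWord (Letters S)} (h : DegLT (d + 1) w) :
    0 ≤ w.len.coeff d := coeff_nonneg_of_mem_degreeLT w.len_nonneg h

theorem one_le_coeff_len {d : ℕ} {w : AWord (Letters S)} (h : DegLT (d + 1) w)
    (hs : ¬ DegLT d w) : 1 ≤ w.len.coeff d := by
  have h0 := coeff_len_nonneg h
  have : w.len.coeff d ≠ 0 := fun h' => hs (degLT_of_coeff h h')
  lia

theorem coeff_len_mul (d : ℕ) (p q : AWord (Letters S)) :
    (p * q).len.coeff d = p.len.coeff d + q.len.coeff d := by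
  rw [len_mul, Polynomial.coeff_add]

theorem SingleCut.not_degLT {d : ℕ} {s : AWord (Letters S)} (h : SingleCut d s) :
    ¬ DegLT d s := by
  intro hs
  have h0 := DegLT.coeff_eq_zero hs
  rw [h.2.2] at h0
  exact one_ne_zero h0

theorem SingleCut.bar {d : ℕ} {s : AWord (Letters S)} (h : SingleCut d s) :
    SingleCut d s.bar := ⟨h.1.bar, h.2⟩

/-- The coefficients of `t ^ d` in the lengths are nonnegative and add up to `1`, and `z` uses up
all of it. -/
theorem SingleCut.degLT_of_eq {d : ℕ} {s a z b : AWord (Letters S)} (h : SingleCut d s)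
    (hs : s = a * z * b) (hz : ¬ DegLT d z) :
    DegLT d a ∧ DegLT d b ∧ SingleCut d z := by
  subst hs
  obtain ⟨hr, hsm, hc⟩ := h
  have h2 := degLT_mul.1 hsm
  have h3 := degLT_mul.1 h2.1
  rw [coeff_len_mul, coeff_len_mul] at hc
  have e1 := coeff_len_nonneg h3.1
  have e2 := one_le_coeff_len h3.2 hz
  have e3 := coeff_len_nonneg h2.2
  exact ⟨degLT_of_coeff h3.1 (by lia), degLT_of_coeff h2.2 (by lia), hr.left.right, h3.2, by lia⟩

/-- The product `s h s'` is shortened by a cancellation around the cuts of `s` and `s'`. -/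
def Pinch (d : ℕ) (s h s' : AWord (Letters S)) : Prop :=
  ∃ a z b c e, s = a * z * b ∧ s' = c * z.bar * e ∧ ¬ DegLT d z ∧ Triv (b * h * c)

/-- Comparing coefficients of `t ^ d` shows that the ends of `s` and `y` differ by degree less than
`d` only. Trimming `y` by the discrepancies at both arms of the mirror gives the required form; the
pieces cut off cancel against each other around `m`. -/
theorem pinch_of_mirror {d : ℕ} (h1 : (1 : G) ∉ S) {s h s' a y m e : AWord (Letters S)}
    (hs : SingleCut d s) (hs' : SingleCut d s') (hh : DegLT d h) (hy : SingleCut d y)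
    (hm : DegLT d m) (hmt : Triv m) (hw : s * h * s' = a * y * m * y.bar * e) :
    Pinch d s h s' := by
  have hmT := (toQuot_eq_one_iff h1).2 hmt
  have hw' : s * (h * s') = a * y * (m * (y.bar * e)) := by simpa only [mul_assoc] using hw
  rcases levi' hw' with ⟨n, h2, h3⟩ | ⟨b, rfl, h3⟩
  · have hn : DegLT d n := by
      have hay : DegLT (d + 1) (a * y) := by
        refine (degLT_mul (q := m * (y.bar * e))).1 ?_ |>.1
        rw [← hw']
        exact degLT_mul.2 ⟨hs.2.1, degLT_mul.2 ⟨hh.mono (Nat.le_succ d), hs'.2.1⟩⟩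
      have ha2 : DegLT (d + 1) (m * (y.bar * e)) := by
        refine (degLT_mul (p := a * y)).1 ?_ |>.2
        rw [← hw']
        exact degLT_mul.2 ⟨hs.2.1, degLT_mul.2 ⟨hh.mono (Nat.le_succ d), hs'.2.1⟩⟩
      have e1 := congrArg (fun w => w.len.coeff d) hw'
      have e2 := congrArg (fun w => w.len.coeff d) h2
      have hn1 : DegLT (d + 1) n := (degLT_mul.1 (h2 ▸ hay)).2
      have e3 := coeff_len_nonneg (degLT_mul.1 hay).1
      have e4 := coeff_len_nonneg (degLT_mul.1 (degLT_mul.1 ha2).2).2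
      have e5 := DegLT.coeff_eq_zero hm
      have e6 := DegLT.coeff_eq_zero hh
      have e7 := coeff_len_nonneg hn1
      simp only [coeff_len_mul, len_bar, hs.2.2, hs'.2.2, hy.2.2] at e1 e2
      exact degLT_of_coeff hn1 (by lia)
    obtain ⟨y2, rfl, rfl⟩ := levi_right h2 (hn.len_lt hy.not_degLT).le
    have hn2 : IsGReduced n := hy.1.right
    have hy2 : ¬ DegLT d y2 := fun h => hy.not_degLT (degLT_mul.2 ⟨h, hn⟩)
    have hnT := red_mul_bar hn2
    rw [bar_mul, mul_assoc n.bar, ← mul_assoc m, ← mul_assoc n] at h3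
    rcases levi' h3 with ⟨g, h4, rfl⟩ | ⟨g, h4, h5⟩
    · refine ⟨a, y2, 1, g, e, by simp only [mul_one], by simp only [mul_assoc], hy2, ?_⟩
      rw [one_mul, ← h4, ← toQuot_eq_one_iff h1, map_mul, map_mul, hmT, one_mul, hnT]
    · have hg : DegLT d g := by rw [h4] at hh; exact (degLT_mul.1 hh).2
      obtain ⟨y3, h6, rfl⟩ := levi (p := g) (q := s') (p' := y2.bar) (q' := e) h5.symm
        (hg.len_lt (q := y2.bar) hy2).le
      have h7 : y2 = y3.bar * g.bar := by rw [← bar_mul, ← h6, bar_bar]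
      subst h7
      have hgT := toQuot_bar_mul (hy.1.left.right.of_bar)
      refine ⟨a, y3.bar, g.bar, 1, e, by simp only [mul_assoc],
        by simp only [bar_bar, one_mul], fun h => hy2 (degLT_mul.2 ⟨h, hg⟩), ?_⟩
      rw [mul_one, h4, ← toQuot_eq_one_iff h1]
      simp only [map_mul, ← mul_assoc] at *
      rw [mul_assoc _ (toQuot S n), mul_assoc _ (toQuot S n * _), mul_assoc (toQuot S n)]
      rw [hmT, one_mul, hnT, mul_one, hgT]
  · have hb : DegLT d b := (hs.degLT_of_eq rfl hy.not_degLT).2.1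
    rw [← mul_assoc b] at h3
    rcases levi' h3.symm with ⟨c, rfl, rfl⟩ | ⟨n, h4, h5⟩
    · exact ⟨a, y, b, c, e, rfl, by simp only [mul_assoc], hy.not_degLT, hmt⟩
    · have hn : DegLT d n := by
        have : DegLT d (b * h) := degLT_mul.2 ⟨hb, hh⟩
        rw [h4] at this; exact (degLT_mul.1 this).2
      obtain ⟨y2, h6, rfl⟩ := levi (p := n) (q := s') (p' := y.bar) (q' := e) h5.symm
        (hn.len_lt (q := y.bar) hy.not_degLT).le
      have h7 : y = y2.bar * n.bar := by rw [← bar_mul, ← h6, bar_bar]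
      subst h7
      have hnT := toQuot_bar_mul (hy.1.right.of_bar)
      refine ⟨a, y2.bar, n.bar * b, 1, e, by simp only [mul_assoc],
        by simp only [bar_bar, one_mul], fun h => hy.not_degLT (degLT_mul.2 ⟨h, hn⟩), ?_⟩
      rw [mul_one, mul_assoc, h4, ← toQuot_eq_one_iff h1, map_mul, map_mul, hmT, one_mul, hnT]

/-- The product `s₁ h₁ s₂ h₂ ⋯` of a list of pairs `(sᵢ, hᵢ)`. -/
def pairProd {M : Type*} [Monoid M] (L : List (M × M)) : M := (L.map fun x => x.1 * x.2).prod

@[simp] theorem pairProd_nil {M : Type*} [Monoid M] : pairProd ([] : List (M × M)) = 1 := rfl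

@[simp] theorem pairProd_cons {M : Type*} [Monoid M] (x : M × M) (L : List (M × M)) :
    pairProd (x :: L) = x.1 * x.2 * pairProd L := by simp [pairProd]

@[simp] theorem pairProd_append {M : Type*} [Monoid M] (L L' : List (M × M)) :
    pairProd (L ++ L') = pairProd L * pairProd L' := by simp [pairProd]

theorem pairProd_cuts {d : ℕ} {L : List (AWord (Letters S) × AWord (Letters S))}
    (hL : ∀ x ∈ L, SingleCut d x.1 ∧ DegLT d x.2) :
    DegLT (d + 1) (pairProd L) ∧ (pairProd L).len.coeff d = L.length := by
  induction L with
  | nil => exact ⟨degLT_one _, by simp⟩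
  | cons x L ih =>
    obtain ⟨h1, h2⟩ := ih fun y hy => hL y (List.mem_cons_of_mem _ hy)
    obtain ⟨h3, h4⟩ := hL x List.mem_cons_self
    rw [pairProd_cons]
    refine ⟨degLT_mul.2 ⟨degLT_mul.2 ⟨h3.2.1, h4.mono (Nat.le_succ d)⟩, h1⟩, ?_⟩
    rw [coeff_len_mul, coeff_len_mul, h2, h3.2.2, DegLT.coeff_eq_zero h4]
    push_cast [List.length_cons]
    ring

theorem exists_split_two {α : Type*} {L : List α} {k : ℕ} (h : k + 2 ≤ L.length) :
    ∃ L₁ x y L₂, L = L₁ ++ x :: y :: L₂ ∧ L₁.length = k := by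
  induction L generalizing k with
  | nil => simp at h
  | cons a L ih =>
    cases k with
    | zero =>
      match L, h with
      | b :: L, _ => exact ⟨[], a, b, L, rfl, rfl⟩
    | succ k =>
      obtain ⟨L₁, x, y, L₂, rfl, rfl⟩ := ih (k := k) (by simp at h; lia)
      exact ⟨a :: L₁, x, y, L₂, rfl, rfl⟩

/-- An analogue of Britton's lemma. -/
theorem exists_pinch {d : ℕ} (hd : 1 ≤ d) (h1 : (1 : G) ∉ S) {h₀ : AWord (Letters S)}
    {L : List (AWord (Letters S) × AWord (Letters S))} (hne : L ≠ [])
    (h0 : DegLT d h₀) (hL : ∀ x ∈ L, SingleCut d x.1 ∧ DegLT d x.2)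
    (hT : Triv (h₀ * pairProd L)) :
    ∃ L₁ x y L₂, L = L₁ ++ x :: y :: L₂ ∧ Pinch d x.1 x.2 y.1 := by
  obtain ⟨hs1, hc1⟩ := pairProd_cuts hL
  have hc0 := DegLT.coeff_eq_zero h0
  have hns : ¬ DegLT d (h₀ * pairProd L) := by
    intro h
    have := DegLT.coeff_eq_zero (degLT_mul.1 h).2
    rw [hc1] at this
    exact hne (List.eq_nil_of_length_eq_zero (by exact_mod_cast this))
  obtain ⟨p, y, m, q, hw, hy, hys, hm, hmt⟩ := hT.hasMirror hd h1 hns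
  have hsw : DegLT (d + 1) (h₀ * pairProd L) :=
    degLT_mul.2 ⟨h0.mono (Nat.le_succ d), hs1⟩
  have hcw := congrArg (fun w => w.len.coeff d) hw
  rw [hw] at hsw
  obtain ⟨⟨⟨⟨sp, sy⟩, sm⟩, -⟩, sq⟩ : (((DegLT (d + 1) p ∧ DegLT (d + 1) y) ∧
      DegLT (d + 1) m) ∧ DegLT (d + 1) y.bar) ∧ DegLT (d + 1) q := by
    simpa only [degLT_mul] using hsw
  have cm := DegLT.coeff_eq_zero hm
  simp only [coeff_len_mul, hc1, hc0, len_bar, cm] at hcw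
  have cp := coeff_len_nonneg sp
  have cq := coeff_len_nonneg sq
  have cy := one_le_coeff_len sy hys
  -- The arm `y` ends after `k + 1` units of `t ^ d`. The pinch is therefore to be found between the
  -- pair preceded by exactly `k` pairs and the next one.
  obtain ⟨k, hk⟩ : ∃ k : ℕ, p.len.coeff d + y.len.coeff d = k + 1 :=
    ⟨(p.len.coeff d + y.len.coeff d - 1).toNat, by lia⟩
  obtain ⟨L₁, x, y', L₂, rfl, hL₁⟩ := exists_split_two (L := L) (k := k) (by lia)
  refine ⟨L₁, x, y', L₂, rfl, ?_⟩
  obtain ⟨hx1, hx2⟩ := hL x (by simp)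
  obtain ⟨hy1, hy2⟩ := hL y' (by simp)
  obtain ⟨sL₁, cL₁⟩ := pairProd_cuts (L := L₁) fun z hz => hL z (by simp [hz])
  set X := h₀ * pairProd L₁ with hX
  have sX : DegLT (d + 1) X := degLT_mul.2 ⟨h0.mono (Nat.le_succ d), sL₁⟩
  have cX : X.len.coeff d = k := by rw [hX, coeff_len_mul, hc0, cL₁, hL₁, zero_add]
  have sx2 := hx2.mono (Nat.le_succ d)
  have cx2 := DegLT.coeff_eq_zero hx2
  have hw2 : X * x.1 * x.2 * y'.1 * (y'.2 * pairProd L₂) = p * y * m * y.bar * q := by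
    rw [← hw, hX]; simp only [pairProd_append, pairProd_cons, mul_assoc]
  -- Both arms of the mirror are shortened to length `ρ`, so that the mirror fits into `x.1 * x.2 *
  -- y'.1`. The minimum of the three available lengths serves: all have a coefficient of `t ^ d` of
  -- at least `1`, and for two of them it equals `1`.
  obtain ⟨ρ, hρ0, hρ1, hρ2, hρ3, hρ4⟩ : ∃ ρ : Polynomial ℤ, 0 ≤ ρ ∧ ρ ≤ y.len ∧
      X.len + ρ ≤ (p * y).len ∧ (p * y * m).len + ρ ≤ (X * x.1 * x.2 * y'.1).len ∧
      ρ.coeff d = 1 ∧ ρ ∈ Polynomial.degreeLT ℤ (d + 1) := by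
    have m1 : y.len ∈ Polynomial.degreeLT ℤ (d + 1) := sy
    have m2 : (p * y).len - X.len ∈ Polynomial.degreeLT ℤ (d + 1) :=
      sub_mem (degLT_mul.2 ⟨sp, sy⟩) sX
    have m3 : (X * x.1 * x.2 * y'.1).len - (p * y * m).len ∈ Polynomial.degreeLT ℤ (d + 1) :=
      sub_mem (degLT_mul.2 ⟨degLT_mul.2 ⟨degLT_mul.2 ⟨sX, hx1.2.1⟩, sx2⟩, hy1.2.1⟩)
        (degLT_mul.2 ⟨degLT_mul.2 ⟨sp, sy⟩, sm⟩)
    have c2 : ((p * y).len - X.len).coeff d = 1 := by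
      rw [Polynomial.coeff_sub, coeff_len_mul, hk, cX]; ring
    have c3 : ((X * x.1 * x.2 * y'.1).len - (p * y * m).len).coeff d = 1 := by
      simp only [Polynomial.coeff_sub, coeff_len_mul, hk, cX, cm, cx2, hx1.2.2, hy1.2.2]; ring
    obtain ⟨ρ, r1, r2, r3, r4, r5⟩ : ∃ ρ, ρ ≤ y.len ∧ ρ ≤ (p * y).len - X.len ∧
        ρ ≤ (X * x.1 * x.2 * y'.1).len - (p * y * m).len ∧
        ρ ∈ Polynomial.degreeLT ℤ (d + 1) ∧ 1 ≤ ρ.coeff d := by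
      refine ⟨min y.len (min ((p * y).len - X.len)
        ((X * x.1 * x.2 * y'.1).len - (p * y * m).len)), min_le_left _ _,
        (min_le_right _ _).trans (min_le_left _ _), (min_le_right _ _).trans (min_le_right _ _),
        ?_, ?_⟩
      · rcases min_choice ((p * y).len - X.len)
          ((X * x.1 * x.2 * y'.1).len - (p * y * m).len) with e | e <;> rw [e] <;>
          rcases min_choice y.len _ with e | e <;> rw [e] <;> assumption
      · rcases min_choice ((p * y).len - X.len)
          ((X * x.1 * x.2 * y'.1).len - (p * y * m).len) with e | e <;> rw [e] <;>
          rcases min_choice y.len _ with e | e <;> rw [e] <;> lia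
    have r0 : 0 < ρ := lt_of_coeff_lt (zero_mem _) r4 (by rw [Polynomial.coeff_zero]; lia)
    have r6 := coeff_nonneg_of_mem_degreeLT (sub_nonneg.2 r2) (sub_mem m2 r4)
    rw [Polynomial.coeff_sub, c2] at r6
    exact ⟨ρ, r0.le, r1, by linarith, by linarith, by lia, r4⟩
  obtain ⟨y0, y1, rfl, hyl⟩ := y.exists_split_right hρ0 hρ1
  have hcut : SingleCut d y1 := ⟨hy.right, (degLT_mul.1 sy).2, by rw [hyl, hρ4.1]⟩
  simp only [len_mul] at hρ2 hρ3
  clear_value X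
  obtain ⟨a, h4, h5⟩ := levi (p := X) (q := x.1 * x.2 * y'.1 * (y'.2 * pairProd L₂))
    (p' := p * y0) (q' := y1 * m * y1.bar * (y0.bar * q))
    (by simpa only [mul_assoc, bar_mul] using hw2) (by rw [len_mul]; linarith)
  have h4' := congrArg AWord.len h4
  obtain ⟨e, h6, -⟩ := levi (p := a * y1 * m * y1.bar) (q := y0.bar * q)
    (p' := x.1 * x.2 * y'.1) (q' := y'.2 * pairProd L₂)
    (by rw [h5]; simp only [mul_assoc]) (by
      simp only [len_mul, len_bar] at *
      linarith)
  exact pinch_of_mirror h1 hx1 hy1 hx2 hcut hm hmt h6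

end Britton

/-! ### The filtration of `Ext(ℤ[t], G)` by degree, and periods of words -/

section Elements

variable {G : Type*} [Group G] {S : Set G}

open AWord

open Classical in
/-- The element of `Ext(ℤ[t], G)` represented by a word of `R*(ℤ[t], G)`; by convention, `1` for
all other words. -/
noncomputable def elt (w : AWord (Letters S)) : Ext S :=
  if h : w ∈ RStar S then ⟨toQuot S w, w, h, rfl⟩ else 1

theorem coe_elt {w : AWord (Letters S)} (h : w ∈ RStar S) :
    (elt w : QuotMonoid S) = toQuot S w := by
  rw [elt, dif_pos h]

theorem elt_one : elt (1 : AWord (Letters S)) = 1 := by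
  apply Subtype.ext
  rw [coe_elt (one_mem _), map_one]
  rfl

theorem elt_mul {p q : AWord (Letters S)} (hp : p ∈ RStar S) (hq : q ∈ RStar S) :
    elt (p * q) = elt p * elt q := by
  apply Subtype.ext
  rw [coe_elt (mul_mem hp hq), map_mul]
  change _ = (elt p : QuotMonoid S) * (elt q : QuotMonoid S)
  rw [coe_elt hp, coe_elt hq]

theorem elt_eq_one_iff (h1 : (1 : G) ∉ S) {w : AWord (Letters S)} (hw : w ∈ RStar S) :
    elt w = 1 ↔ Triv w := by
  rw [← toQuot_eq_one_iff h1, ← coe_elt hw, ← Subtype.val_inj]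
  rfl

theorem elt_bar_of_reduced {u : AWord (Letters S)} (hu : IsGReduced u) :
    elt u.bar = (elt u)⁻¹ := by
  rw [eq_inv_iff_mul_eq_one, ← elt_mul hu.bar.mem_RStar hu.mem_RStar]
  apply Subtype.ext
  rw [coe_elt (mul_mem hu.bar.mem_RStar hu.mem_RStar), map_mul, toQuot_bar_mul hu]
  rfl

theorem elt_bar {w : AWord (Letters S)} (hw : w ∈ RStar S) : elt w.bar = (elt w)⁻¹ := by
  refine Submonoid.closure_induction (motive := fun w _ => elt w.bar = (elt w)⁻¹) ?_ ?_ ?_ hw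
  · exact fun u hu => elt_bar_of_reduced hu
  · rw [bar_one, elt_one, inv_one]
  · intro x y hx hy ex ey
    rw [bar_mul, elt_mul (bar_mem_RStar hy) (bar_mem_RStar hx), elt_mul hx hy, ex, ey,
      mul_inv_rev]

/-- The elements of `Ext(ℤ[t], G)` represented by words whose length has degree less than `d`. -/
noncomputable def degSubgroup (S : Set G) (d : ℕ) : Subgroup (Ext S) where
  carrier := {x | ∃ w ∈ RStar S, DegLT d w ∧ elt w = x}
  one_mem' := ⟨1, one_mem _, degLT_one d, elt_one⟩
  mul_mem' := by
    rintro _ _ ⟨p, hp, hpd, rfl⟩ ⟨q, hq, hqd, rfl⟩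
    exact ⟨p * q, mul_mem hp hq, degLT_mul.2 ⟨hpd, hqd⟩, elt_mul hp hq⟩
  inv_mem' := by
    rintro _ ⟨p, hp, hpd, rfl⟩
    exact ⟨p.bar, bar_mem_RStar hp, hpd, elt_bar hp⟩

theorem elt_mem_degSubgroup {d : ℕ} {w : AWord (Letters S)} (hw : w ∈ RStar S)
    (hd : DegLT d w) : elt w ∈ degSubgroup S d := ⟨w, hw, hd, rfl⟩

/-- The elements represented by reduced words whose length has degree less than `d`. -/
def degGens (S : Set G) (d : ℕ) : Set (Ext S) :=
  {x | ∃ u : AWord (Letters S), IsGReduced u ∧ DegLT d u ∧ elt u = x}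

/-- The elements represented by reduced words whose length has the form `t ^ d + ⋯`. -/
def cutGens (S : Set G) (d : ℕ) : Set (Ext S) :=
  {x | ∃ s : AWord (Letters S), SingleCut d s ∧ elt s = x}

theorem degGens_inv {d : ℕ} {x : Ext S} (hx : x ∈ degGens S d) : x⁻¹ ∈ degGens S d := by
  obtain ⟨u, hu, hd, rfl⟩ := hx
  exact ⟨u.bar, hu.bar, hd, elt_bar_of_reduced hu⟩

theorem degGens_subset (d : ℕ) : degGens S d ⊆ degSubgroup S d := by
  rintro _ ⟨u, hu, hd, rfl⟩
  exact elt_mem_degSubgroup hu.mem_RStar hd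

theorem mem_closure_degGens {d : ℕ} {x : Ext S} :
    x ∈ Submonoid.closure (degGens S d) ↔ x ∈ degSubgroup S d := by
  constructor
  · intro h
    have : Submonoid.closure (degGens S d) ≤ (degSubgroup S d).toSubmonoid :=
      Submonoid.closure_le.2 (degGens_subset d)
    exact this h
  · rintro ⟨w, hw, hd, rfl⟩
    refine Submonoid.closure_induction (motive := fun w _ => DegLT d w →
      elt w ∈ Submonoid.closure (degGens S d)) ?_ ?_ ?_ hw hd
    · exact fun u hu hd => Submonoid.subset_closure ⟨u, hu, hd, rfl⟩
    · intro _; rw [elt_one]; exact one_mem _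
    · intro p q hp hq ep eq hd
      rw [elt_mul hp hq]
      exact mul_mem (ep (degLT_mul.1 hd).1) (eq (degLT_mul.1 hd).2)

theorem Pinch.mem_degSubgroup {d : ℕ} (h1 : (1 : G) ∉ S) {s h s' : AWord (Letters S)}
    (hs : SingleCut d s) (hs' : SingleCut d s') (hh : h ∈ RStar S) (hp : Pinch d s h s') :
    elt s * elt h * elt s' ∈ degSubgroup S d := by
  obtain ⟨a, z, b, c, e, rfl, rfl, hz, ht⟩ := hp
  obtain ⟨ha, hb, -⟩ := hs.degLT_of_eq rfl hz
  obtain ⟨hc, he, -⟩ := hs'.degLT_of_eq rfl hz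
  have ra := hs.1.left.left.mem_RStar
  have rz := hs.1.left.right.mem_RStar
  have rb := hs.1.right.mem_RStar
  have rc := hs'.1.left.left.mem_RStar
  have re := hs'.1.right.mem_RStar
  have key : elt b * elt h * elt c = 1 := by
    rw [← elt_mul rb hh, ← elt_mul (mul_mem rb hh) rc]
    exact (elt_eq_one_iff h1 (mul_mem (mul_mem rb hh) rc)).2 ht
  have : elt (a * z * b) * elt h * elt (c * z.bar * e) = elt a * elt e := by
    rw [elt_mul (mul_mem ra rz) rb, elt_mul ra rz, elt_mul (mul_mem rc (bar_mem_RStar rz)) re,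
      elt_mul rc (bar_mem_RStar rz), elt_bar rz]
    calc _ = elt a * elt z * (elt b * elt h * elt c) * (elt z)⁻¹ * elt e := by group
      _ = _ := by rw [key]; group
  rw [this]
  exact mul_mem (elt_mem_degSubgroup ra ha) (elt_mem_degSubgroup re he)

theorem elt_pairProd {L : List (AWord (Letters S) × AWord (Letters S))}
    (hL : ∀ x ∈ L, x.1 ∈ RStar S ∧ x.2 ∈ RStar S) :
    pairProd L ∈ RStar S ∧ elt (pairProd L) = pairProd (L.map (Prod.map elt elt)) := by
  induction L with
  | nil => exact ⟨one_mem _, elt_one⟩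
  | cons x L ih =>
    obtain ⟨h1, h2⟩ := ih fun y hy => hL y (List.mem_cons_of_mem _ hy)
    obtain ⟨h3, h4⟩ := hL x List.mem_cons_self
    rw [pairProd_cons, List.map_cons, pairProd_cons, ← h2]
    exact ⟨mul_mem (mul_mem h3 h4) h1, by rw [elt_mul (mul_mem h3 h4) h1, elt_mul h3 h4]; rfl⟩

/-- A product lying in the subgroup becomes trivial when its initial factor `h₀` is changed within
the subgroup. -/
theorem exists_pinch_words {d : ℕ} (hd : 1 ≤ d) (h1 : (1 : G) ∉ S) {h₀ : Ext S}
    {L : List (AWord (Letters S) × AWord (Letters S))} (hne : L ≠ [])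
    (h0 : h₀ ∈ degSubgroup S d)
    (hL : ∀ x ∈ L, SingleCut d x.1 ∧ DegLT d x.2 ∧ x.2 ∈ RStar S)
    (hm : h₀ * pairProd (L.map (Prod.map elt elt)) ∈ degSubgroup S d) :
    ∃ L₁ x y L₂, L = L₁ ++ x :: y :: L₂ ∧ Pinch d x.1 x.2 y.1 := by
  obtain ⟨hLR, hLe⟩ := elt_pairProd fun x hx => ⟨(hL x hx).1.1.mem_RStar, (hL x hx).2.2⟩
  obtain ⟨w, hw, hwd, e⟩ := mul_mem (inv_mem hm) h0
  refine exists_pinch hd h1 (h₀ := w) hne hwd (fun x hx => ⟨(hL x hx).1, (hL x hx).2.1⟩) ?_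
  rw [← elt_eq_one_iff h1 (mul_mem hw hLR), elt_mul hw hLR, hLe, e]
  group

theorem exists_pinch_elt {d : ℕ} (hd : 1 ≤ d) (h1 : (1 : G) ∉ S) {h₀ : Ext S}
    {L : List (Ext S × Ext S)} (hne : L ≠ []) (h0 : h₀ ∈ degSubgroup S d)
    (hL : ∀ x ∈ L, x.1 ∈ cutGens S d ∧ x.2 ∈ degSubgroup S d)
    (hm : h₀ * pairProd L ∈ degSubgroup S d) :
    ∃ L₁ x y L₂, L = L₁ ++ x :: y :: L₂ ∧ x.1 * x.2 * y.1 ∈ degSubgroup S d := by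
  obtain ⟨L', hL', rfl⟩ : ∃ L' : List (AWord (Letters S) × AWord (Letters S)),
      (∀ x ∈ L', SingleCut d x.1 ∧ DegLT d x.2 ∧ x.2 ∈ RStar S) ∧
        L = L'.map (Prod.map elt elt) := by
    clear hm hne
    induction L with
    | nil => exact ⟨[], by simp, rfl⟩
    | cons x L ih =>
      obtain ⟨L', h2, rfl⟩ := ih fun y hy => hL y (List.mem_cons_of_mem _ hy)
      obtain ⟨⟨s, hs, e1⟩, ⟨w, hw, hwd, e2⟩⟩ := hL x List.mem_cons_self
      refine ⟨(s, w) :: L', ?_, by simp [e1, e2]⟩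
      intro y hy
      rcases List.mem_cons.1 hy with rfl | hy
      · exact ⟨hs, hwd, hw⟩
      · exact h2 y hy
  obtain ⟨L₁, x, y, L₂, rfl, hp⟩ := exists_pinch_words hd h1 (by rintro rfl; simp at hne) h0 hL' hm
  refine ⟨L₁.map (Prod.map elt elt), Prod.map elt elt x, Prod.map elt elt y,
    L₂.map (Prod.map elt elt), by simp, ?_⟩
  obtain ⟨hx, -, hx2⟩ := hL' x (by simp)
  obtain ⟨hy, -⟩ := hL' y (by simp)
  exact hp.mem_degSubgroup h1 hx hy hx2

/-- `σ` is a period of the word `z`. -/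
def IsPeriod {Γ : Type*} (z : AWord Γ) (σ : Polynomial ℤ) : Prop :=
  ∀ β, 1 ≤ β → β ≤ z.len → 1 ≤ β + σ → β + σ ≤ z.len → z.letter β = z.letter (β + σ)

/-- The periods of degree less than `d` of a word whose length has degree at least `d`. -/
def periodGroup {Γ : Type*} (d : ℕ) (z : AWord Γ) (hz : ¬ DegLT d z) :
    AddSubgroup (Polynomial ℤ) where
  carrier := {σ | σ ∈ Polynomial.degreeLT ℤ d ∧ IsPeriod z σ}
  zero_mem' := ⟨zero_mem _, fun β _ _ _ _ => by rw [add_zero]⟩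
  neg_mem' := by
    rintro σ ⟨h1, h2⟩
    refine ⟨neg_mem h1, fun β b1 b2 b3 b4 => ?_⟩
    have := h2 (β + -σ) b3 b4 (by rwa [neg_add_cancel_right]) (by rwa [neg_add_cancel_right])
    rw [this, neg_add_cancel_right]
  add_mem' := by
    rintro σ τ ⟨h1, h2⟩ ⟨h3, h4⟩
    refine ⟨add_mem h1 h3, fun β b1 b2 b3 b4 => ?_⟩
    rw [← add_assoc] at b3 b4 ⊢
    -- One of the intermediate positions `β + σ` and `β + τ` lies in the word. They cannot both be
    -- outside on the same side, as `β` and `β + σ + τ` are inside. On different sides, a difference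
    -- of degree less than `d` would bridge all of `z`.
    by_cases c1 : 1 ≤ β + σ ∧ β + σ ≤ z.len
    · rw [h2 β b1 b2 c1.1 c1.2, h4 _ c1.1 c1.2 b3 b4]
    by_cases c2 : 1 ≤ β + τ ∧ β + τ ≤ z.len
    · rw [h4 β b1 b2 c2.1 c2.2, h2 _ c2.1 c2.2 (by linarith) (by linarith), add_right_comm]
    exfalso
    have key : ∀ α α' : Polynomial ℤ, α ∈ Polynomial.degreeLT ℤ d →
        α' ∈ Polynomial.degreeLT ℤ d → ¬ (β + α < 1 ∧ z.len < β + α') := by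
      rintro α α' hα hα' ⟨e1, e2⟩
      refine hz (mem_degreeLT_of_le z.len_nonneg ?_ (sub_mem hα' hα))
      have e3 := poly_add_one_le_iff.2 e2
      linarith
    rw [not_and_or, not_le, not_le] at c1 c2
    rcases c1 with c1 | c1 <;> rcases c2 with c2 | c2
    · linarith
    · exact key _ _ h1 h3 ⟨c1, c2⟩
    · exact key _ _ h3 h1 ⟨c2, c1⟩
    · linarith

theorem IsPeriod.of_mul {Γ : Type*} {a z b : AWord Γ} {σ : Polynomial ℤ}
    (h : IsPeriod (a * z * b) σ) : IsPeriod z σ := by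
  intro β b1 b2 b3 b4
  have ha := a.len_nonneg
  have hb := b.len_nonneg
  have e : ∀ γ, 1 ≤ γ → γ ≤ z.len → (a * z * b).letter (a.len + γ) = z.letter γ := by
    intro γ g1 g2
    rw [letter_mul_left _ _ (by rw [len_mul]; linarith), letter_mul_right _ _ g1]
  rw [← e β b1 b2, ← e (β + σ) b3 b4, ← add_assoc]
  refine h _ (by linarith) ?_ (by linarith) ?_ <;> simp only [len_mul] <;> linarith

theorem IsPeriod.exists_eq {Γ : Type*} {z : AWord Γ} {σ : Polynomial ℤ} (h : IsPeriod z σ)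
    (h0 : 0 ≤ σ) (hl : σ ≤ z.len) :
    ∃ y p p', z = y * p ∧ z = p' * y ∧ p.len = σ ∧ p'.len = σ := by
  obtain ⟨y, p, e, hp⟩ := z.exists_split_right h0 hl
  obtain ⟨p', y', e', hp'⟩ := z.exists_split h0 hl
  have hl1 : z.len = y.len + σ := by rw [e, len_mul, hp]
  have hl2 : z.len = σ + y'.len := by rw [e', len_mul, hp']
  have : y = y' := by
    refine ext_letter (by linarith) fun β => ?_
    by_cases hβ : 1 ≤ β ∧ β ≤ y.len
    · have e1 := letter_mul_left y p hβ.2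
      have e2 := letter_mul_right p' y' hβ.1
      rw [← e] at e1
      rw [← e', hp', add_comm] at e2
      rw [← e1, ← e2]
      exact h β hβ.1 (by linarith [hβ.2]) (by linarith [hβ.1]) (by linarith [hβ.2])
    · rw [(letter_eq_none_iff _ _).2 hβ, (letter_eq_none_iff _ _).2]
      rwa [show y'.len = y.len by linarith]
  subst this
  exact ⟨y, p, p', e, e', hp, hp'⟩

theorem isNoetherian_degreeLT (d : ℕ) : IsNoetherian ℤ (Polynomial.degreeLT ℤ d) :=
  isNoetherian_of_linearEquiv (Polynomial.degreeLTEquiv ℤ d).symm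

/-- This is the ascending chain condition for subgroups of `ℤ ^ d`. -/
theorem exists_maximal_of_le_degreeLT {d : ℕ} {Q₀ : Set (AddSubgroup (Polynomial ℤ))}
    (hne : Q₀.Nonempty) (h : ∀ P ∈ Q₀, ∀ σ ∈ P, σ ∈ Polynomial.degreeLT ℤ d) :
    ∃ P ∈ Q₀, ∀ Q ∈ Q₀, P ≤ Q → Q ≤ P := by
  have := isNoetherian_degreeLT d
  let f : AddSubgroup (Polynomial ℤ) → Submodule ℤ (Polynomial.degreeLT ℤ d) := fun P =>
    (AddSubgroup.toIntSubmodule P).submoduleOf (Polynomial.degreeLT ℤ d)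
  obtain ⟨_, ⟨P, hP, rfl⟩, hmax⟩ := (wellFounded_gt (α := Submodule ℤ
    (Polynomial.degreeLT ℤ d))).has_min (f '' Q₀) (hne.image f)
  refine ⟨P, hP, fun Q hQ hPQ => ?_⟩
  have h2 : f P ≤ f Q := fun x hx => hPQ hx
  have h3 := hmax (f Q) ⟨Q, hQ, rfl⟩
  have h4 : f Q ≤ f P := by
    by_contra hc
    exact h3 (lt_of_le_not_ge h2 hc)
  intro σ hσ
  exact h4 (show (⟨σ, h Q hQ σ hσ⟩ : Polynomial.degreeLT ℤ d) ∈ f Q from hσ)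

theorem fg_of_le_degreeLT {d : ℕ} {P : AddSubgroup (Polynomial ℤ)}
    (h : ∀ σ ∈ P, σ ∈ Polynomial.degreeLT ℤ d) : P.FG := by
  have := isNoetherian_degreeLT d
  have h1 : ((AddSubgroup.toIntSubmodule P).submoduleOf (Polynomial.degreeLT ℤ d)).FG :=
    IsNoetherian.noetherian _
  have h2 := h1.map (Polynomial.degreeLT ℤ d).subtype
  rw [Submodule.submoduleOf, Submodule.map_comap_subtype, inf_eq_right.2 (fun σ hσ => h σ hσ),
    Submodule.fg_iff_addSubgroup_fg] at h2
  exact h2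

/-- A homomorphism on the positive cone of a linearly ordered group extends to the group. -/
theorem exists_hom_of_nonneg {A E : Type*} [AddCommGroup A] [LinearOrder A]
    [IsOrderedAddMonoid A] [Group E] (P : AddSubgroup A) (f : A → E)
    (hf : ∀ σ ∈ P, ∀ τ ∈ P, 0 ≤ σ → 0 ≤ τ → f (σ + τ) = f σ * f τ) :
    ∃ φ : P →+ Additive E, ∀ σ : P, 0 ≤ (σ : A) → (φ σ).toMul = f σ := by
  have hcomm : ∀ σ ∈ P, ∀ τ ∈ P, 0 ≤ σ → 0 ≤ τ → f σ * f τ = f τ * f σ := fun σ hσ τ hτ s0 t0 => by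
    rw [← hf σ hσ τ hτ s0 t0, ← hf τ hτ σ hσ t0 s0, add_comm]
  have h0 : f 0 = 1 := by
    have := hf 0 P.zero_mem 0 P.zero_mem le_rfl le_rfl
    rw [add_zero] at this
    exact mul_eq_left.1 this.symm
  have key : ∀ a ∈ P, ∀ b ∈ P, ∀ c ∈ P, ∀ e ∈ P, 0 ≤ a → 0 ≤ b → 0 ≤ c → 0 ≤ e →
      a - b = c - e → f a * (f b)⁻¹ = f c * (f e)⁻¹ := by
    intro a ha b hb c hc e he a0 b0 c0 e0 h
    have h2 : a + e = c + b := by rw [sub_eq_sub_iff_add_eq_add] at h; exact h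
    have h3 : f a * f e = f c * f b := by
      rw [← hf a ha e he a0 e0, ← hf c hc b hb c0 b0, h2]
    have h4 : f e * f b = f b * f e := hcomm e he b hb e0 b0
    rw [mul_inv_eq_iff_eq_mul]
    have c1 : Commute (f e) (f b) := h4
    rw [mul_assoc, c1.inv_left.eq, ← mul_assoc, ← h3]
    group
  have hp : ∀ σ ∈ P, max σ 0 ∈ P := fun σ hσ => by
    rcases max_choice σ 0 with h | h <;> rw [h]
    exacts [hσ, P.zero_mem]
  have hmm : ∀ σ : A, max σ 0 - max (-σ) 0 = σ := fun σ => by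
    rcases le_total σ 0 with h | h
    · rw [max_eq_right h, max_eq_left (neg_nonneg.2 h)]; abel
    · rw [max_eq_left h, max_eq_right (neg_nonpos.2 h)]; abel
  -- The extension is `f σ⁺ * (f σ⁻)⁻¹`; by `key`, any other way to write `σ` as a difference of
  -- nonnegative elements of `P` gives the same value.
  refine ⟨AddMonoidHom.mk' (fun σ => Additive.ofMul
    (f (max (σ : A) 0) * (f (max (-(σ : A)) 0))⁻¹)) ?_, ?_⟩
  · intro σ τ
    have s1 := hp σ σ.2
    have s2 := hp _ (P.neg_mem σ.2)
    have t1 := hp τ τ.2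
    have t2 := hp _ (P.neg_mem τ.2)
    have e1 := key _ (hp _ (P.add_mem σ.2 τ.2)) _ (hp _ (P.neg_mem (P.add_mem σ.2 τ.2)))
      _ (P.add_mem s1 t1) _ (P.add_mem s2 t2) (le_max_right _ _) (le_max_right _ _)
      (add_nonneg (le_max_right _ _) (le_max_right _ _))
      (add_nonneg (le_max_right _ _) (le_max_right _ _))
      (by rw [hmm, add_sub_add_comm, hmm, hmm])
    rw [← ofMul_mul]
    congr 1
    rw [AddSubgroup.coe_add, e1, hf _ s1 _ t1 (le_max_right _ _) (le_max_right _ _),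
      add_comm, hf _ t2 _ s2 (le_max_right _ _) (le_max_right _ _), mul_inv_rev]
    have c1 : Commute (f (max (τ : A) 0)) (f (max (-(σ : A)) 0)) :=
      hcomm _ t1 _ s2 (le_max_right _ _) (le_max_right _ _)
    rw [mul_assoc, ← mul_assoc (f (max (τ : A) 0)), c1.inv_right.eq]
    simp only [mul_assoc]
  · intro σ h
    change f (max (σ : A) 0) * (f (max (-(σ : A)) 0))⁻¹ = _
    rw [max_eq_left h, max_eq_right (neg_nonpos.2 h), h0, inv_one, mul_one]

end Elements

/-! ### Stabilisers of cuts come from periods -/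

section Periods

variable {G : Type*} [Group G] {S : Set G}

open AWord

theorem AWord.DegLT.len_max {Γ : Type*} {d : ℕ} {p q : AWord Γ} (hp : DegLT d p)
    (hq : DegLT d q) : max p.len q.len ∈ Polynomial.degreeLT ℤ d := by
  rcases max_choice p.len q.len with h | h <;> rw [h] <;> assumption

theorem le_len_of_not_degLT {Γ : Type*} {d : ℕ} {σ : Polynomial ℤ} {z : AWord Γ}
    (hσ : σ ∈ Polynomial.degreeLT ℤ d) (hz : ¬ DegLT d z) : σ ≤ z.len := by
  by_contra h
  exact hz (mem_degreeLT_of_le z.len_nonneg (not_le.1 h).le hσ)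

/-- The quotient of the two suffixes of `s` after two occurrences of one factor depends only on the
shift. Prolonging `b₁` and `e₁` to the left by suffixes of `z` and `y` to a common length does the
same for `b₂` and `e₂`, and suffixes of `s` of equal length coincide. -/
theorem suffix_quotient_eq {d : ℕ} {s a₁ z b₁ a₂ b₂ c₁ y e₁ c₂ e₂ : AWord (Letters S)}
    (hs : SingleCut d s) (h1 : s = a₁ * z * b₁) (h2 : s = a₂ * z * b₂) (h3 : s = c₁ * y * e₁)
    (h4 : s = c₂ * y * e₂) (hz : ¬ DegLT d z) (hy : ¬ DegLT d y)
    (hl : b₂.len - b₁.len = e₂.len - e₁.len) :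
    (elt b₁)⁻¹ * elt b₂ = (elt e₁)⁻¹ * elt e₂ := by
  have sb := (hs.degLT_of_eq h1 hz).2.1
  have se := (hs.degLT_of_eq h3 hy).2.1
  have hN := sb.len_max se
  obtain ⟨z', x, rfl, hx⟩ := z.exists_split_right
    (sub_nonneg.2 (le_max_left b₁.len e₁.len)) (le_len_of_not_degLT (sub_mem hN sb) hz)
  obtain ⟨y', w, rfl, hw⟩ := y.exists_split_right
    (sub_nonneg.2 (le_max_right b₁.len e₁.len)) (le_len_of_not_degLT (sub_mem hN se) hy)
  have aux : ∀ p q p' q' : AWord (Letters S), s = p * q → s = p' * q' → q.len = q'.len →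
      q = q' := by
    intro p q p' q' e e' hlen
    refine (mul_cancel (e.symm.trans e') ?_).2
    have := congrArg AWord.len e
    rw [e', len_mul, len_mul] at this
    linarith
  have k1 : x * b₁ = w * e₁ := aux (a₁ * z') _ (c₁ * y') _ (by rw [h1]; simp only [mul_assoc])
    (by rw [h3]; simp only [mul_assoc]) (by simp only [len_mul]; linarith)
  have k2 : x * b₂ = w * e₂ := aux (a₂ * z') _ (c₂ * y') _ (by rw [h2]; simp only [mul_assoc])
    (by rw [h4]; simp only [mul_assoc]) (by simp only [len_mul]; linarith)
  have r1 := hs.1; rw [h1] at r1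
  have r2 := hs.1; rw [h2] at r2
  have r3 := hs.1; rw [h3] at r3
  have r4 := hs.1; rw [h4] at r4
  have rx := r1.left.right.right.mem_RStar
  have rw' := r3.left.right.right.mem_RStar
  have k1' := congrArg elt k1
  have k2' := congrArg elt k2
  rw [elt_mul rx r1.right.mem_RStar, elt_mul rw' r3.right.mem_RStar] at k1'
  rw [elt_mul rx r2.right.mem_RStar, elt_mul rw' r4.right.mem_RStar] at k2'
  calc (elt b₁)⁻¹ * elt b₂ = (elt x * elt b₁)⁻¹ * (elt x * elt b₂) := by group
    _ = (elt e₁)⁻¹ * elt e₂ := by rw [k1', k2']; group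

/-- A homomorphism from a group of polynomials of degree less than `d` to `Ext(ℤ[t], G)` which maps
every `σ ≥ 0` to an element represented by a reduced word of length `σ`. -/
structure IsPeriodHom (d : ℕ) {P : AddSubgroup (Polynomial ℤ)} (φ : P →+ Additive (Ext S)) :
    Prop where
  le : ∀ σ ∈ P, σ ∈ Polynomial.degreeLT ℤ d
  exists_word : ∀ σ : P, 0 ≤ (σ : Polynomial ℤ) →
    ∃ u : AWord (Letters S), IsGReduced u ∧ u.len = σ ∧ elt u = (φ σ).toMul

/-- A period `σ ≥ 0` is sent to the suffix of `z` of length `σ`. Additivity is periodicity: in the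
suffix `q p` of length `σ + τ`, the part `q` ends `y`, where `z = y p = p' y`; hence `q` also ends
`z`. -/
theorem exists_isPeriodHom {d : ℕ} {z : AWord (Letters S)} (hr : IsGReduced z)
    (hz : ¬ DegLT d z) : ∃ φ : periodGroup d z hz →+ Additive (Ext S), IsPeriodHom d φ ∧
      ∀ (σ : periodGroup d z hz) (y p : AWord (Letters S)), z = y * p → p.len = σ →
        (φ σ).toMul = elt p := by
  classical
  obtain ⟨f, hf⟩ : ∃ f : Polynomial ℤ → Ext S, ∀ σ y p, z = y * p → p.len = σ → f σ = elt p := by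
    refine ⟨fun σ => if h : ∃ p, ∃ y, z = y * p ∧ p.len = σ then elt h.choose else 1, ?_⟩
    intro σ y p e hp
    have h : ∃ p, ∃ y, z = y * p ∧ p.len = σ := ⟨p, y, e, hp⟩
    simp only [dif_pos h]
    obtain ⟨y', e', hp'⟩ := h.choose_spec
    congr 1
    refine (mul_cancel (e'.symm.trans e) ?_).2
    have := congrArg AWord.len e
    rw [e', len_mul, len_mul] at this
    rw [hp', hp] at this
    linarith
  have hex : ∀ σ ∈ periodGroup d z hz, 0 ≤ σ → ∃ y p p', z = y * p ∧ z = p' * y ∧ p.len = σ ∧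
      p'.len = σ := fun σ hσ h0 => hσ.2.exists_eq h0 (le_len_of_not_degLT hσ.1 hz)
  obtain ⟨φ, hφ⟩ := exists_hom_of_nonneg (periodGroup d z hz) f (by
    intro σ hσ τ hτ s0 t0
    obtain ⟨y, p, p', e1, e2, h1, h2⟩ := hex τ hτ t0
    have hy : ¬ DegLT d y := by
      intro h
      apply hz
      rw [e1]
      refine degLT_mul.2 ⟨h, ?_⟩
      rw [DegLT, h1]
      exact hτ.1
    obtain ⟨x, q, rfl, hq⟩ := y.exists_split_right s0 (le_len_of_not_degLT hσ.1 hy)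
    have rz := hr
    rw [e1] at rz
    rw [hf (σ + τ) x (q * p) (by rw [e1, mul_assoc]) (by rw [len_mul, h1, hq]),
      hf τ _ p e1 h1, hf σ (p' * x) q (by rw [e2, mul_assoc]) hq,
      elt_mul rz.left.right.mem_RStar rz.right.mem_RStar])
  have hval : ∀ (σ : periodGroup d z hz) (y p : AWord (Letters S)), z = y * p → p.len = σ →
      (φ σ).toMul = elt p := fun σ y p e hp => by
    rw [hφ σ (by rw [← hp]; exact p.len_nonneg)]
    exact hf σ y p e hp
  refine ⟨φ, ⟨fun σ hσ => hσ.1, fun σ h0 => ?_⟩, hval⟩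
  obtain ⟨y, p, p', e1, e2, h1, h2⟩ := hex σ σ.2 h0
  refine ⟨p, ?_, h1, (hval σ y p e1 h1).symm⟩
  rw [e1] at hr
  exact hr.right

/-- `z` lies inside the second occurrence of `z₁`, and the first occurrence is the second one moved
by the claimed period. -/
theorem isPeriod_of_two_factors {s a z b a₁ z₁ b₁ a₂ b₂ : AWord (Letters S)}
    (h : s = a * z * b) (h1 : s = a₁ * z₁ * b₁) (h2 : s = a₂ * z₁ * b₂)
    (ha : a₂.len ≤ a.len) (hb : b₂.len ≤ b.len) : IsPeriod z (b₂.len - b₁.len) := by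
  intro β k1 k2 k3 k4
  have l0 := congrArg AWord.len h
  have l1 := congrArg AWord.len h1
  have l2 := congrArg AWord.len h2
  simp only [len_mul] at l0 l1 l2
  have nb := b.len_nonneg
  have nb1 := b₁.len_nonneg
  have nb2 := b₂.len_nonneg
  have e0 : ∀ γ, 1 ≤ γ → γ ≤ z.len → s.letter (a.len + γ) = z.letter γ := by
    intro γ g1 g2
    rw [h, letter_mul_left _ _ (by rw [len_mul]; linarith), letter_mul_right _ _ g1]
  have e1 : ∀ γ, 1 ≤ γ → γ ≤ z₁.len → s.letter (a₁.len + γ) = z₁.letter γ := by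
    intro γ g1 g2
    rw [h1, letter_mul_left _ _ (by rw [len_mul]; linarith), letter_mul_right _ _ g1]
  have e2 : ∀ γ, 1 ≤ γ → γ ≤ z₁.len → s.letter (a₂.len + γ) = z₁.letter γ := by
    intro γ g1 g2
    rw [h2, letter_mul_left _ _ (by rw [len_mul]; linarith), letter_mul_right _ _ g1]
  have g1 : 1 ≤ a.len + β - a₂.len := by linarith
  have g2 : a.len + β - a₂.len ≤ z₁.len := by linarith
  rw [← e0 β k1 k2, ← e0 _ k3 k4]
  have f1 := e1 _ g1 g2
  have f2 := e2 _ g1 g2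
  rw [show a.len + β = a₂.len + (a.len + β - a₂.len) by ring, f2, ← f1]
  congr 1
  linear_combination l2 - l1

theorem pinch_of_mem_degSubgroup {d : ℕ} (hd : 1 ≤ d) (h1 : (1 : G) ∉ S)
    {s h s' : AWord (Letters S)} (hs : SingleCut d s) (hs' : SingleCut d s') (hh : h ∈ RStar S)
    (hhd : DegLT d h) (hm : elt s * elt h * elt s' ∈ degSubgroup S d) : Pinch d s h s' := by
  obtain ⟨L₁, x, y, L₂, e, hp⟩ := exists_pinch_words hd h1 (h₀ := 1) (L := [(s, h), (s', 1)])
    (by simp) (one_mem _) (by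
      intro x hx
      simp only [List.mem_cons, List.not_mem_nil, or_false] at hx
      rcases hx with rfl | rfl
      exacts [⟨hs, hhd, hh⟩, ⟨hs', degLT_one d, one_mem _⟩]) (by
      simpa [elt_one] using hm)
  match L₁, e with
  | [], e =>
    simp only [List.nil_append, List.cons.injEq] at e
    obtain ⟨rfl, rfl, -⟩ := e
    exact hp
  | [_], e => simp at e
  | _ :: _ :: _, e => simp at e

/-- The stabiliser of a cut is conjugate to the image of a group of periods. -/
theorem exists_cut_stabilizer {d : ℕ} (hd : 1 ≤ d) (h1 : (1 : G) ∉ S) {s : AWord (Letters S)}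
    (hs : SingleCut d s) : ∃ (b : AWord (Letters S)) (P : AddSubgroup (Polynomial ℤ))
      (φ : P →+ Additive (Ext S)), IsGReduced b ∧ DegLT d b ∧ IsPeriodHom d φ ∧
      ∀ h, (h ∈ degSubgroup S d ∧ elt s * h * (elt s)⁻¹ ∈ degSubgroup S d) ↔
        ∃ σ : P, h = (elt b)⁻¹ * (φ σ).toMul * elt b := by
  -- Shrinking `z` can only enlarge its group of periods. For a maximal group, no further shrinking
  -- of `z` to a factor of degree at least `d` produces new periods.
  obtain ⟨P, ⟨a, z, b, hz, rfl, rfl⟩, hmax⟩ := exists_maximal_of_le_degreeLT (d := d)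
    (Q₀ := {P | ∃ (a z b : AWord (Letters S)) (hz : ¬ DegLT d z), s = a * z * b ∧
      P = periodGroup d z hz}) ⟨_, 1, s, 1, hs.not_degLT, by simp, rfl⟩ (by
      rintro _ ⟨a, z, b, hz, -, rfl⟩ σ hσ
      exact hσ.1)
  have hr := hs.1
  obtain ⟨ha, hb, hzc⟩ := hs.degLT_of_eq rfl hz
  obtain ⟨φ, hφ, hval⟩ := exists_isPeriodHom hr.left.right hz
  refine ⟨b, periodGroup d z hz, φ, hr.right, hb, hφ, fun h => ⟨?_, ?_⟩⟩
  · rintro ⟨⟨w, hw, hwd, rfl⟩, hm⟩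
    rw [← elt_bar hr.mem_RStar] at hm
    obtain ⟨a₁, z₁, b₁, c, e, k1, k2, hz1, hT⟩ := pinch_of_mem_degSubgroup hd h1 hs hs.bar hw hwd hm
    have k3 : a * z * b = e.bar * z₁ * c.bar := by
      have := congrArg AWord.bar k2
      rw [bar_bar] at this
      rw [this]; simp only [bar_mul, bar_bar, mul_assoc]
    have r1 := hr; rw [k1] at r1
    have r2 := hr; rw [k3] at r2
    obtain ⟨sa1, sb1, -⟩ := hs.degLT_of_eq k1 hz1
    obtain ⟨se, sc, -⟩ := hs.degLT_of_eq k3 hz1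
    have hwe : elt w = (elt b₁)⁻¹ * elt c.bar := by
      have rc : c ∈ RStar S := r2.right.of_bar.mem_RStar
      have := (elt_eq_one_iff h1 (mul_mem (mul_mem r1.right.mem_RStar hw) rc)).2 hT
      rw [elt_mul (mul_mem r1.right.mem_RStar hw) rc, elt_mul r1.right.mem_RStar hw] at this
      rw [elt_bar rc, eq_inv_mul_iff_mul_eq, eq_inv_iff_mul_eq_one]
      exact this
    have hσ : c.bar.len - b₁.len ∈ periodGroup d z hz := by
      have ne := e.len_nonneg
      have nc := c.len_nonneg
      -- `z` is trimmed by the lengths of `e` and `c`, so that the remainder lies inside the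
      -- occurrence `ē z₁ c̄`. These lengths have degree less than `d`, so the remainder still has
      -- degree at least `d`.
      obtain ⟨a', z', e1, hla⟩ := z.exists_split e.len_nonneg (le_len_of_not_degLT se hz)
      have hz' : ¬ DegLT d z' := by
        intro hc
        apply hz; rw [e1]
        refine degLT_mul.2 ⟨?_, hc⟩
        rw [DegLT, hla]; exact se
      obtain ⟨z'', b', e2, hlb⟩ := z'.exists_split_right c.len_nonneg (le_len_of_not_degLT sc hz')
      have hz'' : ¬ DegLT d z'' := by
        intro hc
        apply hz'; rw [e2]
        refine degLT_mul.2 ⟨hc, ?_⟩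
        rw [DegLT, hlb]; exact sc
      refine hmax _ ⟨a * a', z'', b' * b, hz'', by rw [e1, e2]; simp only [mul_assoc], rfl⟩ ?_ ?_
      · intro σ hσ
        refine ⟨hσ.1, ?_⟩
        have := hσ.2
        rw [e1, e2, ← mul_assoc] at this
        exact this.of_mul
      · refine ⟨sub_mem sc sb1, ?_⟩
        refine isPeriod_of_two_factors (a := a * a') (b := b' * b) ?_ k1 k3 ?_ ?_
        · rw [e1, e2]; simp only [mul_assoc]
        · simp only [len_mul, len_bar, hla]
          linarith [a.len_nonneg]
        · simp only [len_mul, len_bar, hlb]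
          linarith [b.len_nonneg]
    have main : ∀ (σ : periodGroup d z hz) (a₁ b₁ a₂ b₂ : AWord (Letters S)),
        a * z * b = a₁ * z₁ * b₁ → a * z * b = a₂ * z₁ * b₂ → 0 ≤ (σ : Polynomial ℤ) →
        b₂.len - b₁.len = σ → (elt b₁)⁻¹ * elt b₂ = (elt b)⁻¹ * (φ σ).toMul * elt b := by
      intro σ a₁ b₁ a₂ b₂ k1 k3 h0 hlen
      obtain ⟨y, p, p', e1, e2, hp, hp'⟩ := σ.2.2.exists_eq h0 (le_len_of_not_degLT σ.2.1 hz)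
      have hy : ¬ DegLT d y := by
        intro hc
        apply hz; rw [e1]
        refine degLT_mul.2 ⟨hc, ?_⟩
        rw [DegLT, hp]; exact σ.2.1
      have rp : IsGReduced p := by
        have := hr.left.right
        rw [e1] at this
        exact this.right
      rw [hval σ y p e1 hp, mul_assoc, ← elt_mul rp.mem_RStar hr.right.mem_RStar]
      refine suffix_quotient_eq (z := z₁) (y := y) (c₁ := a * p') (c₂ := a) hs k1 k3 ?_ ?_ hz1 hy ?_
      · rw [e2]; simp only [mul_assoc]
      · rw [e1]; simp only [mul_assoc]
      · rw [hlen, len_mul, hp]; ring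
    rw [hwe]
    rcases le_total 0 (c.bar.len - b₁.len) with h0 | h0
    · exact ⟨⟨_, hσ⟩, main ⟨_, hσ⟩ a₁ b₁ _ _ k1 k3 h0 rfl⟩
    · refine ⟨⟨_, hσ⟩, ?_⟩
      have := main (-⟨_, hσ⟩) _ _ a₁ b₁ k3 k1 (by simpa using h0) (by simp)
      rw [map_neg, toMul_neg] at this
      have h2 := congrArg (·⁻¹) this
      simp only [mul_inv_rev, inv_inv, mul_assoc] at h2 ⊢
      exact h2
  · have pos : ∀ σ : periodGroup d z hz, 0 ≤ (σ : Polynomial ℤ) →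
        (elt b)⁻¹ * (φ σ).toMul * elt b ∈ degSubgroup S d ∧
        elt (a * z * b) * ((elt b)⁻¹ * (φ σ).toMul * elt b) * (elt (a * z * b))⁻¹ ∈
          degSubgroup S d := by
      intro σ h0
      obtain ⟨y, p, p', e1, e2, hp, hp'⟩ := σ.2.2.exists_eq h0 (le_len_of_not_degLT σ.2.1 hz)
      have rz := hr.left.right
      have rz1 := rz; rw [e1] at rz1
      have rz2 := rz; rw [e2] at rz2
      have mb := elt_mem_degSubgroup hr.right.mem_RStar hb
      have ma := elt_mem_degSubgroup hr.left.left.mem_RStar ha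
      have mp : elt p ∈ degSubgroup S d := elt_mem_degSubgroup rz1.right.mem_RStar (by
        rw [DegLT, hp]; exact σ.2.1)
      have mp' : elt p' ∈ degSubgroup S d := elt_mem_degSubgroup rz2.left.mem_RStar (by
        rw [DegLT, hp']; exact σ.2.1)
      have f1 : elt z = elt y * elt p := by
        rw [← elt_mul rz1.left.mem_RStar rz1.right.mem_RStar, ← e1]
      have f2 : elt z = elt p' * elt y := by
        rw [← elt_mul rz2.left.mem_RStar rz2.right.mem_RStar, ← e2]
      rw [hval σ y p e1 hp, elt_mul hr.left.mem_RStar hr.right.mem_RStar,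
        elt_mul hr.left.left.mem_RStar rz.mem_RStar]
      refine ⟨mul_mem (mul_mem (inv_mem mb) mp) mb, ?_⟩
      have : elt a * elt z * elt b * ((elt b)⁻¹ * elt p * elt b) * (elt a * elt z * elt b)⁻¹ =
          elt a * elt p' * (elt a)⁻¹ := by
        -- From `z = y p = p' y`: conjugation by `z` takes the suffix `p` to the prefix `p'`, which
        -- has the same length.
        have f3 : elt z * elt p = elt p' * elt z := by rw [f2, mul_assoc, ← f1, f2]
        calc _ = elt a * (elt z * elt p) * (elt z)⁻¹ * (elt a)⁻¹ := by group
          _ = _ := by rw [f3]; group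
      rw [this]
      exact mul_mem (mul_mem ma mp') (inv_mem ma)
    rintro ⟨σ, rfl⟩
    rcases le_total 0 (σ : Polynomial ℤ) with h0 | h0
    · exact pos σ h0
    · have := pos (-σ) (by simpa using h0)
      have k1 := inv_mem this.1
      have k2 := inv_mem this.2
      rw [map_neg, toMul_neg] at k1 k2
      simp only [mul_inv_rev, inv_inv, mul_assoc] at k1 k2 ⊢
      exact ⟨k1, k2⟩

end Periods

/-! # Computable functions on lists -/

section Computability

variable {α β σ : Type*} [Primcodable α] [Primcodable β] [Primcodable σ]

theorem computable_list_foldl {f : α → List β} {g : α → σ} {h : α → σ × β → σ}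
    (hf : Computable f) (hg : Computable g) (hh : Computable₂ h) :
    Computable fun a => (f a).foldl (fun s b => h a (s, b)) (g a) := by
  have h1 : Computable fun a => Nat.rec (motive := fun _ => σ) (g a)
      (fun k s => Option.casesOn ((f a)[k]?) s (fun b => h a (s, b))) (f a).length := by
    refine Computable.nat_rec (Computable.list_length.comp hf) hg
      (h := fun a p => Option.casesOn ((f a)[p.1]?) p.2 (fun b => h a (p.2, b))) ?_
    refine Computable.option_casesOn
      (Computable.list_getElem?.comp (hf.comp Computable.fst)
        (Computable.fst.comp Computable.snd)) (Computable.snd.comp Computable.snd) ?_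
    exact hh.comp (Computable.fst.comp Computable.fst)
      (Computable.pair (Computable.snd.comp (Computable.snd.comp Computable.fst)) Computable.snd)
  refine h1.of_eq fun a => ?_
  have key : ∀ k ≤ (f a).length, Nat.rec (motive := fun _ => σ) (g a)
      (fun k s => Option.casesOn ((f a)[k]?) s (fun b => h a (s, b))) k =
      ((f a).take k).foldl (fun s b => h a (s, b)) (g a) := by
    intro k hk
    induction k with
    | zero => rfl
    | succ k ih =>
      have hk' : k < (f a).length := hk
      simp only [ih hk'.le]
      rw [List.getElem?_eq_getElem hk', List.take_succ_eq_append_getElem hk', List.foldl_append]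
      rfl
  rw [key _ le_rfl, List.take_length]

theorem computable_list_foldr {f : α → List β} {g : α → σ} {h : α → β × σ → σ}
    (hf : Computable f) (hg : Computable g) (hh : Computable₂ h) :
    Computable fun a => (f a).foldr (fun b s => h a (b, s)) (g a) := by
  have := computable_list_foldl (f := fun a => (f a).reverse) (h := fun a p => h a (p.2, p.1))
    (Computable.list_reverse.comp hf) hg
    (hh.comp Computable.fst (Computable.pair (Computable.snd.comp Computable.snd)
      (Computable.fst.comp Computable.snd)))
  exact this.of_eq fun a => by rw [List.foldl_reverse]

theorem computable_fin {n : ℕ} {f : Fin n → α → σ} (hf : ∀ i, Computable (f i)) : Computable₂ f :=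
  (Computable.vector_get.comp ((Computable.vector_ofFn hf).comp Computable.snd)
    Computable.fst).of_eq fun a => by simp

theorem computablePred_iff_bool {p : α → Prop} :
    ComputablePred p ↔ ∃ f : α → Bool, Computable f ∧ ∀ a, p a ↔ f a = true := by
  rw [ComputablePred.computable_iff]
  constructor
  · rintro ⟨f, hf, rfl⟩; exact ⟨f, hf, fun a => Iff.rfl⟩
  · rintro ⟨f, hf, h⟩; exact ⟨f, hf, funext fun a => propext (h a)⟩

theorem computablePred_comp {p : β → Prop} (hp : ComputablePred p) {f : α → β}
    (hf : Computable f) : ComputablePred fun a => p (f a) := by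
  obtain ⟨c, hc, h⟩ := computablePred_iff_bool.1 hp
  exact computablePred_iff_bool.2 ⟨_, hc.comp hf, fun a => h (f a)⟩

theorem computablePred_or {p q : α → Prop} (hp : ComputablePred p) (hq : ComputablePred q) :
    ComputablePred fun a => p a ∨ q a := by
  obtain ⟨c, hc, h⟩ := computablePred_iff_bool.1 hp
  obtain ⟨c', hc', h'⟩ := computablePred_iff_bool.1 hq
  exact computablePred_iff_bool.2 ⟨fun a => c a || c' a, Primrec.or.to_comp.comp hc hc',
    fun a => by simp [h, h']⟩

theorem computablePred_and {p q : α → Prop} (hp : ComputablePred p) (hq : ComputablePred q) :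
    ComputablePred fun a => p a ∧ q a := by
  obtain ⟨c, hc, h⟩ := computablePred_iff_bool.1 hp
  obtain ⟨c', hc', h'⟩ := computablePred_iff_bool.1 hq
  exact computablePred_iff_bool.2 ⟨fun a => c a && c' a, Primrec.and.to_comp.comp hc hc',
    fun a => by simp [h, h']⟩

theorem computablePred_exists_lt {p : ℕ → α → Prop} (hp : ComputablePred fun x : ℕ × α => p x.1 x.2)
    {f : α → ℕ} (hf : Computable f) : ComputablePred fun a => ∃ k < f a, p k a := by
  obtain ⟨c, hc, h⟩ := computablePred_iff_bool.1 hp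
  refine computablePred_iff_bool.2 ⟨fun a => Nat.rec (motive := fun _ => Bool) false
    (fun k s => s || c (k, a)) (f a), ?_, fun a => ?_⟩
  · refine Computable.nat_rec hf (Computable.const _) (h := fun a x => x.2 || c (x.1, a)) ?_
    exact Primrec.or.to_comp.comp (Computable.snd.comp Computable.snd) (hc.comp
      (Computable.pair (Computable.fst.comp Computable.snd) Computable.fst))
  · beta_reduce
    generalize f a = m
    induction m with
    | zero => simp
    | succ m ih =>
      simp only [Bool.or_eq_true, ← ih, ← h]
      constructor
      · rintro ⟨k, hk, h⟩
        rcases Nat.lt_succ_iff_lt_or_eq.1 hk with h' | rfl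
        exacts [Or.inl ⟨k, h', h⟩, Or.inr h]
      · rintro (⟨k, hk, h⟩ | h)
        exacts [⟨k, hk.trans (Nat.lt_succ_self _), h⟩, ⟨m, Nat.lt_succ_self _, h⟩]

theorem computablePred_forall_mem {p : β → Prop} (hp : ComputablePred p) {f : α → List β}
    (hf : Computable f) : ComputablePred fun a => ∀ b ∈ f a, p b := by
  obtain ⟨c, hc, h⟩ := computablePred_iff_bool.1 hp
  refine computablePred_iff_bool.2 ⟨fun a => (f a).foldr (fun b s => c b && s) true,
    computable_list_foldr hf (Computable.const _) (h := fun _ x => c x.1 && x.2) ?_, fun a => ?_⟩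
  · exact Primrec.and.to_comp.comp (hc.comp (Computable.fst.comp Computable.snd))
      (Computable.snd.comp Computable.snd)
  · beta_reduce
    induction f a with
    | nil => simp
    | cons b l ih => simp [← ih, h]

/-- Unbounded search through the codes of elements of `β`, which ends because a solution exists. -/
theorem exists_computable_choice {p : α → β → Prop}
    (hp : ComputablePred fun x : α × β => p x.1 x.2) (h : ∀ a, ∃ b, p a b) :
    ∃ f : α → β, Computable f ∧ ∀ a, p a (f a) := by
  classical
  rcases isEmpty_or_nonempty α with hα | ⟨⟨a₀⟩⟩
  · exact ⟨fun a => (hα.false a).elim, (Primrec.dom_finite _).to_comp,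
      fun a => (hα.false a).elim⟩
  obtain ⟨b₀, -⟩ := h a₀
  let D : ℕ → β := fun k => (Encodable.decode (α := β) k).getD b₀
  have hD : Computable D := Computable.option_getD Computable.decode (Computable.const b₀)
  have h1 : ∀ a, ∃ k, p a (D k) := fun a => by
    obtain ⟨b, hb⟩ := h a
    exact ⟨Encodable.encode b, by simpa [D] using hb⟩
  have h2 : Computable fun a => Nat.find (h1 a) := by
    refine Computable.find (P := fun a k => p a (D k)) ?_ h1
    exact computablePred_comp hp (Computable.pair Computable.fst (hD.comp Computable.snd))
  exact ⟨fun a => D (Nat.find (h1 a)), hD.comp h2, fun a => Nat.find_spec (h1 a)⟩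

end Computability

/-! # Computable families of group elements -/

section Families

variable {E : Type*} [Group E] {α β : Type*} [Primcodable α] [Primcodable β]

/-- The element represented by a list of indices of a family of group elements. -/
def famProd {n : ℕ} (f : Fin n → E) (l : List (Fin n)) : E := (l.map f).prod

@[simp] theorem famProd_nil {n : ℕ} (f : Fin n → E) : famProd f [] = 1 := rfl

@[simp] theorem famProd_cons {n : ℕ} (f : Fin n → E) (i : Fin n) (l : List (Fin n)) :
    famProd f (i :: l) = f i * famProd f l := by simp [famProd]

@[simp] theorem famProd_append {n : ℕ} (f : Fin n → E) (l l' : List (Fin n)) :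
    famProd f (l ++ l') = famProd f l * famProd f l' := by simp [famProd]

theorem famProd_flatMap {m n : ℕ} {f : Fin n → E} {g : Fin m → E} {w : Fin m → List (Fin n)}
    (h : ∀ i, famProd f (w i) = g i) (l : List (Fin m)) :
    famProd f (l.flatMap w) = famProd g l := by
  induction l with
  | nil => simp
  | cons i l ih => simp [ih, h]

theorem famProd_mem {n : ℕ} {f : Fin n → E} {M : Submonoid E} (h : ∀ i, f i ∈ M)
    (l : List (Fin n)) : famProd f l ∈ M := by
  induction l with
  | nil => exact one_mem _
  | cons i l ih => rw [famProd_cons]; exact mul_mem (h i) ih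

theorem computable_flatMap {m n : ℕ} (w : Fin m → List (Fin n)) :
    Computable fun l : List (Fin m) => l.flatMap w :=
  (Primrec.list_flatMap Primrec.id ((Primrec.dom_finite w).comp₂ Primrec₂.right)).to_comp

/-- Finitely many elements of the submonoid generated by `X` are represented by words over a
finite family of elements of `X`. -/
theorem exists_family (X : Set E) (Y : List E) (hY : ∀ y ∈ Y, y ∈ Submonoid.closure X) :
    ∃ (n : ℕ) (f : Fin n → E), (∀ i, f i ∈ X) ∧ ∀ y ∈ Y, ∃ w, famProd f w = y := by
  have h : ∃ T : List E, (∀ x ∈ T, x ∈ X) ∧ ∀ y ∈ Y, ∃ L : List E, (∀ x ∈ L, x ∈ T) ∧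
      L.prod = y := by
    induction Y with
    | nil => exact ⟨[], by simp, by simp⟩
    | cons y Y ih =>
      obtain ⟨T, hT, h⟩ := ih fun y hy => hY y (List.mem_cons_of_mem _ hy)
      obtain ⟨L, hL, rfl⟩ := Submonoid.exists_list_of_mem_closure (hY y List.mem_cons_self)
      refine ⟨L ++ T, ?_, ?_⟩
      · intro x hx
        rcases List.mem_append.1 hx with hx | hx
        exacts [hL x hx, hT x hx]
      · intro z hz
        rcases List.mem_cons.1 hz with rfl | hz
        · exact ⟨L, fun x hx => List.mem_append_left _ hx, rfl⟩
        · obtain ⟨L', h1, h2⟩ := h z hz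
          exact ⟨L', fun x hx => List.mem_append_right _ (h1 x hx), h2⟩
  obtain ⟨T, hT, h⟩ := h
  refine ⟨T.length, T.get, fun i => hT _ (List.get_mem T i), fun y hy => ?_⟩
  obtain ⟨L, hL, rfl⟩ := h y hy
  clear hy h hY
  induction L with
  | nil => exact ⟨[], rfl⟩
  | cons x L ih =>
    obtain ⟨w, hw⟩ := ih fun x hx => hL x (List.mem_cons_of_mem _ hx)
    obtain ⟨i, hi⟩ := List.mem_iff_get.1 (hL x List.mem_cons_self)
    exact ⟨i :: w, by rw [famProd_cons, hw, hi, List.prod_cons]⟩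

/-- Membership in `H` is decidable for words over finite families of elements of `X`. -/
def DecOn (H X : Set E) : Prop :=
  ∀ (n : ℕ) (f : Fin n → E), (∀ i, f i ∈ X) →
    ComputablePred fun l : List (Fin n) => famProd f l ∈ H

/-- Words over a finite family of elements of `X` which represent the values of `g` can be
computed. -/
def CompElt (X : Set E) (g : α → E) : Prop :=
  ∃ (n : ℕ) (f : Fin n → E), (∀ i, f i ∈ X) ∧ ∃ w : α → List (Fin n), Computable w ∧
    ∀ a, famProd f (w a) = g a

theorem DecOn.comp {H X : Set E} (h : DecOn H X) {g : α → E} (hg : CompElt X g) :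
    ComputablePred fun a => g a ∈ H := by
  obtain ⟨n, f, hf, w, hw, e⟩ := hg
  simp only [← e]
  exact computablePred_comp (h n f hf) hw

theorem CompElt.comp {X : Set E} {g : β → E} (hg : CompElt X g) {k : α → β} (hk : Computable k) :
    CompElt X fun a => g (k a) := by
  obtain ⟨n, f, hf, w, hw, e⟩ := hg
  exact ⟨n, f, hf, _, hw.comp hk, fun a => e (k a)⟩

theorem CompElt.of_eq {X : Set E} {g h : α → E} (hg : CompElt X g) (e : ∀ a, g a = h a) :
    CompElt X h := (funext e : g = h) ▸ hg

theorem CompElt.famProd {X : Set E} {m : ℕ} {g : Fin m → E}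
    (hg : ∀ i, g i ∈ Submonoid.closure X) : CompElt X (famProd g) := by
  obtain ⟨n, f, hf, h⟩ := exists_family X (List.ofFn g) (by
    intro y hy
    obtain ⟨i, rfl⟩ := (List.mem_ofFn' _ _).1 hy
    exact hg i)
  choose w hw using fun i => h (g i) ((List.mem_ofFn' _ _).2 ⟨i, rfl⟩)
  exact ⟨n, f, hf, fun l => l.flatMap w, computable_flatMap w, famProd_flatMap hw⟩

theorem CompElt.const {X : Set E} {y : E} (hy : y ∈ Submonoid.closure X) :
    CompElt X fun _ : α => y :=
  ((CompElt.famProd (g := fun _ : Fin 1 => y) fun _ => hy).comp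
    (Computable.const [(0 : Fin 1)])).of_eq fun _ => by simp

theorem CompElt.mul {X : Set E} {g h : α → E} (hg : CompElt X g) (hh : CompElt X h) :
    CompElt X fun a => g a * h a := by
  obtain ⟨m, f, hf, w, hw, e⟩ := hg
  obtain ⟨n, k, hk, v, hv, e'⟩ := hh
  have h1 : ∀ l, NonArch.famProd (Fin.append f k) (l.flatMap fun i => [Fin.castAdd n i]) =
      NonArch.famProd f l := famProd_flatMap (by simp)
  have h2 : ∀ l, NonArch.famProd (Fin.append f k) (l.flatMap fun i => [Fin.natAdd m i]) =
      NonArch.famProd k l := famProd_flatMap (by simp)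
  refine ⟨m + n, Fin.append f k, fun i => ?_, fun a => (w a).flatMap (fun i => [Fin.castAdd n i]) ++
    (v a).flatMap (fun i => [Fin.natAdd m i]), ?_, fun a => ?_⟩
  · refine Fin.addCases (fun i => ?_) (fun i => ?_) i <;> simp [hf, hk]
  · exact Computable.list_append.comp ((computable_flatMap _).comp hw)
      ((computable_flatMap _).comp hv)
  · rw [famProd_append, h1, h2, e, e']

theorem CompElt.pow {X : Set E} {y : E} (hy : y ∈ Submonoid.closure X) :
    CompElt X fun k : ℕ => y ^ k := by
  refine ((CompElt.famProd (g := fun _ : Fin 1 => y) fun _ => hy).comp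
    (k := fun k : ℕ => (List.range k).map fun _ => (0 : Fin 1)) ?_).of_eq fun k => ?_
  · exact (Primrec.list_map Primrec.list_range (Primrec₂.const _)).to_comp
  · simp [NonArch.famProd]

/-- A finite family has finitely many letters, and each is replaced by a fixed word over `Y`; no
algorithm is needed to find these words. -/
theorem DecOn.mono {H X Y : Set E} (hY : DecOn H Y) (h : X ⊆ Submonoid.closure Y) : DecOn H X :=
  fun _ _ hf => hY.comp (CompElt.famProd fun i => h (hf i))

end Families

/-! ### Decidability by pinch reductions -/

section Algorithm

variable {E : Type*} [Group E]

theorem exists_family_of_finite (X : Set E) {Y : Set E} (hfin : Y.Finite)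
    (hY : ∀ y ∈ Y, y ∈ Submonoid.closure X) :
    ∃ (n : ℕ) (f : Fin n → E), (∀ i, f i ∈ X) ∧ ∀ y ∈ Y, ∃ w, famProd f w = y := by
  obtain ⟨n, f, hf, h⟩ := exists_family X hfin.toFinset.toList fun y hy => hY y (by simpa using hy)
  exact ⟨n, f, hf, fun y hy => h y (by simpa using hy)⟩

/-- Conjugation by `s` is computable on a finitely generated decidable subgroup. -/
theorem exists_computable_conj {X : Set E} {N : ℕ} {F : Fin N → E} (hF : ∀ i, F i ∈ X)
    (h1 : DecOn {1} X) {s : E} {A : Subgroup E} (hA : DecOn (A : Set E) X) {T : Set E}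
    (hfin : T.Finite) (hT : Submonoid.closure T = A.toSubmonoid)
    (hw : ∀ g ∈ T, ∃ w, famProd F w = g) (hw' : ∀ g ∈ T, ∃ w, famProd F w = s * g⁻¹ * s⁻¹) :
    ∃ τ : List (Fin N) → List (Fin N), Computable τ ∧
      ∀ h, famProd F h ∈ A → famProd F (τ h) = s * famProd F h * s⁻¹ := by
  obtain ⟨r, g, hgT⟩ : ∃ (r : ℕ) (g : Fin r → E), Set.range g = T := by
    have := hfin.to_subtype
    obtain ⟨r, ⟨e⟩⟩ := Finite.exists_equiv_fin T
    refine ⟨r, fun i => (e.symm i : E), ?_⟩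
    ext x
    constructor
    · rintro ⟨i, rfl⟩; exact (e.symm i).2
    · intro hx; exact ⟨e ⟨x, hx⟩, by simp⟩
  have hgT' : ∀ i, g i ∈ T := fun i => hgT ▸ ⟨i, rfl⟩
  choose w w_eq using fun i => hw (g i) (hgT' i)
  choose w' w_eq' using fun i => hw' (g i) (hgT' i)
  have hval : CompElt X (famProd F) := ⟨N, F, hF, id, Computable.id, fun _ => rfl⟩
  -- A word over the generators of `A` for the inverse of `h` is found by search with the word
  -- problem. The first alternative lets the search end when `h` is not in `A`. Searching for the
  -- inverse is why `w'` spells conjugates of inverses of generators.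
  obtain ⟨c, hc, hcs⟩ := exists_computable_choice (α := List (Fin N)) (β := List (Fin r))
    (p := fun h c => ¬ famProd F h ∈ (A : Set E) ∨ famProd F (h ++ c.flatMap w) ∈ ({1} : Set E))
    (computablePred_or (computablePred_comp (hA.comp hval).not Computable.fst)
      (h1.comp (hval.comp (Computable.list_append.comp Computable.fst
        ((computable_flatMap w).comp Computable.snd))))) (by
      intro h
      by_cases hh : famProd F h ∈ A
      · have h2 : (famProd F h)⁻¹ ∈ Submonoid.closure T := by
          rw [hT]; exact A.inv_mem hh
        obtain ⟨L, hL, hLe⟩ := Submonoid.exists_list_of_mem_closure h2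
        obtain ⟨c, rfl⟩ : ∃ c : List (Fin r), c.map g = L := by
          clear hLe
          induction L with
          | nil => exact ⟨[], rfl⟩
          | cons x L ih =>
            obtain ⟨c, rfl⟩ := ih fun y hy => hL y (List.mem_cons_of_mem _ hy)
            have hx := hL x List.mem_cons_self
            rw [← hgT] at hx
            obtain ⟨i, rfl⟩ := hx
            exact ⟨i :: c, rfl⟩
        refine ⟨c, Or.inr ?_⟩
        rw [famProd_append, famProd_flatMap w_eq, famProd, famProd, hLe, ← famProd]
        exact mul_inv_cancel _
      · exact ⟨[], Or.inl hh⟩)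
  refine ⟨fun h => (c h).reverse.flatMap w',
    (computable_flatMap w').comp (Computable.list_reverse.comp hc), fun h hh => ?_⟩
  have key : ∀ c : List (Fin r), famProd F (c.reverse.flatMap w') = s * (famProd g c)⁻¹ * s⁻¹ := by
    intro c
    induction c with
    | nil => simp
    | cons i c ih =>
      rw [List.reverse_cons, List.flatMap_append, famProd_append, ih, famProd_cons]
      simp only [List.flatMap_cons, List.flatMap_nil, List.append_nil, w_eq']
      group
  have h2 : famProd F h * famProd g (c h) = 1 := by
    rcases hcs h with h3 | h3
    · exact absurd hh h3
    · rwa [famProd_append, famProd_flatMap w_eq] at h3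
  rw [key, ← eq_inv_of_mul_eq_one_left h2]

variable {K : Subgroup E} {X S₀ : Set E}

/-- Fix some `h₀ ∈ K` with `s h₀ s' ∈ K`, if there is one. Then `s h s' = s (h h₀⁻¹) s⁻¹ · s h₀ s'`,
so for `h ∈ K` the product is in `K` exactly if `h h₀⁻¹ ∈ A`, and it can be computed by conjugation
on `A`. The family `F` is left open, subject only to spelling the finitely many elements of `Y`, so
that one family can serve several pairs `(s, s')`. -/
theorem exists_reduction_pair (hX : X ⊆ K) (hK : ∀ x ∈ K, x ∈ Submonoid.closure X)
    (h1 : DecOn {1} X) {s s' : E} {A : Subgroup E} (hfg : A.FG) (hA : DecOn (A : Set E) X)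
    (hAK : ∀ h, h ∈ A ↔ h ∈ K ∧ s * h * s⁻¹ ∈ K) :
    ∃ Y : Set E, Y.Finite ∧ Y ⊆ Submonoid.closure X ∧
      ∀ (N : ℕ) (F : Fin N → E), (∀ i, F i ∈ X) → (∀ y ∈ Y, ∃ w, famProd F w = y) →
        ∃ red : List (Fin N) → Option (List (Fin N)), Computable red ∧
          ∀ h, (∀ v, red h = some v → famProd F v = s * famProd F h * s') ∧
            (red h = none → s * famProd F h * s' ∉ K) := by
  have hFK : ∀ {N : ℕ} {F : Fin N → E}, (∀ i, F i ∈ X) → ∀ l, famProd F l ∈ K :=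
    fun hF l => famProd_mem (M := K.toSubmonoid) (fun i => hX (hF i)) l
  by_cases hex : ∃ h₀ ∈ K, s * h₀ * s' ∈ K
  · obtain ⟨h₀, h0, hk⟩ := hex
    obtain ⟨T, hT, hfin⟩ := (Submonoid.fg_iff _).1 ((Subgroup.fg_iff_submonoid_fg _).1 hfg)
    have hTA : ∀ g ∈ T, g ∈ A := fun g hg => by
      have : g ∈ A.toSubmonoid := hT ▸ Submonoid.subset_closure hg
      exact this
    refine ⟨{h₀⁻¹, s * h₀ * s'} ∪ (T ∪ (fun g => s * g⁻¹ * s⁻¹) '' T), ?_, ?_, ?_⟩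
    · exact (Set.toFinite _).union (hfin.union (hfin.image _))
    · rintro y ((rfl | rfl) | hy | ⟨g, hg, rfl⟩)
      · exact hK _ (K.inv_mem h0)
      · exact hK _ hk
      · exact hK _ ((hAK y).1 (hTA y hy)).1
      · exact hK _ ((hAK _).1 (A.inv_mem (hTA g hg))).2
    · intro N F hF hY
      obtain ⟨τ, hτ, hτs⟩ := exists_computable_conj hF h1 hA hfin hT
        (fun g hg => hY g (Or.inr (Or.inl hg)))
        (fun g hg => hY _ (Or.inr (Or.inr ⟨g, hg, rfl⟩)))
      obtain ⟨w₀, hw₀⟩ := hY h₀⁻¹ (Or.inl (Or.inl rfl))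
      obtain ⟨w₁, hw₁⟩ := hY (s * h₀ * s') (Or.inl (Or.inr rfl))
      obtain ⟨c, hc, hcs⟩ := computablePred_iff_bool.1 (computablePred_comp (hA N F hF)
        (Computable.list_append.comp Computable.id (Computable.const w₀)))
      refine ⟨fun h => bif c h then some (τ (h ++ w₀) ++ w₁) else none,
        Computable.cond hc (Computable.option_some.comp (Computable.list_append.comp
          (hτ.comp (Computable.list_append.comp Computable.id (Computable.const w₀)))
          (Computable.const w₁))) (Computable.const none), fun h => ?_⟩
      have hval : s * famProd F h * s' =
          s * (famProd F h * h₀⁻¹) * s⁻¹ * (s * h₀ * s') := by group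
      have hcs' := hcs h
      simp only [id, famProd_append, hw₀, SetLike.mem_coe] at hcs'
      constructor
      · intro v hv
        cases hch : c h
        · simp [hch] at hv
        · simp only [hch, cond_true, Option.some.injEq] at hv
          rw [← hv, famProd_append, hw₁, hτs, famProd_append, hw₀, hval]
          rw [famProd_append, hw₀]
          exact hcs'.2 hch
      · intro hv hm
        cases hch : c h
        · have hnot : ¬ famProd F h * h₀⁻¹ ∈ A := fun hh => by
            rw [hcs'.1 hh] at hch; exact Bool.noConfusion hch
          refine hnot ((hAK _).2 ⟨K.mul_mem (hFK hF h) (K.inv_mem h0), ?_⟩)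
          rw [hval] at hm
          exact (K.mul_mem_cancel_right hk).1 hm
        · simp [hch] at hv
  · refine ⟨∅, Set.finite_empty, Set.empty_subset _, fun N F hF _ => ⟨fun _ => none,
      Computable.const _, fun h => ⟨fun v hv => by simp at hv, fun _ hm => hex ⟨_, hFK hF h, hm⟩⟩⟩⟩

/-- Words over generators of `K` and elements `f i` admit computable pinch reductions. -/
theorem exists_reduction (hX : X ⊆ K) (hK : ∀ x ∈ K, x ∈ Submonoid.closure X)
    (h1 : DecOn {1} X)
    (hst : ∀ s ∈ S₀, ∃ A : Subgroup E, A.FG ∧ DecOn (A : Set E) X ∧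
      ∀ h, h ∈ A ↔ h ∈ K ∧ s * h * s⁻¹ ∈ K) {n : ℕ} (f : Fin n → E) :
    ∃ (N : ℕ) (F : Fin N → E) (wd : Fin n → List (Fin N))
      (red : Fin n × Fin n → List (Fin N) → Option (List (Fin N))),
      (∀ i, F i ∈ X) ∧ (∀ i, f i ∈ X → famProd F (wd i) = f i) ∧
      (∀ p, Computable (red p)) ∧
      ∀ i j, f i ∈ S₀ → ∀ h, (∀ v, red (i, j) h = some v →
        famProd F v = f i * famProd F h * f j) ∧
          (red (i, j) h = none → f i * famProd F h * f j ∉ K) := by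
  classical
  have h2 : ∀ p : Fin n × Fin n, ∃ Y : Set E, Y.Finite ∧ Y ⊆ Submonoid.closure X ∧
      ∀ (N : ℕ) (F : Fin N → E), (∀ i, F i ∈ X) → (∀ y ∈ Y, ∃ w, famProd F w = y) →
        ∃ red : List (Fin N) → Option (List (Fin N)), Computable red ∧ (f p.1 ∈ S₀ →
          ∀ h, (∀ v, red h = some v → famProd F v = f p.1 * famProd F h * f p.2) ∧
            (red h = none → f p.1 * famProd F h * f p.2 ∉ K)) := by
    rintro ⟨i, j⟩
    by_cases hi : f i ∈ S₀
    · obtain ⟨A, a1, a2, a3⟩ := hst _ hi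
      obtain ⟨Y, y1, y2, y3⟩ := exists_reduction_pair (s' := f j) hX hK h1 a1 a2 a3
      refine ⟨Y, y1, y2, fun N F hF hY => ?_⟩
      obtain ⟨red, r1, r2⟩ := y3 N F hF hY
      exact ⟨red, r1, fun _ => r2⟩
    · exact ⟨∅, Set.finite_empty, Set.empty_subset _, fun N F _ _ =>
        ⟨fun _ => none, Computable.const _, fun h => absurd h hi⟩⟩
  choose Y y1 y2 y3 using h2
  -- The output of one reduction is input to others, so a single family has to serve all pairs.
  obtain ⟨N, F, hF, hY⟩ := exists_family_of_finite X
    (Y := (⋃ p, Y p) ∪ (Set.range f ∩ X))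
    ((Set.finite_iUnion y1).union ((Set.finite_range f).inter_of_left _)) (by
      rintro y (hy | hy)
      · obtain ⟨p, hp⟩ := Set.mem_iUnion.1 hy
        exact y2 p hp
      · exact Submonoid.subset_closure hy.2)
  have h3 : ∀ i, ∃ w, f i ∈ X → famProd F w = f i := fun i => by
    by_cases hi : f i ∈ X
    · obtain ⟨w, hw⟩ := hY (f i) (Or.inr ⟨⟨i, rfl⟩, hi⟩)
      exact ⟨w, fun _ => hw⟩
    · exact ⟨[], fun h => absurd h hi⟩
  choose wd hwd using h3
  choose red r1 r2 using fun p => y3 p N F hF fun y hy => hY y (Or.inl (Set.mem_iUnion.2 ⟨p, hy⟩))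
  exact ⟨N, F, wd, red, hF, hwd, r1, fun i j hi => r2 (i, j) hi⟩

/-- One step of the reduction algorithm. The state `(h, L)` represents the product of `h` and of
the pairs `(f i, v)` in the stack `L`. -/
def stackStep {n N : ℕ} (t : Fin n → Bool) (wd : Fin n → List (Fin N))
    (red : Fin n × Fin n → List (Fin N) → Option (List (Fin N))) (i : Fin n)
    (st : List (Fin N) × List (Fin n × List (Fin N))) :
    List (Fin N) × List (Fin n × List (Fin N)) :=
  bif t i then (wd i ++ st.1, st.2) else
    Option.casesOn (st.2.head?) ([], [(i, st.1)]) fun y =>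
      Option.casesOn (red (i, y.1) st.1) ([], (i, st.1) :: st.2) fun v => (v ++ y.2, st.2.tail)

theorem computable_stackStep {n N : ℕ} (t : Fin n → Bool) (wd : Fin n → List (Fin N))
    {red : Fin n × Fin n → List (Fin N) → Option (List (Fin N))} (hr : ∀ p, Computable (red p)) :
    Computable₂ (stackStep t wd red) := by
  have hr2 : Computable₂ red := by
    obtain ⟨e⟩ : Nonempty (Fin n × Fin n ≃ Fin (n * n)) := ⟨finProdFinEquiv⟩
    have h1 : Computable₂ fun k : Fin (n * n) => red (finProdFinEquiv.symm k) :=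
      computable_fin fun k => hr _
    have h2 : Computable (finProdFinEquiv : Fin n × Fin n → Fin (n * n)) :=
      (Primrec.dom_finite _).to_comp
    exact (h1.comp (h2.comp Computable.fst) Computable.snd).of_eq fun x => by simp
  have i1 : Computable fun x : Fin n × List (Fin N) × List (Fin n × List (Fin N)) => x.1 :=
    Computable.fst
  have i2 : Computable fun x : Fin n × List (Fin N) × List (Fin n × List (Fin N)) => x.2.1 :=
    Computable.fst.comp Computable.snd
  have i3 : Computable fun x : Fin n × List (Fin N) × List (Fin n × List (Fin N)) => x.2.2 :=
    Computable.snd.comp Computable.snd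
  refine Computable.cond ((Primrec.dom_finite t).to_comp.comp i1)
    (Computable.pair (Computable.list_append.comp ((Primrec.dom_finite wd).to_comp.comp i1) i2) i3)
    (Computable.option_casesOn (Primrec.list_head?.to_comp.comp i3)
      (Computable.pair (Computable.const _) (Computable.list_cons.comp
        (Computable.pair i1 i2) (Computable.const _))) ?_)
  refine Computable.option_casesOn (hr2.comp (Computable.pair (i1.comp Computable.fst)
    (Computable.fst.comp Computable.snd)) (i2.comp Computable.fst))
    (Computable.pair (Computable.const _) (Computable.list_cons.comp (Computable.pair
      (i1.comp Computable.fst) (i2.comp Computable.fst)) (i3.comp Computable.fst))) ?_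
  exact Computable.pair (Computable.list_append.comp Computable.snd
    (Computable.snd.comp (Computable.snd.comp Computable.fst)))
    (Primrec.list_tail.to_comp.comp (i3.comp (Computable.fst.comp Computable.fst)))

/-- The element represented by a stack. -/
def stackProd {n N : ℕ} (f : Fin n → E) (F : Fin N → E) (L : List (Fin n × List (Fin N))) : E :=
  pairProd (L.map fun x => (f x.1, famProd F x.2))

/-- Decidability passes from generators of a subgroup `K` to the union with a set `S₀` which
satisfies an analogue of Britton's lemma. -/
theorem decOn_union (hX : X ⊆ K) (hK : ∀ x ∈ K, x ∈ Submonoid.closure X)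
    (h1 : DecOn {1} X)
    (hst : ∀ s ∈ S₀, ∃ A : Subgroup E, A.FG ∧ DecOn (A : Set E) X ∧
      ∀ h, h ∈ A ↔ h ∈ K ∧ s * h * s⁻¹ ∈ K)
    (hBr : ∀ (h₀ : E) (L : List (E × E)), L ≠ [] → h₀ ∈ K → (∀ x ∈ L, x.1 ∈ S₀ ∧ x.2 ∈ K) →
      h₀ * pairProd L ∈ K → ∃ L₁ x y L₂, L = L₁ ++ x :: y :: L₂ ∧ x.1 * x.2 * y.1 ∈ K)
    {H : Set E} (hHK : H ⊆ K) (hH : DecOn H X) : DecOn H (X ∪ S₀) := by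
  classical
  intro n f hf
  obtain ⟨N, F, wd, red, hF, hwd, hrc, hr⟩ := exists_reduction hX hK h1 hst f
  let t : Fin n → Bool := fun i => decide (f i ∈ X)
  let R : Fin n × List (Fin N) → Fin n × List (Fin N) → Prop :=
    fun x y => f x.1 * famProd F x.2 * f y.1 ∉ K
  let run : List (Fin n) → List (Fin N) × List (Fin n × List (Fin N)) := fun l =>
    l.foldr (stackStep t wd red) ([], [])
  have hrun : Computable run := by
    refine computable_list_foldr Computable.id (Computable.const _)
      (h := fun _ x => stackStep t wd red x.1 x.2) ?_
    exact (computable_stackStep t wd hrc).comp (Computable.fst.comp Computable.snd)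
      (Computable.snd.comp Computable.snd)
  -- The chain condition says that no two neighbours in the stack can be pinched; for a nonempty
  -- stack with value in `K` this contradicts `hBr`.
  have hinv : ∀ l, famProd f l = famProd F (run l).1 * stackProd f F (run l).2 ∧
      (∀ x ∈ (run l).2, f x.1 ∈ S₀) ∧ (run l).2.IsChain R := by
    intro l
    induction l with
    | nil => simp [run, stackProd]
    | cons i l ih =>
      have hrl : run (i :: l) = stackStep t wd red i (run l) := rfl
      obtain ⟨e1, e2, e3⟩ := ih
      rw [hrl, famProd_cons, e1]
      generalize run l = st at e1 e2 e3
      obtain ⟨h, L⟩ := st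
      by_cases ht : f i ∈ X
      · have : stackStep t wd red i (h, L) = (wd i ++ h, L) := by simp [stackStep, t, ht]
        rw [this]
        refine ⟨?_, e2, e3⟩
        rw [famProd_append, hwd i ht, mul_assoc]
      have hi : f i ∈ S₀ := (hf i).resolve_left ht
      cases L with
      | nil =>
        have : stackStep t wd red i (h, []) = ([], [(i, h)]) := by simp [stackStep, t, ht]
        rw [this]
        simp [stackProd, hi]
      | cons y L =>
        cases hred : red (i, y.1) h with
        | none =>
          have : stackStep t wd red i (h, y :: L) = ([], (i, h) :: y :: L) := by
            simp [stackStep, t, ht, hred]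
          rw [this]
          refine ⟨by simp [stackProd, mul_assoc], ?_, ?_⟩
          · intro x hx
            rcases List.mem_cons.1 hx with rfl | hx
            exacts [hi, e2 x hx]
          · exact List.isChain_cons_cons.2 ⟨(hr i y.1 hi h).2 hred, e3⟩
        | some v =>
          have : stackStep t wd red i (h, y :: L) = (v ++ y.2, L) := by
            simp [stackStep, t, ht, hred]
          rw [this]
          refine ⟨?_, fun x hx => e2 x (List.mem_cons_of_mem _ hx), ?_⟩
          · simp only [famProd_append, (hr i y.1 hi h).1 v hred, stackProd, List.map_cons,
              pairProd_cons, mul_assoc]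
          · exact e3.tail
  have hFK : ∀ l, famProd F l ∈ K :=
    fun l => famProd_mem (M := K.toSubmonoid) (fun i => hX (hF i)) l
  have hacc : ∀ l, famProd f l ∈ H ↔ (run l).2 = [] ∧ famProd F (run l).1 ∈ H := by
    intro l
    obtain ⟨e1, e2, e3⟩ := hinv l
    constructor
    · intro hl
      have hnil : (run l).2 = [] := by
        by_contra hne
        have hlK := hHK hl
        rw [e1] at hlK
        obtain ⟨L₁, x, y, L₂, eq, hm⟩ := hBr _ _ (by simpa using hne) (hFK (run l).1) (by
          intro x hx
          obtain ⟨y, hy, rfl⟩ := List.mem_map.1 hx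
          exact ⟨e2 y hy, hFK _⟩) hlK
        obtain ⟨M₁, M, eM, eM1, eM2⟩ := List.map_eq_append_iff.1 eq
        obtain ⟨x', M', rfl, rfl, eM3⟩ := List.map_eq_cons_iff.1 eM2
        obtain ⟨y', M'', rfl, rfl, eM4⟩ := List.map_eq_cons_iff.1 eM3
        rw [eM] at e3
        exact List.isChain_iff_forall_rel_of_append_cons_cons.1 e3 rfl hm
      refine ⟨hnil, ?_⟩
      rw [e1, hnil] at hl
      simpa [stackProd] using hl
    · rintro ⟨hnil, hl⟩
      rw [e1, hnil]
      simpa [stackProd] using hl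
  simp only [hacc]
  refine computablePred_and ?_ (computablePred_comp (hH N F hF) (Computable.fst.comp hrun))
  refine computablePred_comp (p := fun L : List (Fin n × List (Fin N)) => L = []) ?_
    (Computable.snd.comp hrun)
  refine computablePred_iff_bool.2 ⟨fun L => Option.casesOn L.head? true fun _ => false, ?_, ?_⟩
  · exact Computable.option_casesOn Primrec.list_head?.to_comp (Computable.const _)
      (Computable.const _)
  · intro L; cases L <;> simp

end Algorithm

/-! ### Lengths of reduced factors in trivial words -/

section Lengths

variable {G : Type*} [Group G] {S : Set G}

open AWord

/-- In a factorisation of `u ū`, a reduced factor is not longer than the other two together. -/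
theorem len_le_of_mul_bar_eq {u p U q : AWord (Letters S)} (h : u * u.bar = p * U * q)
    (hU : IsGReduced U) : U.len ≤ p.len + q.len := by
  have hp := p.len_nonneg
  have hq := q.len_nonneg
  rcases levi' h.symm with ⟨k, rfl, rfl⟩ | ⟨r, e, e'⟩
  · have := k.len_nonneg
    simp only [len_mul, len_bar] at *
    linarith
  rw [eq_comm, eq_bar_iff, bar_mul] at e'
  have hr := r.len_nonneg
  rcases levi' e with ⟨k, rfl, rfl⟩ | ⟨k, rfl, rfl⟩
  · have hk := k.len_nonneg
    rcases le_total k.len r.len with hl | hl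
    · obtain ⟨m, rfl, e2⟩ := levi_right e' (by simpa using hl)
      rw [eq_comm, eq_bar_iff, bar_mul] at e2
      subst e2
      rw [← mul_assoc] at hU
      rw [mul_bar_reduced hU.left]
      simp only [len_mul, len_bar, bar_one, one_mul] at *
      linarith
    · obtain ⟨m, e1, rfl⟩ := levi_right e'.symm (by simpa using hl)
      have h2 : IsGReduced (r.bar * r.bar.bar) := by
        rw [bar_bar]; rw [mul_assoc] at hU; exact hU.right
      rw [bar_eq_one_iff.1 (mul_bar_reduced h2)]
      have := congrArg AWord.len e1
      simp only [len_mul, len_bar, bar_one, mul_one] at *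
      linarith
  · have := k.len_nonneg
    have h2 := congrArg AWord.len e'
    have := U.len_nonneg
    simp only [len_mul, len_bar] at *
    linarith

/-- The length bound is inherited when `a` is inserted into `P * Q`. If `U` meets only one end of
`a`, it is split there and the two bounds are added. If `U` contains all of `a`, then `a` is
reduced, hence empty by `ha1`. -/
theorem exists_len_le_insert {P a Q p U q : AWord (Letters S)} (ha1 : IsGReduced a → a = 1)
    (ha : ∀ p' U' q', a = p' * U' * q' → IsGReduced U' →
      ∃ n : ℕ, U'.len ≤ p'.len + q'.len + n)
    (ih : ∀ p' U' q', P * Q = p' * U' * q' → IsGReduced U' →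
      ∃ n : ℕ, U'.len ≤ p'.len + q'.len + n)
    (h : P * a * Q = p * U * q) (hU : IsGReduced U) :
    ∃ n : ℕ, U.len ≤ p.len + q.len + n := by
  have ha0 := a.len_nonneg
  rw [mul_assoc, mul_assoc] at h
  rcases levi' h with ⟨k, rfl, h2⟩ | ⟨k, rfl, h2⟩
  · rcases levi' h2 with ⟨r, rfl, rfl⟩ | ⟨r, rfl, h3⟩
    · obtain ⟨n, hn⟩ := ih (P * r) U q (by simp only [mul_assoc]) hU
      refine ⟨n, ?_⟩
      simp only [len_mul] at *
      linarith
    · rcases levi' h3 with ⟨s, rfl, rfl⟩ | ⟨s, rfl, rfl⟩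
      · obtain ⟨n, hn⟩ := ha k U s (by simp only [mul_assoc]) hU
        refine ⟨n, ?_⟩
        have := P.len_nonneg
        have := Q.len_nonneg
        simp only [len_mul] at *
        linarith
      · obtain ⟨n, hn⟩ := ha k r 1 (by simp) hU.left
        obtain ⟨m, hm⟩ := ih P s q (by simp only [mul_assoc]) hU.right
        refine ⟨n + m, ?_⟩
        push_cast
        simp only [len_mul, len_one] at *
        linarith
  · rcases levi' h2 with ⟨r, rfl, rfl⟩ | ⟨r, rfl, h3⟩
    · obtain ⟨n, hn⟩ := ih p U (r * Q) (by simp only [mul_assoc]) hU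
      refine ⟨n, ?_⟩
      simp only [len_mul] at *
      linarith
    · rcases levi' h3 with ⟨s, rfl, rfl⟩ | ⟨s, rfl, rfl⟩
      · obtain rfl := ha1 hU.right.left
        rw [one_mul] at hU
        obtain ⟨n, hn⟩ := ih p (k * s) q (by simp only [mul_assoc]) hU
        refine ⟨n, ?_⟩
        simp only [len_mul, len_one] at *
        linarith
      · obtain ⟨n, hn⟩ := ha 1 r s (by simp) hU.right
        obtain ⟨m, hm⟩ := ih p k Q (by simp only [mul_assoc]) hU.left
        refine ⟨n + m, ?_⟩
        push_cast
        simp only [len_mul, len_one] at *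
        linarith

/-- In a word which represents `1`, a reduced factor is not longer than the other factors
together, up to a finite length. -/
theorem Triv.exists_len_le (h1 : (1 : G) ∉ S) {w : AWord (Letters S)} (h : Triv w) :
    ∀ p U q, w = p * U * q → IsGReduced U → ∃ n : ℕ, U.len ≤ p.len + q.len + n := by
  induction h with
  | one =>
    intro p U q e _
    refine ⟨0, ?_⟩
    obtain ⟨e1, rfl⟩ := eq_one_of_mul_eq_one e.symm
    obtain ⟨rfl, rfl⟩ := eq_one_of_mul_eq_one e1
    simp
  | ins P Q u hu _ _ ih =>
    intro p U q e hU
    refine exists_len_le_insert ?_ ?_ ih e hU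
    · intro h
      rw [mul_bar_reduced h, one_mul, bar_one]
    · intro p' U' q' e' hU'
      exact ⟨0, by simpa using len_le_of_mul_bar_eq e' hU'⟩
  | fin P Q a ha _ ih =>
    intro p U q e hU
    refine exists_len_le_insert (fun h => h.eq_one_of_hasValue h1 ha) ?_ ih e hU
    intro p' U' q' e' hU'
    have hd := ha.degLT
    rw [e', degLT_mul, degLT_mul] at hd
    obtain ⟨n, hn⟩ := exists_natCast_of_mem_degreeLT_one U'.len_nonneg hd.1.2
    refine ⟨n, ?_⟩
    have := p'.len_nonneg
    have := q'.len_nonneg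
    linarith

/-- Completing `U w` by a word of degree less than `d` to a trivial word, `Triv.exists_len_le`
bounds `U` by the rest, and lower degrees do not affect the coefficient of `t ^ d`. This will bound
exponents of periods. -/
theorem coeff_len_le_of_elt_mul_mem {d : ℕ} (hd : 1 ≤ d) (h1 : (1 : G) ∉ S)
    {U w : AWord (Letters S)} (hU : IsGReduced U) (hUd : DegLT (d + 1) U) (hw : w ∈ RStar S)
    (hwd : DegLT (d + 1) w) (hm : elt U * elt w ∈ degSubgroup S d) :
    U.len.coeff d ≤ w.len.coeff d := by
  obtain ⟨y, hy, hyd, e⟩ := hm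
  have ht : Triv (1 * U * (w * y.bar)) := by
    have hr := mul_mem hw (bar_mem_RStar hy)
    rw [one_mul, ← elt_eq_one_iff h1 (mul_mem hU.mem_RStar hr), elt_mul hU.mem_RStar hr,
      elt_mul hw (bar_mem_RStar hy), elt_bar hy, e]
    group
  obtain ⟨n, hn⟩ := ht.exists_len_le h1 1 U _ rfl hU
  by_contra hlt
  have hn1 : (n : Polynomial ℤ) ∈ Polynomial.degreeLT ℤ d :=
    Polynomial.degreeLT_mono hd (natCast_mem_degreeLT_one n)
  have hyn : y.len + n ∈ Polynomial.degreeLT ℤ d := add_mem hyd hn1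
  have hle := Polynomial.degreeLT_mono (R := ℤ) (Nat.le_succ d)
  have h0 := (mem_degreeLT_iff_coeff (hle hyn)).1 hyn
  have := lt_of_coeff_lt (α := w.len + (y.len + n)) (add_mem hwd (hle hyn)) hUd (by
    rw [Polynomial.coeff_add, h0]; lia)
  simp only [len_mul, len_one, len_bar] at hn
  linarith

end Lengths

/-! # Finite words as elements -/

section FiniteElements

variable {G : Type*} [Group G] {S : Set G}

open AWord

theorem elt_ofList_eq {l r : List (Letters S)} (h : eval l = eval r) :
    elt (ofList l) = elt (ofList r) := by
  rw [← mul_inv_eq_one, ← elt_bar (ofList_mem_RStar r),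
    ← elt_mul (ofList_mem_RStar l) (bar_mem_RStar (ofList_mem_RStar r))]
  apply Subtype.ext
  rw [coe_elt (mul_mem (ofList_mem_RStar l) (bar_mem_RStar (ofList_mem_RStar r))),
    toQuot_hasValue]
  · rfl
  · exact ((hasValue_ofList l).mul (hasValue_ofList r).bar).of_eq (by rw [h, mul_inv_cancel])

theorem exists_eval_eq (hgen : Subgroup.closure S = ⊤) (g : G) :
    ∃ l : List (Letters S), eval l = g := by
  have hg : g ∈ Submonoid.closure (S ∪ S⁻¹) := by
    rw [← Subgroup.closure_toSubmonoid, hgen]; trivial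
  obtain ⟨L, hL, rfl⟩ := Submonoid.exists_list_of_mem_closure hg
  exact ⟨L.attach.map fun x => ⟨x.1, hL x.1 x.2⟩, by simp [eval, Function.comp_def]⟩

/-- The group `G` embeds into `Ext(ℤ[t], G)`. -/
theorem exists_embedding (h1 : (1 : G) ∉ S) (hgen : Subgroup.closure S = ⊤) :
    ∃ ι : G →* Ext S, Function.Injective ι ∧ ∀ l, ι (eval l) = elt (ofList l) := by
  choose word hword using exists_eval_eq hgen
  let ι : G →* Ext S := MonoidHom.mk' (fun g => elt (ofList (word g))) fun g h => by
    rw [← elt_mul (ofList_mem_RStar _) (ofList_mem_RStar _), ← ofList_append]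
    exact elt_ofList_eq (by rw [eval_append, hword, hword, hword])
  refine ⟨ι, (injective_iff_map_eq_one _).2 fun g hg => ?_, fun l => elt_ofList_eq (hword _)⟩
  have := (elt_eq_one_iff h1 (ofList_mem_RStar _)).1 hg
  exact this.hasValue_eq_one ⟨word g, rfl, hword g⟩

/-- Decidability of a cyclic subgroup of `G` carries over to its image in `Ext(ℤ[t], G)`. -/
theorem decOn_zpowers (h1 : (1 : G) ∉ S) (hgen : Subgroup.closure S = ⊤)
    {v : List (Letters S)}
    (hv : DecidableOnWords fun u : List (Letters S) => eval u ∈ Subgroup.zpowers (eval v)) :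
    DecOn (Subgroup.zpowers (elt (ofList v)) : Set (Ext S)) (degGens S 1) := by
  obtain ⟨ι, hι, hιl⟩ := exists_embedding h1 hgen
  obtain ⟨m, e, hc⟩ := hv
  intro n f hf
  have hex : ∀ i, ∃ l : List (Letters S), elt (ofList l) = f i := fun i => by
    obtain ⟨u, -, hd, hu⟩ := hf i
    obtain ⟨l, rfl⟩ := degLT_one_iff.1 hd
    exact ⟨l, hu⟩
  choose l hl using hex
  have key : ∀ w : List (Fin n), famProd f w ∈ (Subgroup.zpowers (elt (ofList v)) : Set (Ext S)) ↔
      eval ((w.flatMap fun i => (l i).map e.symm).map e) ∈ Subgroup.zpowers (eval v) := by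
    intro w
    have h2 : famProd f w = ι (eval ((w.flatMap fun i => (l i).map e.symm).map e)) := by
      induction w with
      | nil => simp
      | cons i w ih =>
        rw [famProd_cons, ih, List.flatMap_cons, List.map_append, eval_append, map_mul]
        congr 1
        rw [List.map_map, Equiv.self_comp_symm, List.map_id, hιl, hl]
    rw [h2, SetLike.mem_coe, ← hιl, ← MonoidHom.map_zpowers, Subgroup.mem_map_iff_mem hι]
  simp only [key]
  exact computablePred_comp hc (computable_flatMap _)

/-- The image of a period homomorphism. -/
noncomputable def periodRange {P : AddSubgroup (Polynomial ℤ)} (φ : P →+ Additive (Ext S)) :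
    Subgroup (Ext S) := AddSubgroup.toSubgroup' φ.range

theorem mem_periodRange {P : AddSubgroup (Polynomial ℤ)} {φ : P →+ Additive (Ext S)} {x : Ext S} :
    x ∈ periodRange φ ↔ ∃ σ : P, (φ σ).toMul = x := Iff.rfl

/-- The coefficient of `t ^ d` maps `P` onto a nonzero subgroup of `ℤ`; `σ₀` is a preimage of its
positive generator. -/
theorem exists_generator_mod_degreeLT {d : ℕ} {P : AddSubgroup (Polynomial ℤ)}
    (h : ∀ σ ∈ P, σ ∈ Polynomial.degreeLT ℤ (d + 1))
    (hne : ¬ ∀ σ ∈ P, σ ∈ Polynomial.degreeLT ℤ d) :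
    ∃ σ₀ : P, 0 < (σ₀ : Polynomial ℤ).coeff d ∧ 0 < (σ₀ : Polynomial ℤ) ∧
      ∀ σ : P, ∃ k : ℤ, ((σ - k • σ₀ : P) : Polynomial ℤ) ∈ Polynomial.degreeLT ℤ d := by
  let c : P →+ ℤ := (Polynomial.lcoeff ℤ d).toAddMonoidHom.comp P.subtype
  have hc : ∀ σ : P, c σ = (σ : Polynomial ℤ).coeff d := fun σ => rfl
  obtain ⟨a, ha⟩ := Int.subgroup_cyclic c.range
  rw [← AddSubgroup.zmultiples_eq_closure, ← Int.zmultiples_natAbs] at ha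
  have hmem : ∀ σ : P, ∃ k : ℤ, k * (a.natAbs : ℤ) = c σ := fun σ => by
    have : c σ ∈ c.range := ⟨σ, rfl⟩
    rw [ha, AddSubgroup.mem_zmultiples_iff] at this
    simpa using this
  obtain ⟨σ₀, h0⟩ : (a.natAbs : ℤ) ∈ c.range := ha ▸ AddSubgroup.mem_zmultiples _
  have hpos : 0 < (σ₀ : Polynomial ℤ).coeff d := by
    rw [← hc, h0, Int.natCast_pos, Nat.pos_iff_ne_zero]
    intro h00
    refine hne fun σ hσ => ?_
    obtain ⟨k, hk⟩ := hmem ⟨σ, hσ⟩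
    rw [mem_degreeLT_iff_coeff (h σ hσ), ← hc ⟨σ, hσ⟩, ← hk, h00]
    simp
  refine ⟨σ₀, hpos, lt_of_coeff_lt (zero_mem _) (h _ σ₀.2) (by simpa using hpos), fun σ => ?_⟩
  obtain ⟨k, hk⟩ := hmem σ
  refine ⟨k, (mem_degreeLT_iff_coeff (h _ (σ - k • σ₀).2)).2 ?_⟩
  rw [← hc, map_sub, map_zsmul, h0, ← hk]
  simp

/-- Periods of degree less than `1` are integers, so the image is cyclic and generated by a finite
word. The hypothesis on cyclic subgroups of `G` is consumed here. -/
theorem decOn_periodRange_one (h1 : (1 : G) ∉ S) (hgen : Subgroup.closure S = ⊤)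
    (hv : ∀ v : List (Letters S),
      DecidableOnWords fun u : List (Letters S) => eval u ∈ Subgroup.zpowers (eval v))
    {P : AddSubgroup (Polynomial ℤ)} {φ : P →+ Additive (Ext S)} (hφ : IsPeriodHom 1 φ) :
    DecOn (periodRange φ : Set (Ext S)) (degGens S 1) := by
  obtain ⟨v, h⟩ : ∃ v : List (Letters S), periodRange φ = Subgroup.zpowers (elt (ofList v)) := by
    have hz : ∀ σ : P, (σ : Polynomial ℤ) ∈ Polynomial.degreeLT ℤ 0 → σ = 0 := fun σ hσ => by
      rw [Polynomial.mem_degreeLT, Polynomial.degree_lt_iff_coeff_zero] at hσ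
      exact Subtype.ext (Polynomial.ext fun n => by simpa using hσ n (Nat.zero_le n))
    by_cases hne : ∀ σ ∈ P, σ ∈ Polynomial.degreeLT ℤ 0
    · refine ⟨[], ?_⟩
      rw [ofList_nil, elt_one, Subgroup.zpowers_one_eq_bot, eq_bot_iff]
      rintro _ ⟨σ, rfl⟩
      rw [hz σ (hne σ σ.2)]
      exact map_zero φ
    · obtain ⟨σ₀, -, h0, hk⟩ := exists_generator_mod_degreeLT hφ.le hne
      obtain ⟨u, -, hul, hu⟩ := hφ.exists_word σ₀ h0.le
      obtain ⟨v, rfl⟩ := degLT_one_iff.1 (show DegLT 1 u by rw [DegLT, hul]; exact hφ.le _ σ₀.2)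
      refine ⟨v, ?_⟩
      rw [hu]
      ext x
      rw [mem_periodRange, Subgroup.mem_zpowers_iff]
      constructor
      · rintro ⟨σ, rfl⟩
        obtain ⟨k, hk⟩ := hk σ
        refine ⟨k, ?_⟩
        rw [sub_eq_zero.1 (hz _ hk), map_zsmul, toMul_zsmul]
      · rintro ⟨k, rfl⟩
        exact ⟨k • σ₀, by rw [map_zsmul, toMul_zsmul]⟩
  rw [h]
  exact decOn_zpowers h1 hgen (hv v)

end FiniteElements

/-! ### Induction on the degree -/

section Induction

variable {G : Type*} [Group G] {S : Set G}

open AWord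

/-- Prefixes of length `t ^ d` are split off until the coefficient of `t ^ d` in the length is at
most `1`. -/
theorem degGens_succ_subset (d : ℕ) :
    degGens S (d + 1) ⊆ Submonoid.closure (degGens S d ∪ cutGens S d) := by
  rintro _ ⟨u, hu, hud, rfl⟩
  obtain ⟨c, hc⟩ := Int.eq_ofNat_of_zero_le (coeff_len_nonneg hud)
  induction c generalizing u with
  | zero => exact Submonoid.subset_closure (Or.inl ⟨u, hu, degLT_of_coeff hud hc, rfl⟩)
  | succ c ih =>
    have hX : (Polynomial.X ^ d : Polynomial ℤ) ∈ Polynomial.degreeLT ℤ (d + 1) := by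
      rw [Polynomial.mem_degreeLT, Polynomial.degree_X_pow]
      exact_mod_cast Nat.lt_succ_self d
    rcases Nat.eq_zero_or_pos c with rfl | hpos
    · exact Submonoid.subset_closure (Or.inr ⟨u, ⟨hu, hud, by simpa using hc⟩, rfl⟩)
    · have h0 : (0 : Polynomial ℤ) < Polynomial.X ^ d :=
        lt_of_coeff_lt (zero_mem _) hX (by simp)
      have hl : Polynomial.X ^ d < u.len := lt_of_coeff_lt hX hud (by simp [hc, hpos])
      obtain ⟨s, u', rfl, hs⟩ := u.exists_split h0.le hl.le
      have hd := degLT_mul.1 hud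
      rw [elt_mul hu.left.mem_RStar hu.right.mem_RStar]
      rw [coeff_len_mul, hs, Polynomial.coeff_X_pow_self] at hc
      refine mul_mem (Submonoid.subset_closure (Or.inr ⟨s, ⟨hu.left, hd.1, by simp [hs]⟩, rfl⟩))
        (ih u' hu.right hd.2 ?_)
      push_cast at hc
      lia

theorem periodRange_fg {d : ℕ} {P : AddSubgroup (Polynomial ℤ)} {φ : P →+ Additive (Ext S)}
    (hφ : IsPeriodHom d φ) : (periodRange φ).FG := by
  have h1 : AddGroup.FG P := (AddGroup.fg_iff_addSubgroup_fg P).2 (fg_of_le_degreeLT hφ.le)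
  have h2 : φ.range.FG := (AddGroup.fg_iff_addSubgroup_fg _).1 (AddGroup.fg_range φ)
  rw [Subgroup.fg_iff_add_fg]
  exact h2

theorem IsPeriodHom.mem_degGens {d : ℕ} {P : AddSubgroup (Polynomial ℤ)}
    {φ : P →+ Additive (Ext S)} (hφ : IsPeriodHom d φ) (σ : P) :
    (φ σ).toMul ∈ degGens S d := by
  rcases le_total 0 (σ : Polynomial ℤ) with h | h
  · obtain ⟨u, hu, hl, he⟩ := hφ.exists_word σ h
    exact ⟨u, hu, by rw [DegLT, hl]; exact hφ.le _ σ.2, he⟩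
  · obtain ⟨u, hu, hl, he⟩ := hφ.exists_word (-σ) (by simpa using h)
    have : (φ σ).toMul = (elt u)⁻¹ := by rw [he, map_neg, toMul_neg, inv_inv]
    rw [this]
    exact degGens_inv ⟨u, hu, by rw [DegLT, hl]; exact hφ.le _ (-σ).2, rfl⟩

theorem IsPeriodHom.restrict {d e : ℕ} {P : AddSubgroup (Polynomial ℤ)}
    {φ : P →+ Additive (Ext S)} (hφ : IsPeriodHom d φ) {P' : AddSubgroup (Polynomial ℤ)}
    (h : P' ≤ P) (hle : ∀ σ ∈ P', σ ∈ Polynomial.degreeLT ℤ e) :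
    IsPeriodHom e (φ.comp (AddSubgroup.inclusion h)) :=
  ⟨hle, fun σ hσ => hφ.exists_word (AddSubgroup.inclusion h σ) hσ⟩

/-- Cyclic subgroups are reduced to the subgroup generated by the other generators, once the
exponents are bounded by the lengths of the words. -/
theorem decOn_of_bounded_powers {E : Type*} [Group E] {X H H' : Set E} (hH' : DecOn H' X) {q : E}
    (hq : q ∈ Submonoid.closure X) (hq' : q⁻¹ ∈ Submonoid.closure X)
    (hH : ∀ x, x ∈ H ↔ ∃ k : ℕ, q ^ k * x ∈ H' ∨ q⁻¹ ^ k * x ∈ H')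
    (hb : ∀ (n : ℕ) (f : Fin n → E), (∀ i, f i ∈ X) → ∀ (l : List (Fin n)) (k : ℕ),
      q ^ k * famProd f l ∈ H' ∨ q⁻¹ ^ k * famProd f l ∈ H' → k ≤ l.length) :
    DecOn H X := by
  intro n f hf
  have h1 : ∀ l, famProd f l ∈ H ↔ ∃ k < l.length + 1,
      (q ^ k * famProd f l ∈ H' ∨ q⁻¹ ^ k * famProd f l ∈ H') := by
    intro l
    rw [hH]
    constructor
    · rintro ⟨k, hk⟩
      exact ⟨k, Nat.lt_succ_of_le (hb n f hf l k hk), hk⟩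
    · rintro ⟨k, -, hk⟩
      exact ⟨k, hk⟩
  simp only [h1]
  have hf' : CompElt X (famProd f) := CompElt.famProd fun i => Submonoid.subset_closure (hf i)
  refine computablePred_exists_lt (p := fun k l => q ^ k * famProd f l ∈ H' ∨
    q⁻¹ ^ k * famProd f l ∈ H') (computablePred_or ?_ ?_)
    (Computable.succ.comp Computable.list_length)
  · exact hH'.comp (((CompElt.pow hq).comp Computable.fst).mul (hf'.comp Computable.snd))
  · exact hH'.comp (((CompElt.pow hq').comp Computable.fst).mul (hf'.comp Computable.snd))

theorem exists_word_famProd {d : ℕ} {n : ℕ} {f : Fin n → Ext S}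
    (hf : ∀ i, f i ∈ degGens S d ∪ cutGens S d) (l : List (Fin n)) :
    ∃ w ∈ RStar S, DegLT (d + 1) w ∧ w.len.coeff d ≤ l.length ∧ elt w = famProd f l := by
  induction l with
  | nil => exact ⟨1, one_mem _, degLT_one _, by simp, elt_one⟩
  | cons i l ih =>
    obtain ⟨w, hw, hwd, hwl, he⟩ := ih
    obtain ⟨u, hu, hud, hul, hue⟩ : ∃ u ∈ RStar S, DegLT (d + 1) u ∧ u.len.coeff d ≤ 1 ∧
        elt u = f i := by
      rcases hf i with ⟨u, hu, hud, he⟩ | ⟨u, hu, he⟩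
      · exact ⟨u, hu.mem_RStar, hud.mono (Nat.le_succ d),
          by rw [hud.coeff_eq_zero]; exact zero_le_one, he⟩
      · exact ⟨u, hu.1.mem_RStar, hu.2.1, hu.2.2.le, he⟩
    refine ⟨u * w, mul_mem hu hw, degLT_mul.2 ⟨hud, hwd⟩, ?_, ?_⟩
    · rw [coeff_len_mul, List.length_cons]
      push_cast
      lia
    · rw [elt_mul hu hw, hue, he, famProd_cons]

/-- The word problem is the case of the trivial group of periods. -/
theorem decOn_one_of_forall {d : ℕ} {X : Set (Ext S)}
    (h : ∀ {P : AddSubgroup (Polynomial ℤ)} {φ : P →+ Additive (Ext S)}, IsPeriodHom d φ →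
      DecOn (periodRange φ : Set (Ext S)) X) : DecOn {1} X := by
  have h0 : IsPeriodHom d (0 : (⊥ : AddSubgroup (Polynomial ℤ)) →+ Additive (Ext S)) := by
    refine ⟨fun σ hσ => ?_, fun σ _ => ⟨1, isGReduced_one, ?_, elt_one⟩⟩
    · rw [AddSubgroup.mem_bot.1 hσ]; exact zero_mem _
    · rw [AddSubgroup.mem_bot.1 σ.2]; rfl
  have h2 := h h0
  have h3 : (periodRange (0 : (⊥ : AddSubgroup (Polynomial ℤ)) →+ Additive (Ext S)) :
      Set (Ext S)) = {1} := by
    ext x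
    rw [SetLike.mem_coe, mem_periodRange, Set.mem_singleton_iff]
    constructor
    · rintro ⟨σ, rfl⟩; rfl
    · rintro rfl; exact ⟨0, rfl⟩
  rwa [h3] at h2

/-- An application of `decOn_union`, with the cuts as stable letters over `degSubgroup S d`. The
stabiliser of a cut is conjugate to an image of periods of degree less than `d` by an element of
`degGens S d`, so `ih` decides it. -/
theorem decOn_periodRange_succ {d : ℕ} (hd : 1 ≤ d) (h1 : (1 : G) ∉ S)
    (ih : ∀ {P : AddSubgroup (Polynomial ℤ)} {φ : P →+ Additive (Ext S)}, IsPeriodHom d φ →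
      DecOn (periodRange φ : Set (Ext S)) (degGens S d))
    {P : AddSubgroup (Polynomial ℤ)} {φ : P →+ Additive (Ext S)} (hφ : IsPeriodHom d φ) :
    DecOn (periodRange φ : Set (Ext S)) (degGens S d ∪ cutGens S d) := by
  have hK : ∀ x ∈ degSubgroup S d, x ∈ Submonoid.closure (degGens S d) :=
    fun x hx => mem_closure_degGens.2 hx
  refine decOn_union (K := degSubgroup S d) (degGens_subset d) hK
    (decOn_one_of_forall ih) ?_
    (fun h₀ L hne h0 hL hm => exists_pinch_elt hd h1 hne h0 hL hm) ?_ (ih hφ)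
  · rintro _ ⟨s, hs, rfl⟩
    obtain ⟨b, Q, ψ, hb, hbd, hψ, hst⟩ := exists_cut_stabilizer hd h1 hs
    have hmap : ∀ h, h ∈ (periodRange ψ).map (MulAut.conj (elt b)⁻¹).toMonoidHom ↔
        elt b * h * (elt b)⁻¹ ∈ periodRange ψ := by
      intro h
      rw [Subgroup.mem_map]
      constructor
      · rintro ⟨x, hx, rfl⟩
        convert hx using 1
        simp [mul_assoc]
      · intro hx
        exact ⟨_, hx, by simp [mul_assoc]⟩
    refine ⟨(periodRange ψ).map (MulAut.conj (elt b)⁻¹).toMonoidHom, (Subgroup.fg_iff_submonoid_fg _).2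
      (((Subgroup.fg_iff_submonoid_fg _).1 (periodRange_fg hψ)).map _),
      ?_, fun h => ?_⟩
    · intro n f hf
      simp only [SetLike.mem_coe, hmap]
      have hbG : elt b ∈ degGens S d := ⟨b, hb, hbd, rfl⟩
      exact (ih hψ).comp (((CompElt.const (Submonoid.subset_closure hbG)).mul
        (CompElt.famProd fun i => Submonoid.subset_closure (hf i))).mul
        (CompElt.const (Submonoid.subset_closure (degGens_inv hbG))))
    · rw [hst, hmap, mem_periodRange]
      constructor
      · rintro ⟨σ, e⟩
        exact ⟨σ, by rw [e]; group⟩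
      · rintro ⟨σ, e⟩
        exact ⟨σ, by rw [e]; group⟩
  · rintro _ ⟨σ, rfl⟩
    exact degGens_subset d (hφ.mem_degGens σ)

/-- The induction has to cover all images of periods and not just the word problem, since the
stabilisers met at the next degree are of this kind. -/
theorem decOn_periodRange (h1 : (1 : G) ∉ S) (hgen : Subgroup.closure S = ⊤)
    (hv : ∀ v : List (Letters S),
      DecidableOnWords fun u : List (Letters S) => eval u ∈ Subgroup.zpowers (eval v))
    {d : ℕ} (hd : 1 ≤ d) : ∀ {P : AddSubgroup (Polynomial ℤ)} {φ : P →+ Additive (Ext S)},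
      IsPeriodHom d φ → DecOn (periodRange φ : Set (Ext S)) (degGens S d) := by
  induction d, hd using Nat.le_induction with
  | base => exact fun hφ => decOn_periodRange_one h1 hgen hv hφ
  | succ d hd ih =>
    intro P φ hφ
    refine DecOn.mono ?_ (degGens_succ_subset d)
    by_cases hne : ∀ σ ∈ P, σ ∈ Polynomial.degreeLT ℤ d
    · exact decOn_periodRange_succ hd h1 ih ⟨hne, hφ.exists_word⟩
    -- `P` is generated by `σ₀` and its elements of degree less than `d`. With `q` the image of
    -- `σ₀`, membership in the image of `P` means that some `q ^ k` or `q⁻¹ ^ k` moves the element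
    -- into the image of the smaller group.
    obtain ⟨σ₀, hc0, h0, hk⟩ := exists_generator_mod_degreeLT hφ.le hne
    let P' : AddSubgroup (Polynomial ℤ) := P ⊓ (Polynomial.degreeLT ℤ d).toAddSubgroup
    have hφ' : IsPeriodHom d (φ.comp (AddSubgroup.inclusion (inf_le_left : P' ≤ P))) :=
      hφ.restrict inf_le_left fun σ hσ => hσ.2
    set φ' := φ.comp (AddSubgroup.inclusion (inf_le_left : P' ≤ P)) with hφ'_def
    have hsub : ∀ x ∈ periodRange φ', x ∈ periodRange φ := by
      rintro _ ⟨σ, rfl⟩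
      exact ⟨_, rfl⟩
    have hq := hφ.mem_degGens σ₀
    have hqm : (φ σ₀).toMul ∈ periodRange φ := ⟨σ₀, rfl⟩
    have hmono := degGens_succ_subset (S := S) d
    refine decOn_of_bounded_powers (decOn_periodRange_succ hd h1 ih hφ') (hmono hq)
      (hmono (degGens_inv hq)) (fun x => ⟨?_, ?_⟩) ?_
    · intro hx
      obtain ⟨σ, rfl⟩ := mem_periodRange.1 hx
      obtain ⟨k, hk⟩ := hk σ
      have hk' : (φ (σ - k • σ₀)).toMul ∈ periodRange φ' :=
        ⟨⟨_, (σ - k • σ₀).2, hk⟩, rfl⟩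
      rw [map_sub, map_zsmul, toMul_sub, toMul_zsmul] at hk'
      have hcomm : Commute (φ σ).toMul ((φ σ₀).toMul ^ k)⁻¹ := by
        have h2 : Commute (φ σ).toMul (φ σ₀).toMul := by
          rw [Commute, SemiconjBy, ← toMul_add, ← toMul_add, ← map_add, ← map_add, add_comm]
        exact (h2.zpow_right k).inv_right
      rw [div_eq_mul_inv, hcomm.eq] at hk'
      obtain ⟨j, rfl | rfl⟩ := Int.eq_nat_or_neg k
      · exact ⟨j, Or.inr (by simpa using hk')⟩
      · exact ⟨j, Or.inl (by simpa using hk')⟩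
    · rintro ⟨k, hx | hx⟩
      · exact (Subgroup.mul_mem_cancel_left _ (pow_mem hqm k)).1 (hsub _ hx)
      · exact (Subgroup.mul_mem_cancel_left _ (pow_mem (inv_mem hqm) k)).1 (hsub _ hx)
    -- Each letter of `l` adds at most `1` to the coefficient of `t ^ d`, while the reduced word for
    -- `q ^ k` has coefficient at least `k`; hence `k` is at most the length of `l`.
    · intro n f hf l k hx
      obtain ⟨w, hw, hwd, hwl, he⟩ := exists_word_famProd hf l
      obtain ⟨U, hU, hUl, hUe⟩ := hφ.exists_word (k • σ₀) (by
        rw [AddSubgroup.coe_nsmul]; exact nsmul_nonneg h0.le k)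
      rw [map_nsmul, toMul_nsmul] at hUe
      have hUd : DegLT (d + 1) U := by rw [DegLT, hUl]; exact hφ.le _ (k • σ₀).2
      have hdeg : ∀ y ∈ periodRange φ', y ∈ degSubgroup S d := by
        rintro _ ⟨σ, rfl⟩
        exact degGens_subset d (hφ'.mem_degGens σ)
      have hle : U.len.coeff d ≤ w.len.coeff d := by
        rcases hx with hx | hx
        · exact coeff_len_le_of_elt_mul_mem hd h1 hU hUd hw hwd
            (by rw [hUe, he]; exact hdeg _ hx)
        · exact coeff_len_le_of_elt_mul_mem (U := U.bar) hd h1 hU.bar hUd hw hwd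
            (by rw [elt_bar_of_reduced hU, hUe, he, ← inv_pow]; exact hdeg _ hx)
      rw [hUl, AddSubgroup.coe_nsmul, Polynomial.coeff_smul, nsmul_eq_mul] at hle
      have h3 : (k : ℤ) * 1 ≤ k * (σ₀ : Polynomial ℤ).coeff d :=
        mul_le_mul_of_nonneg_left hc0 (Int.natCast_nonneg k)
      have h4 := h3.trans (hle.trans hwl)
      lia

end Induction

/-! ### The word problem of `Ext(ℤ[t], G)` -/

section WordProblem

variable {G : Type*} [Group G] {S : Set G}

open AWord

theorem eqOneInExt_iff {w : AWord (Letters S)} : EqOneInExt S w ↔ toQuot S w = 1 := by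
  constructor
  · rintro ⟨h, e⟩
    exact congrArg Subtype.val e
  · intro h
    exact ⟨h ▸ one_mem _, Subtype.ext h⟩

/-- A word equal to `1` is trivial, hence lies in `R*` together with all its factors. -/
theorem eqOneInExt_list_prod_iff (h1 : (1 : G) ∉ S) {L : List (AWord (Letters S))} :
    EqOneInExt S L.prod ↔ (∀ w ∈ L, w ∈ RStar S) ∧ (L.map elt).prod = 1 := by
  have hmem : L.prod ∈ RStar S ↔ ∀ w ∈ L, w ∈ RStar S := by
    induction L with
    | nil => simp [one_mem]
    | cons w L ih => rw [List.prod_cons, mul_mem_RStar, ih]; simp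
  have hprod : (∀ w ∈ L, w ∈ RStar S) → (L.map elt).prod = elt L.prod := by
    clear hmem
    intro h
    induction L with
    | nil => exact elt_one.symm
    | cons w L ih =>
      have h2 : ∀ w ∈ L, w ∈ RStar S := fun x hx => h x (List.mem_cons_of_mem _ hx)
      rw [List.map_cons, List.prod_cons, List.prod_cons, ih h2,
        elt_mul (h w List.mem_cons_self) (list_prod_mem h2)]
  rw [eqOneInExt_iff, toQuot_eq_one_iff h1, ← hmem]
  constructor
  · intro h
    have hR := h.mem_RStar
    refine ⟨hR, ?_⟩
    rw [hprod (hmem.1 hR), elt_eq_one_iff h1 hR]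
    exact h
  · rintro ⟨hR, h⟩
    rwa [hprod (hmem.1 hR), elt_eq_one_iff h1 hR] at h

theorem decidable_eqOneInExt (h1 : (1 : G) ∉ S) (hgen : Subgroup.closure S = ⊤)
    (hv : ∀ v : List (Letters S),
      DecidableOnWords fun u : List (Letters S) => eval u ∈ Subgroup.zpowers (eval v))
    (Δ : Finset (AWord (Letters S))) :
    DecidableOnWords fun w : List Δ => EqOneInExt S (w.map Subtype.val).prod := by
  classical
  refine ⟨_, Δ.equivFin.symm, ?_⟩
  obtain ⟨d, hd, hΔ⟩ : ∃ d, 1 ≤ d ∧ ∀ w ∈ Δ, DegLT d w := by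
    choose D hD using fun w : AWord (Letters S) => exists_degLT w
    exact ⟨Δ.sup D + 1, Nat.le_add_left _ _,
      fun w hw => (hD w).mono ((Finset.le_sup hw).trans (Nat.le_succ _))⟩
  let f : Fin Δ.card → Ext S := fun i => elt (Δ.equivFin.symm i : AWord (Letters S))
  have hf : ∀ i, f i ∈ Submonoid.closure (degGens S d) := fun i => by
    by_cases hR : (Δ.equivFin.symm i : AWord (Letters S)) ∈ RStar S
    · exact mem_closure_degGens.2 (elt_mem_degSubgroup hR (hΔ _ (Δ.equivFin.symm i).2))
    -- Letters outside `R*` receive the value `1` by convention; inputs containing them are rejected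
    -- by the separate test in `key`.
    · simp only [f, elt, dif_neg hR, one_mem]
  have key : ∀ l : List (Fin Δ.card),
      EqOneInExt S ((l.map Δ.equivFin.symm).map Subtype.val).prod ↔
        (∀ i ∈ l, (Δ.equivFin.symm i : AWord (Letters S)) ∈ RStar S) ∧
          famProd f l ∈ ({1} : Set (Ext S)) := by
    intro l
    rw [eqOneInExt_list_prod_iff h1]
    simp [famProd, f, Function.comp_def]
  simp only [key]
  refine computablePred_and (computablePred_forall_mem (p := fun i =>
    (Δ.equivFin.symm i : AWord (Letters S)) ∈ RStar S) ?_ Computable.id)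
    ((decOn_one_of_forall (decOn_periodRange h1 hgen hv hd)).comp (CompElt.famProd hf))
  -- Membership of the letters in `R*` is a finite table, so no algorithm for `R*` itself is
  -- required.
  exact computablePred_iff_bool.2 ⟨fun i => decide ((Δ.equivFin.symm i : AWord (Letters S)) ∈
    RStar S), (Primrec.dom_finite _).to_comp, by simp⟩

end WordProblem

/-! # Periodic words -/

section Segments

variable {Γ : Type*}

/-- The factor of length `m` of the biinfinite word `χ` which starts at position `i`. -/
def seg (χ : ℤ → Γ) (i : ℤ) (m : ℕ) : List Γ := (List.range m).map fun k : ℕ => χ (i + (k : ℤ))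

@[simp] theorem length_seg (χ : ℤ → Γ) (i : ℤ) (m : ℕ) : (seg χ i m).length = m := by simp [seg]

@[simp] theorem seg_zero (χ : ℤ → Γ) (i : ℤ) : seg χ i 0 = [] := rfl

theorem seg_succ (χ : ℤ → Γ) (i : ℤ) (m : ℕ) : seg χ i (m + 1) = χ i :: seg χ (i + 1) m := by
  simp only [seg, List.range_succ_eq_map, List.map_cons, List.map_map]
  congr 1
  · simp
  · refine List.map_congr_left fun k _ => ?_
    simp only [Function.comp_apply]
    push_cast
    congr 1
    ring

theorem seg_add (χ : ℤ → Γ) (i : ℤ) (m n : ℕ) :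
    seg χ i (m + n) = seg χ i m ++ seg χ (i + m) n := by
  induction m generalizing i with
  | zero => simp
  | succ m ih =>
    rw [Nat.add_right_comm, seg_succ, seg_succ, ih, List.cons_append]
    push_cast
    rw [add_assoc, add_comm (1 : ℤ)]

theorem seg_shift {χ : ℤ → Γ} {δ : ℤ} (h : ∀ i, χ (i + δ) = χ i) (i : ℤ) (m : ℕ) :
    seg χ (i + δ) m = seg χ i m := by
  refine List.map_congr_left fun k _ => ?_
  rw [add_right_comm, h]

theorem shift_zsmul {χ : ℤ → Γ} {δ : ℤ} (h : ∀ i, χ (i + δ) = χ i) (k i : ℤ) :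
    χ (i + k * δ) = χ i := by
  induction k with
  | zero => simp
  | succ k ih => rw [add_mul, one_mul, ← add_assoc, h, ih]
  | pred k ih => rw [← ih, ← h (i + (-(k : ℤ) - 1) * δ)]; congr 1; ring

variable {G : Type*} [Group G] {S : Set G}

theorem eval_seg_mul {χ : ℤ → Letters S} {L : ℕ} (h : ∀ i, χ (i + L) = χ i) (i : ℤ) (q : ℕ) :
    eval (seg χ i (q * L)) = eval (seg χ i L) ^ q := by
  induction q with
  | zero => simp
  | succ q ih =>
    rw [Nat.add_mul, one_mul, seg_add, eval_append, ih, pow_succ]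
    push_cast
    rw [seg_shift (shift_zsmul h q)]

/-- Positive powers of `g` and `h` are conjugate. -/
def VirtuallyConj (g h : G) : Prop :=
  ∃ (z : G) (a k : ℕ), 1 ≤ a ∧ 1 ≤ k ∧ h ^ a = z * g ^ k * z⁻¹

theorem VirtuallyConj.refl (g : G) : VirtuallyConj g g := ⟨1, 1, 1, le_rfl, le_rfl, by simp⟩

theorem VirtuallyConj.conj {g h : G} (H : VirtuallyConj g h) (y : G) :
    VirtuallyConj g (y * h * y⁻¹) := by
  obtain ⟨z, a, k, ha, hk, e⟩ := H
  exact ⟨y * z, a, k, ha, hk, by rw [conj_pow, e]; group⟩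

theorem VirtuallyConj.pow {g h : G} (H : VirtuallyConj g h) {q : ℕ} (hq : 1 ≤ q) :
    VirtuallyConj g (h ^ q) := by
  obtain ⟨z, a, k, ha, hk, e⟩ := H
  refine ⟨z, a, k * q, ha, Nat.mul_pos hk hq, ?_⟩
  rw [← pow_mul, mul_comm, pow_mul, e, conj_pow, pow_mul]

theorem VirtuallyConj.of_pow {g h : G} {q : ℕ} (H : VirtuallyConj g (h ^ q)) (hq : 1 ≤ q) :
    VirtuallyConj g h := by
  obtain ⟨z, a, k, ha, hk, e⟩ := H
  exact ⟨z, q * a, k, Nat.mul_pos hq ha, hk, by rw [pow_mul, e]⟩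

theorem VirtuallyConj.pow_ne_one {g h : G} (hg : ∀ n : ℕ, 1 ≤ n → g ^ n ≠ 1)
    (H : VirtuallyConj g h) {n : ℕ} (hn : 1 ≤ n) : h ^ n ≠ 1 := by
  obtain ⟨z, a, k, ha, hk, e⟩ := H
  intro h1
  refine hg (k * n) (Nat.mul_pos hk hn) ?_
  have h2 : (z * g ^ k * z⁻¹) ^ n = 1 := by rw [← e, ← pow_mul, mul_comm, pow_mul, h1, one_pow]
  rw [conj_pow, ← pow_mul] at h2
  simpa using h2

/-- The biinfinite word `χ` is the power of a shortest word which is virtually conjugate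
to `g`. -/
structure IsMinimalPeriodic (g : G) (χ : ℤ → Letters S) (L : ℕ) : Prop where
  pos : 1 ≤ L
  shift : ∀ i, χ (i + L) = χ i
  conj : ∀ i, VirtuallyConj g (eval (seg χ i L))
  minimal : ∀ l : List (Letters S), l ≠ [] → VirtuallyConj g (eval l) → L ≤ l.length

/-- A shortest nonempty word virtually conjugate to `eval v` is repeated in both directions. Windows
of length `L` at neighbouring positions are cyclic rotations of each other, so their values are
conjugate. -/
theorem exists_isMinimalPeriodic {v : List (Letters S)} (hv : v ≠ []) :
    ∃ (χ : ℤ → Letters S) (L : ℕ), IsMinimalPeriodic (eval v) χ L := by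
  classical
  have hex : ∃ n, ∃ l : List (Letters S), l ≠ [] ∧ VirtuallyConj (eval v) (eval l) ∧
      l.length = n := ⟨_, v, hv, VirtuallyConj.refl _, rfl⟩
  obtain ⟨c, hc, hcv, hcl⟩ := Nat.find_spec hex
  have hmin : ∀ l : List (Letters S), l ≠ [] → VirtuallyConj (eval v) (eval l) →
      c.length ≤ l.length := fun l h1 h2 => hcl ▸ Nat.find_min' hex ⟨l, h1, h2, rfl⟩
  have hL : 0 < c.length := List.length_pos_iff.2 hc
  have hL' : (0 : ℤ) < c.length := by exact_mod_cast hL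
  have hlt : ∀ i : ℤ, (i % c.length).toNat < c.length := fun i => by
    have h1 := Int.emod_lt_of_pos i hL'
    have h2 := Int.emod_nonneg i hL'.ne'
    lia
  let χ : ℤ → Letters S := fun i => c.get ⟨(i % c.length).toNat, hlt i⟩
  have hshift : ∀ i, χ (i + c.length) = χ i := fun i => by simp [χ]
  refine ⟨χ, c.length, hL, hshift, ?_, hmin⟩
  have h0 : seg χ 0 c.length = c := by
    refine List.ext_getElem (by simp) fun k h1 h2 => ?_
    have h3 : (seg χ 0 c.length)[k] = χ k := by simp [seg]
    rw [h3]
    refine congrArg c.get (Fin.ext ?_)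
    change ((k : ℤ) % c.length).toNat = k
    rw [Int.emod_eq_of_lt (by lia) (by lia)]
    simp
  have hstep : ∀ i, eval (seg χ (i + 1) c.length) =
      (χ i : G)⁻¹ * eval (seg χ i c.length) * χ i := by
    intro i
    have e1 := seg_succ χ i c.length
    rw [seg_add, seg_succ, seg_zero, hshift] at e1
    have e2 := congrArg eval e1
    rw [eval_append] at e2
    simp only [eval, List.map_cons, List.map_nil, List.prod_cons, List.prod_nil, mul_one] at e2 ⊢
    rw [mul_assoc, e2, inv_mul_cancel_left]
  intro i
  induction i with
  | zero => rw [h0]; exact hcv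
  | succ i ih =>
    rw [hstep]
    simpa using ih.conj (χ i : G)⁻¹
  | pred i ih =>
    have e := hstep (-(i : ℤ) - 1)
    rw [sub_add_cancel] at e
    rw [e] at ih
    have := ih.conj (χ (-(i : ℤ) - 1) : G)
    convert this using 1
    group

namespace IsMinimalPeriodic

variable {g : G} {χ : ℤ → Letters S} {L : ℕ}

/-- Write `m = q L + r` with `r < L` and suppose the value is `1`. If `r = 0`, a power of an element
of infinite order would vanish. If `q = 0`, the segment of length `r` could be dropped from a
period. Otherwise the inverse of the tail of length `r` is a positive power of a period. The last
two cases give a word shorter than `L` that is virtually conjugate to `g`. -/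
theorem eval_seg_ne_one (h : IsMinimalPeriodic g χ L) (hg : ∀ n : ℕ, 1 ≤ n → g ^ n ≠ 1) (i : ℤ)
    {m : ℕ} (hm : 1 ≤ m) : eval (seg χ i m) ≠ 1 := by
  intro he
  have hdm := Nat.div_add_mod' m L
  have hr := Nat.mod_lt m h.pos
  generalize m / L = q at hdm
  generalize m % L = r at hdm hr
  subst hdm
  have hval : eval (seg χ i L) ^ q * eval (seg χ i r) = 1 := by
    rw [← he, seg_add, eval_append, eval_seg_mul h.shift]
    congr 2
    push_cast
    exact (seg_shift (shift_zsmul h.shift q) _ _).symm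
  rcases Nat.eq_zero_or_pos r with rfl | hr0
  · rw [seg_zero, eval_nil, mul_one] at hval
    refine (h.conj i).pow_ne_one hg (n := q) ?_ hval
    by_contra hq
    have : q = 0 := by lia
    simp [this] at hm
  rcases Nat.eq_zero_or_pos q with rfl | hq
  · rw [pow_zero, one_mul] at hval
    have e : eval (seg χ i L) = eval (seg χ (i + r) (L - r)) := by
      conv_lhs => rw [show L = r + (L - r) by lia]
      rw [seg_add, eval_append, hval, one_mul]
    have := h.minimal (seg χ (i + r) (L - r))
      (by rw [← List.length_pos_iff, length_seg]; lia) (e ▸ h.conj i)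
    rw [length_seg] at this
    lia
  · have e : eval ((seg χ i r).reverse.map (·⁻¹)) = eval (seg χ i L) ^ q := by
      rw [eval_rev, eq_comm, eq_inv_iff_mul_eq_one]
      exact hval
    have := h.minimal ((seg χ i r).reverse.map (·⁻¹))
      (by rw [← List.length_pos_iff]; simpa using hr0) (e ▸ (h.conj i).pow hq)
    simp at this
    lia

/-- Otherwise the remainder `r` of `δ` modulo `L` is a shift too. The segment of length `r L` is
then both an `L`-th power of a segment of length `r` and an `r`-th power of a period, which
contradicts minimality. -/
theorem dvd_of_shift (h : IsMinimalPeriodic g χ L) {δ : ℤ} (hδ : ∀ i, χ (i + δ) = χ i) :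
    (L : ℤ) ∣ δ := by
  have hL : (0 : ℤ) < L := by exact_mod_cast h.pos
  rw [Int.dvd_iff_emod_eq_zero]
  by_contra hne
  have h1 := Int.emod_lt_of_pos δ hL
  have h2 := Int.emod_nonneg δ hL.ne'
  obtain ⟨r, hr⟩ := Int.eq_ofNat_of_zero_le h2
  rw [hr] at hne h1
  have hr0 : 1 ≤ r := by lia
  have hper : ∀ i, χ (i + r) = χ i := fun i => by
    rw [← hr, ← shift_zsmul h.shift (δ / L), add_assoc,
      show δ % L + δ / L * L = δ by rw [mul_comm]; exact Int.emod_add_mul_ediv δ L, hδ]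
  have e : eval (seg χ 0 r) ^ L = eval (seg χ 0 L) ^ r := by
    rw [← eval_seg_mul hper, ← eval_seg_mul h.shift, mul_comm]
  have h4 : VirtuallyConj g (eval (seg χ 0 r) ^ L) := e ▸ (h.conj 0).pow hr0
  have := h.minimal (seg χ 0 r) (by rw [← List.length_pos_iff, length_seg]; lia)
    (h4.of_pow h.pos)
  rw [length_seg] at this
  lia

end IsMinimalPeriodic

end Segments

/-! ### The periodic word of length `t` and its centraliser -/

section PeriodicWords

variable {G : Type*} [Group G] {S : Set G}

open AWord

/-- The letters of `w` are read off from `χ`, from position `i + 1` on. -/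
def ReadsOff {Γ : Type*} (χ : ℤ → Γ) (i : ℤ) (w : AWord Γ) : Prop :=
  ∀ β, 1 ≤ β → β ≤ w.len → w.letter β = some (χ (i + β.coeff 0))

namespace ReadsOff

variable {Γ : Type*} {χ : ℤ → Γ}

theorem of_mul {i : ℤ} {p q : AWord Γ} (h : ReadsOff χ i (p * q)) :
    ReadsOff χ i p ∧ ReadsOff χ (i + p.len.coeff 0) q := by
  have hp := p.len_nonneg
  have hq := q.len_nonneg
  refine ⟨fun β h1 h2 => ?_, fun β h1 h2 => ?_⟩
  · rw [← letter_mul_left p q h2]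
    exact h β h1 (by rw [len_mul]; linarith)
  · rw [← letter_mul_right p q h1, h _ (by linarith) (by rw [len_mul]; linarith),
      Polynomial.coeff_add, add_assoc]

theorem eq_of_len {i j : ℤ} {p q : AWord Γ} (hp : ReadsOff χ i p) (hq : ReadsOff χ j q)
    (hl : p.len = q.len) (h : ∀ k, χ (i + k) = χ (j + k)) : p = q := by
  refine ext_letter hl fun β => ?_
  by_cases hβ : 1 ≤ β ∧ β ≤ p.len
  · rw [hp β hβ.1 hβ.2, hq β hβ.1 (hl ▸ hβ.2), h]
  · rw [(letter_eq_none_iff _ _).2 hβ, (letter_eq_none_iff _ _).2 (hl ▸ hβ)]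

theorem ofList_eq {i : ℤ} {l : List Γ} (h : ReadsOff χ i (ofList l)) :
    l = seg χ (i + 1) l.length := by
  induction l generalizing i with
  | nil => rfl
  | cons a l ih =>
    rw [ofList_cons] at h
    obtain ⟨h1, h2⟩ := h.of_mul
    have h3 := h1 1 le_rfl le_rfl
    simp only [single, if_true, Option.some.injEq, Polynomial.coeff_one_zero] at h3
    have h4 : (single a).len.coeff 0 = 1 := by simp [single]
    rw [h4] at h2
    rw [List.length_cons, seg_succ, ← ih h2, h3]

end ReadsOff

/-- The periodic word of length `t`. -/
noncomputable def periodicWord {Γ : Type*} (χ : ℤ → Γ) : AWord Γ :=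
  have h0 : (0 : Polynomial ℤ) ≤ Polynomial.X := poly_le_iff.2 (Or.inr (by simp))
  { len := Polynomial.X
    len_nonneg := h0
    letter := fun β => by
      classical
      -- The positions are `n` with `n ≥ 1` and `t - n` with `n ≥ 0`, so the constant coefficient
      -- runs through `1, 2, …` from the left end and through `…, -1, 0` towards the right end.
      exact if 1 ≤ β ∧ β ≤ Polynomial.X then some (χ (β.coeff 0)) else none
    isSome_letter_iff := fun β => by
      by_cases h : 1 ≤ β ∧ β ≤ Polynomial.X <;> simp [h] }

theorem readsOff_periodicWord {Γ : Type*} (χ : ℤ → Γ) : ReadsOff χ 0 (periodicWord χ) := by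
  intro β h1 h2
  have h2' : β ≤ Polynomial.X := h2
  simp [periodicWord, h1, h2']

theorem len_periodicWord {Γ : Type*} (χ : ℤ → Γ) : (periodicWord χ).len = Polynomial.X := rfl

theorem IsMinimalPeriodic.singleCut {g : G} {χ : ℤ → Letters S} {L : ℕ}
    (h : IsMinimalPeriodic g χ L) (hg : ∀ n : ℕ, 1 ≤ n → g ^ n ≠ 1) :
    SingleCut 1 (periodicWord χ) := by
  refine ⟨?_, ?_, by simp [len_periodicWord]⟩
  · intro p q f e hf
    have h1 := readsOff_periodicWord χ
    rw [e] at h1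
    have h2 := h1.of_mul.1.of_mul.2.ofList_eq
    rw [h2]
    exact h.eval_seg_ne_one hg _ (by lia)
  · rw [DegLT, len_periodicWord, Polynomial.mem_degreeLT]
    simp

theorem natCast_lt_X (m : ℕ) : (m : Polynomial ℤ) < Polynomial.X := by
  have h1 : (m : Polynomial ℤ) ∈ Polynomial.degreeLT ℤ 2 :=
    Polynomial.degreeLT_mono (by norm_num) (natCast_mem_degreeLT_one m)
  have h2 : (Polynomial.X : Polynomial ℤ) ∈ Polynomial.degreeLT ℤ 2 := by
    rw [Polynomial.mem_degreeLT]; simp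
  refine lt_of_coeff_lt (d := 1) h1 h2 ?_
  simp [Polynomial.coeff_natCast_ite]

/-- By periodicity the prefix and the suffix of length `L` are the same word `c`, and so are the two
remainders: the periodic word is `c y = y c`. -/
theorem IsMinimalPeriodic.commute {g : G} {χ : ℤ → Letters S} {L : ℕ}
    (h : IsMinimalPeriodic g χ L) (hg : ∀ n : ℕ, 1 ≤ n → g ^ n ≠ 1) :
    Commute (elt (periodicWord χ)) (elt (ofList (seg χ 1 L))) := by
  have hx := (h.singleCut hg).1
  have hL0 : (0 : Polynomial ℤ) ≤ L := Nat.cast_nonneg L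
  have hLX : (L : Polynomial ℤ) ≤ (periodicWord χ).len := (natCast_lt_X L).le
  obtain ⟨p, y, e, hp⟩ := (periodicWord χ).exists_split hL0 hLX
  obtain ⟨y', q, e', hq⟩ := (periodicWord χ).exists_split_right hL0 hLX
  have hr := readsOff_periodicWord χ
  have hr' := readsOff_periodicWord χ
  rw [e] at hr
  rw [e'] at hr'
  have hXp : (periodicWord χ).len.coeff 0 = 0 := by simp [len_periodicWord]
  have hy'0 : y'.len.coeff 0 = -L := by
    rw [e', coeff_len_mul, hq] at hXp
    simp only [Polynomial.coeff_natCast_ite, if_true] at hXp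
    lia
  obtain ⟨l, rfl, hl⟩ := exists_ofList_of_len_eq hp
  obtain ⟨l', rfl, hl'⟩ := exists_ofList_of_len_eq hq
  have e1 := hr.of_mul.1.ofList_eq
  have e2 := hr'.of_mul.2.ofList_eq
  rw [hl, zero_add] at e1
  rw [hl', hy'0, zero_add, ← seg_shift h.shift, show -(L : ℤ) + 1 + L = 1 by ring] at e2
  have e3 : y = y' := by
    refine hr.of_mul.2.eq_of_len hr'.of_mul.1 ?_ fun k => ?_
    · have h1 := congrArg AWord.len e
      have h2 := congrArg AWord.len e'
      rw [len_mul] at h1 h2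
      linarith
    · rw [hp]
      simp only [Polynomial.coeff_natCast_ite, if_true, zero_add]
      rw [add_comm]
      exact h.shift k
  subst e3
  rw [e1] at e
  rw [e2] at e'
  have hyr : y ∈ RStar S := by rw [e] at hx; exact hx.right.mem_RStar
  have k1 : elt (periodicWord χ) = elt (ofList (seg χ 1 L)) * elt y := by
    rw [e, elt_mul (ofList_mem_RStar _) hyr]
  have k2 : elt (periodicWord χ) = elt y * elt (ofList (seg χ 1 L)) := by
    rw [e', elt_mul hyr (ofList_mem_RStar _)]
  rw [Commute, SemiconjBy]
  conv_lhs => rw [k1]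
  conv_rhs => rw [k2]
  rw [mul_assoc]

/-- A pinch provides an infinite factor `z` of the periodic word followed by finite suffixes `l` and
`l'` with `l u = l'` in `G`. Two occurrences of `z` make the difference of their lengths a shift of
`χ`, hence a multiple of `L`, so `l` and `l'` differ by a power of the period on the right. -/
theorem IsMinimalPeriodic.mem_zpowers {g : G} {χ : ℤ → Letters S} {L : ℕ}
    (h : IsMinimalPeriodic g χ L) (hg : ∀ n : ℕ, 1 ≤ n → g ^ n ≠ 1) (h1 : (1 : G) ∉ S)
    {u : List (Letters S)} (hu : elt (periodicWord χ) * elt (ofList u) *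
      elt (periodicWord χ).bar ∈ degSubgroup S 1) :
    eval u ∈ Subgroup.zpowers (eval (seg χ 1 L)) := by
  have hx := h.singleCut hg
  obtain ⟨a, z, b, c, e, e1, e2, hz, ht⟩ := pinch_of_mem_degSubgroup le_rfl h1 hx hx.bar
    (ofList_mem_RStar u) (degLT_ofList u) hu
  rw [eq_comm, eq_bar_iff] at e2
  simp only [bar_mul, bar_bar] at e2
  rw [← mul_assoc] at e2
  obtain ⟨-, hb, -⟩ := hx.degLT_of_eq e1 hz
  obtain ⟨-, hc, -⟩ := hx.degLT_of_eq e2.symm hz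
  obtain ⟨l, rfl⟩ := degLT_one_iff.1 hb
  obtain ⟨l', hl'⟩ := degLT_one_iff.1 hc
  have hX : (periodicWord χ).len.coeff 0 = 0 := by simp [len_periodicWord]
  have key : ∀ (p : AWord (Letters S)) (m : List (Letters S)), periodicWord χ = p * z * ofList m →
      ReadsOff χ (-(m.length : ℤ) - z.len.coeff 0) z ∧ m = seg χ (-(m.length : ℤ) + 1) m.length := by
    intro p m em
    have hr := readsOff_periodicWord χ
    rw [em] at hr hX
    rw [coeff_len_mul, len_ofList, Polynomial.coeff_natCast_ite, if_pos rfl] at hX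
    have h2 := hr.of_mul.1.of_mul.2
    have h3 := hr.of_mul.2.ofList_eq
    rw [zero_add] at h2 h3
    rw [coeff_len_mul] at hX
    refine ⟨?_, ?_⟩
    · rwa [show -(m.length : ℤ) - z.len.coeff 0 = p.len.coeff 0 by lia]
    · rwa [show -(m.length : ℤ) = (p * z).len.coeff 0 by rw [coeff_len_mul]; lia]
  obtain ⟨r1, s1⟩ := key _ _ e1
  rw [hl'] at e2
  obtain ⟨r2, s2⟩ := key _ _ e2.symm
  have hval : eval l * eval u = eval l' := by
    have h2 := ((hasValue_ofList l).mul (hasValue_ofList u)).mul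
      (HasValue.of_eq ⟨_, by rw [← bar_ofList, ← hl', bar_bar], eval_rev l'⟩ rfl)
    exact mul_inv_eq_one.1 (ht.hasValue_eq_one h2)
  have hdvd : (L : ℤ) ∣ (l.length : ℤ) - l'.length := by
    refine h.dvd_of_shift fun i => ?_
    have hpos := h.pos
    -- Both occurrences of `z` are compared at a finite position `n ≥ 1`, which lies in `z` because
    -- `z` is infinite. Adding a large multiple of `L` makes the position positive without changing
    -- the letters of `χ`.
    obtain ⟨n, hn⟩ : ∃ n : ℕ, (n : ℤ) = i + l.length + z.len.coeff 0 +
        (|i + l.length + z.len.coeff 0| + 1) * L := by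
      refine Int.eq_ofNat_of_zero_le ?_ |>.imp fun _ h => h.symm
      have h3 := neg_abs_le (i + l.length + z.len.coeff 0)
      have h4 := abs_nonneg (i + l.length + z.len.coeff 0)
      have h5 : (1 : ℤ) ≤ L := by exact_mod_cast hpos
      nlinarith
    have hn1 : 1 ≤ n := by
      have h3 := neg_abs_le (i + l.length + z.len.coeff 0)
      have h4 := abs_nonneg (i + l.length + z.len.coeff 0)
      have h5 : (1 : ℤ) ≤ L := by exact_mod_cast hpos
      have : (1 : ℤ) ≤ n := by nlinarith
      exact_mod_cast this
    have hz1 : (1 : Polynomial ℤ) ≤ n := by exact_mod_cast Nat.one_le_cast.2 hn1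
    have hz2 : (n : Polynomial ℤ) ≤ z.len :=
      le_len_of_not_degLT (natCast_mem_degreeLT_one n) hz
    have h3 := (r1 n hz1 hz2).symm.trans (r2 n hz1 hz2)
    simp only [Option.some.injEq, Polynomial.coeff_natCast_ite, if_true, hn] at h3
    rw [← shift_zsmul h.shift (|i + l.length + z.len.coeff 0| + 1) i,
      ← shift_zsmul h.shift (|i + l.length + z.len.coeff 0| + 1) (i + _)]
    calc _ = _ := by congr 1; ring
      _ = _ := h3.symm
      _ = _ := by congr 1; ring
  have hpow : ∀ m j : ℕ, eval (seg χ (-((m + j * L : ℕ) : ℤ) + 1) (m + j * L)) =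
      eval (seg χ (-(m : ℤ) + 1) m) * eval (seg χ 1 L) ^ j := by
    intro m j
    have a1 : -((m + j * L : ℕ) : ℤ) + 1 + j * L = -(m : ℤ) + 1 := by push_cast; ring
    have a2 : -((m + j * L : ℕ) : ℤ) + 1 + m + j * L = 1 := by push_cast; ring
    rw [seg_add, eval_append, eval_seg_mul h.shift, ← seg_shift (shift_zsmul h.shift j), a1,
      ← seg_shift (shift_zsmul h.shift j) (-((m + j * L : ℕ) : ℤ) + 1 + m), a2]
  rw [← eq_inv_mul_iff_mul_eq] at hval
  rw [hval]
  have v1 := congrArg eval s1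
  have v2 := congrArg eval s2
  have hC := Subgroup.mem_zpowers (eval (seg χ 1 L))
  obtain ⟨j, hj⟩ := hdvd
  obtain ⟨k, rfl | rfl⟩ := Int.eq_nat_or_neg j
  · have e3 : l.length = l'.length + k * L := by
      have : (l.length : ℤ) = l'.length + k * L := by linarith
      exact_mod_cast this
    rw [e3, hpow, ← v2] at v1
    rw [v1, mul_inv_rev, inv_mul_cancel_right]
    exact inv_mem (pow_mem hC k)
  · have e3 : l'.length = l.length + k * L := by
      have : (l'.length : ℤ) = l.length + k * L := by linarith
      exact_mod_cast this
    rw [e3, hpow, ← v1] at v2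
    rw [v2, inv_mul_cancel_left]
    exact pow_mem hC k

end PeriodicWords

/-! # Cyclic subgroups -/

section Cyclic

variable {G : Type*} [Group G]

theorem decOn_zpowers_of_finite {X : Set G} (h1 : DecOn {1} X)
    (hX : ∀ g : G, g ∈ Submonoid.closure X) {g : G} {n : ℕ} (hn : 1 ≤ n) (hg : g ^ n = 1) :
    DecOn (Subgroup.zpowers g : Set G) X := by
  intro m f hf
  have key : ∀ l, famProd f l ∈ (Subgroup.zpowers g : Set G) ↔
      ∃ k < n, famProd f l * g ^ k ∈ ({1} : Set G) := by
    intro l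
    rw [SetLike.mem_coe]
    constructor
    · intro h
      have hfin : IsOfFinOrder g := isOfFinOrder_iff_pow_eq_one.2 ⟨n, hn, hg⟩
      classical
      obtain ⟨k, hk⟩ := Finset.mem_image.1
        (hfin.mem_zpowers_iff_mem_range_orderOf.1 (inv_mem h))
      refine ⟨k, (Finset.mem_range.1 hk.1).trans_le (orderOf_le_of_pow_eq_one hn hg), ?_⟩
      rw [hk.2, mul_inv_cancel]
      rfl
    · rintro ⟨k, -, hk⟩
      rw [eq_inv_of_mul_eq_one_left hk]
      exact inv_mem (pow_mem (Subgroup.mem_zpowers g) k)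
  simp only [key]
  refine computablePred_exists_lt (p := fun k l => famProd f l * g ^ k ∈ ({1} : Set G)) ?_
    (Computable.const n)
  exact h1.comp (((CompElt.famProd fun i => hX _).comp Computable.snd).mul
    ((CompElt.pow (hX g)).comp Computable.fst))

/-- Once membership in `⟨c⟩` is confirmed, the exponent is found by search as a difference of
natural numbers. It is unique because `c` has infinite order, so divisibility by `a` can be tested.
-/
theorem decOn_zpowers_pow {X : Set G} (h1 : DecOn {1} X)
    (hX : ∀ g : G, g ∈ Submonoid.closure X) {c : G} (hc : ∀ n : ℕ, 1 ≤ n → c ^ n ≠ 1)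
    (hd : DecOn (Subgroup.zpowers c : Set G) X) (a : ℕ) :
    DecOn (Subgroup.zpowers (c ^ a) : Set G) X := by
  intro m f hf
  have hF : CompElt X (famProd f) := CompElt.famProd fun i => hX _
  obtain ⟨e, he, hes⟩ := exists_computable_choice (α := List (Fin m)) (β := ℕ × ℕ)
    (p := fun l x => ¬ famProd f l ∈ (Subgroup.zpowers c : Set G) ∨
      c ^ x.1 * famProd f l * c⁻¹ ^ x.2 ∈ ({1} : Set G))
    (computablePred_or (computablePred_comp (hd m f hf).not Computable.fst)
      (h1.comp ((((CompElt.pow (hX c)).comp (Computable.fst.comp Computable.snd)).mul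
        (hF.comp Computable.fst)).mul
        ((CompElt.pow (hX c⁻¹)).comp (Computable.snd.comp Computable.snd))))) (by
      intro l
      by_cases hl : famProd f l ∈ (Subgroup.zpowers c : Set G)
      · obtain ⟨k, hk⟩ := Subgroup.mem_zpowers_iff.1 hl
        obtain ⟨j, rfl | rfl⟩ := Int.eq_nat_or_neg k
        · exact ⟨(0, j), Or.inr (by simp [← hk])⟩
        · exact ⟨(j, 0), Or.inr (by simp [← hk])⟩
      · exact ⟨(0, 0), Or.inl hl⟩)
  have key : ∀ l, famProd f l ∈ (Subgroup.zpowers (c ^ a) : Set G) ↔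
      famProd f l ∈ (Subgroup.zpowers c : Set G) ∧ (e l).1 % a = (e l).2 % a := by
    intro l
    simp only [SetLike.mem_coe]
    have hinj : Function.Injective fun n : ℤ => c ^ n := by
      rw [injective_zpow_iff_not_isOfFinOrder, isOfFinOrder_iff_pow_eq_one]
      rintro ⟨n, hn, h⟩
      exact hc n hn h
    have hval : famProd f l ∈ Subgroup.zpowers c →
        famProd f l = c ^ (((e l).2 : ℤ) - (e l).1) := by
      intro h
      rcases hes l with h2 | h2
      · exact absurd h h2
      · have h3 := eq_inv_of_mul_eq_one_left (Set.mem_singleton_iff.1 h2)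
        rw [inv_pow, inv_inv, ← eq_inv_mul_iff_mul_eq] at h3
        rw [h3, sub_eq_neg_add, zpow_add, zpow_neg, zpow_natCast, zpow_natCast]
    have hmod : (e l).1 % a = (e l).2 % a ↔ (a : ℤ) ∣ ((e l).2 : ℤ) - (e l).1 :=
      Nat.modEq_iff_dvd
    rw [hmod]
    constructor
    · intro h
      obtain ⟨k, hk⟩ := Subgroup.mem_zpowers_iff.1 h
      have hm : famProd f l ∈ Subgroup.zpowers c := by
        rw [← hk]; exact zpow_mem (pow_mem (Subgroup.mem_zpowers c) a) k
      refine ⟨hm, k, ?_⟩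
      apply hinj
      simp only
      rw [← hval hm, ← hk, zpow_mul, zpow_natCast]
    · rintro ⟨hm, k, hk⟩
      rw [hval hm, hk, zpow_mul, zpow_natCast]
      exact zpow_mem (Subgroup.mem_zpowers _) k
  simp only [key]
  refine computablePred_and (hd m f hf) (computablePred_iff_bool.2
    ⟨fun l => decide ((e l).1 % a = (e l).2 % a), ?_, by simp⟩)
  exact (PrimrecRel.decide Primrec.eq).to_comp.comp
    (Primrec.nat_mod.to_comp.comp (Computable.fst.comp he) (Computable.const a))
    (Primrec.nat_mod.to_comp.comp (Computable.snd.comp he) (Computable.const a))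

/-- `⟨g⟩` is a union of the cosets of `⟨g ^ k⟩` by `g ^ i` with `i < k`, and `⟨g ^ k⟩` is conjugate
to `⟨c ^ a⟩`. -/
theorem decOn_zpowers_of_virtuallyConj {X : Set G} (h1 : DecOn {1} X)
    (hX : ∀ g : G, g ∈ Submonoid.closure X) {g c : G} (hg : ∀ n : ℕ, 1 ≤ n → g ^ n ≠ 1)
    (hc : VirtuallyConj g c) (hd : DecOn (Subgroup.zpowers c : Set G) X) :
    DecOn (Subgroup.zpowers g : Set G) X := by
  obtain ⟨z, a, k, ha, hk, e⟩ := id hc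
  have hda := decOn_zpowers_pow h1 hX (fun n hn => hc.pow_ne_one hg hn) hd a
  have hconj : ∀ y, z * y * z⁻¹ ∈ Subgroup.zpowers (c ^ a) ↔ y ∈ Subgroup.zpowers (g ^ k) := by
    intro y
    rw [e, Subgroup.mem_zpowers_iff, Subgroup.mem_zpowers_iff]
    refine exists_congr fun j => ?_
    rw [conj_zpow]
    constructor
    · intro h; simpa using h
    · rintro rfl; rfl
  have key : ∀ y, y ∈ Subgroup.zpowers g ↔
      ∃ i < k, z * (y * g ^ i) * z⁻¹ ∈ (Subgroup.zpowers (c ^ a) : Set G) := by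
    intro y
    simp only [SetLike.mem_coe, hconj]
    constructor
    · intro h
      obtain ⟨j, rfl⟩ := Subgroup.mem_zpowers_iff.1 h
      have hk0 : (0 : ℤ) < k := by exact_mod_cast hk
      have h3 := Int.emod_lt_of_pos (-j) hk0
      have h4 := Int.emod_nonneg (-j) hk0.ne'
      refine ⟨(-j % k).toNat, by lia, ?_⟩
      have h5 : g ^ (-j % k).toNat = g ^ (-j % (k : ℤ)) := by
        rw [← zpow_natCast, Int.toNat_of_nonneg h4]
      rw [h5, ← zpow_add,
        show j + -j % k = k * (-(-j / k)) by have := Int.emod_add_mul_ediv (-j) k; linarith,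
        zpow_mul, zpow_natCast]
      exact zpow_mem (Subgroup.mem_zpowers _) _
    · rintro ⟨i, -, hi⟩
      have h2 : y * g ^ i ∈ Subgroup.zpowers g :=
        (Subgroup.zpowers_le.2 (pow_mem (Subgroup.mem_zpowers g) k)) hi
      exact (Subgroup.mul_mem_cancel_right _ (pow_mem (Subgroup.mem_zpowers g) i)).1 h2
  intro m f hf
  simp only [SetLike.mem_coe, key]
  refine computablePred_exists_lt
    (p := fun i l => z * (famProd f l * g ^ i) * z⁻¹ ∈ (Subgroup.zpowers (c ^ a) : Set G)) ?_
    (Computable.const k)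
  exact hda.comp (((CompElt.const (hX z)).mul (((CompElt.famProd fun i => hX _).comp
    Computable.snd).mul ((CompElt.pow (hX g)).comp Computable.fst))).mul (CompElt.const (hX z⁻¹)))

end Cyclic

/-! ### From the word problem of `Ext(ℤ[t], G)` to cyclic subgroups of `G` -/

section Converse

variable {G : Type*} [Group G] {S : Set G}

open AWord

/-- The family may have repetitions, and the numbering of `Δ` is not under control; a fixed table
translates the letters. -/
theorem computablePred_eqOneInExt
    (h : ∀ Δ : Finset (AWord (Letters S)),
      DecidableOnWords fun w : List Δ => EqOneInExt S (w.map Subtype.val).prod)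
    {m : ℕ} (W : Fin m → AWord (Letters S)) :
    ComputablePred fun l : List (Fin m) => EqOneInExt S (l.map W).prod := by
  classical
  obtain ⟨n, e, hc⟩ := h (Finset.univ.image W)
  have hW : ∀ i, W i ∈ Finset.univ.image W := fun i => Finset.mem_image_of_mem W (Finset.mem_univ i)
  let w : Fin m → List (Fin n) := fun i => [e.symm ⟨W i, hW i⟩]
  have key : ∀ l : List (Fin m), ((l.flatMap w).map e).map Subtype.val = l.map W := by
    intro l
    induction l with
    | nil => rfl
    | cons i l ih => simp [w, ← ih]
  have h2 := computablePred_comp hc (computable_flatMap w)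
  simp only [key] at h2
  exact h2

theorem eval_map_mk {m : ℕ} {f : Fin m → G} (hf : ∀ i, f i ∈ S ∪ S⁻¹) (l : List (Fin m)) :
    eval (l.map fun i => (⟨f i, hf i⟩ : Letters S)) = famProd f l := by
  simp [eval, famProd, Function.comp_def]

theorem decOn_one_of_decidable (h1 : (1 : G) ∉ S)
    (h : ∀ Δ : Finset (AWord (Letters S)),
      DecidableOnWords fun w : List Δ => EqOneInExt S (w.map Subtype.val).prod) :
    DecOn {1} (S ∪ S⁻¹ : Set G) := by
  intro m f hf
  have h2 := computablePred_eqOneInExt h fun i => single (⟨f i, hf i⟩ : Letters S)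
  have key : ∀ l : List (Fin m),
      EqOneInExt S (l.map fun i => single (⟨f i, hf i⟩ : Letters S)).prod ↔
        famProd f l ∈ ({1} : Set G) := by
    intro l
    have e : (l.map fun i => single (⟨f i, hf i⟩ : Letters S)).prod =
        ofList (l.map fun i => (⟨f i, hf i⟩ : Letters S)) := by
      rw [ofList, List.map_map]; rfl
    rw [e, eqOneInExt_iff, Set.mem_singleton_iff, ← eval_map_mk hf]
    refine ⟨fun h => ?_, fun h => toQuot_hasValue ⟨_, rfl, h⟩⟩
    exact ((toQuot_eq_one_iff h1).1 h).hasValue_eq_one (hasValue_ofList _)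
  simp only [key] at h2
  exact h2

/-- The right-hand side says that `u` commutes with the periodic word. Powers of the period do so by
`IsMinimalPeriodic.commute`. Conversely, commuting makes the conjugate of `u` an element of degree
less than `1`, and `IsMinimalPeriodic.mem_zpowers` applies. -/
theorem IsMinimalPeriodic.mem_zpowers_iff {g : G} {χ : ℤ → Letters S} {L : ℕ}
    (h : IsMinimalPeriodic g χ L) (hg : ∀ n : ℕ, 1 ≤ n → g ^ n ≠ 1) (h1 : (1 : G) ∉ S)
    (hgen : Subgroup.closure S = ⊤) (u : List (Letters S)) :
    eval u ∈ Subgroup.zpowers (eval (seg χ 1 L)) ↔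
      EqOneInExt S (periodicWord χ * ofList u * (periodicWord χ).bar *
        ofList (u.reverse.map (·⁻¹))) := by
  have hx := (h.singleCut hg).1
  have hxR := hx.mem_RStar
  have hxR' := hx.bar.mem_RStar
  have hu := ofList_mem_RStar u
  have hu' := bar_mem_RStar hu
  rw [eqOneInExt_iff, toQuot_eq_one_iff h1, ← bar_ofList,
    ← elt_eq_one_iff h1 (mul_mem (mul_mem (mul_mem hxR hu) hxR') hu'),
    elt_mul (mul_mem (mul_mem hxR hu) hxR') hu', elt_mul (mul_mem hxR hu) hxR',
    elt_mul hxR hu, elt_bar hu]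
  constructor
  · intro hm
    obtain ⟨k, hk⟩ := Subgroup.mem_zpowers_iff.1 hm
    obtain ⟨ι, -, hι⟩ := exists_embedding h1 hgen
    have hcomm : Commute (elt (periodicWord χ)) (elt (ofList u)) := by
      rw [← hι, ← hk, map_zpow, hι]
      exact (h.commute hg).zpow_right k
    rw [hcomm.eq, elt_bar_of_reduced hx]
    group
  · intro he
    refine h.mem_zpowers hg h1 ?_
    rw [mul_inv_eq_one.1 he]
    exact elt_mem_degSubgroup hu (degLT_ofList u)

theorem IsMinimalPeriodic.decOn_zpowers {g : G} {χ : ℤ → Letters S} {L : ℕ}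
    (hχ : IsMinimalPeriodic g χ L) (hg : ∀ n : ℕ, 1 ≤ n → g ^ n ≠ 1) (h1 : (1 : G) ∉ S)
    (hgen : Subgroup.closure S = ⊤)
    (h : ∀ Δ : Finset (AWord (Letters S)),
      DecidableOnWords fun w : List Δ => EqOneInExt S (w.map Subtype.val).prod) :
    DecOn (Subgroup.zpowers (eval (seg χ 1 L)) : Set G) (S ∪ S⁻¹ : Set G) := by
  intro m f hf
  let a : Fin m → Letters S := fun i => ⟨f i, hf i⟩
  let x := periodicWord χ
  -- The alphabet consists of the given letters, their inverses, `x` and `x̄`; `φ` spells the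
  -- commutator `x u x̄ ū` over it.
  let p : Fin m → Fin (m + (m + 2)) := fun i => Fin.castAdd _ i
  let n : Fin m → Fin (m + (m + 2)) := fun i => Fin.natAdd m (Fin.castAdd 2 i)
  let y : Fin 2 → Fin (m + (m + 2)) := fun i => Fin.natAdd m (Fin.natAdd m i)
  let W : Fin (m + (m + 2)) → AWord (Letters S) := Fin.append (fun i => single (a i))
    (Fin.append (fun i => single (a i)⁻¹) ![x, x.bar])
  have hW := computablePred_eqOneInExt h W
  let φ : List (Fin m) → List (Fin (m + (m + 2))) := fun l =>
    [y 0] ++ l.flatMap (fun i => [p i]) ++ [y 1] ++ l.reverse.flatMap (fun i => [n i])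
  have hφ : Computable φ := by
    refine Computable.list_append.comp (Computable.list_append.comp (Computable.list_append.comp
      (Computable.const _) (computable_flatMap _)) (Computable.const _))
      ((computable_flatMap _).comp Computable.list_reverse)
  have key : ∀ l, famProd f l ∈ (Subgroup.zpowers (eval (seg χ 1 L)) : Set G) ↔
      EqOneInExt S ((φ l).map W).prod := by
    intro l
    rw [SetLike.mem_coe, ← eval_map_mk hf, hχ.mem_zpowers_iff hg h1 hgen]
    have e1 : ((l.flatMap fun i => [p i]).map W).prod = ofList (l.map a) := by
      rw [← List.map_eq_flatMap, List.map_map, ofList, List.map_map]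
      congr 2
      funext i
      simp [W, p]
    have e2 : ((l.reverse.flatMap fun i => [n i]).map W).prod =
        ofList ((l.map a).reverse.map (·⁻¹)) := by
      rw [← List.map_eq_flatMap, List.map_map, ofList, ← List.map_reverse, List.map_map,
        List.map_map]
      congr 2
      funext i
      simp [W, n]
    have e3 : W (y 0) = x := by simp [W, y]
    have e4 : W (y 1) = x.bar := by simp [W, y]
    simp only [φ, List.map_append, List.prod_append, e1, e2, List.map_cons, List.map_nil,
      List.prod_cons, List.prod_nil, mul_one, e3, e4]
    rfl
  simp only [key]
  exact computablePred_comp hW hφ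

/-- If `eval v` has finite order, the word problem of `G` suffices. Otherwise the period of a
periodic word stands in for `eval v`, to which it is virtually conjugate. -/
theorem decidable_mem_zpowers (hfin : S.Finite) (h1 : (1 : G) ∉ S)
    (hgen : Subgroup.closure S = ⊤)
    (h : ∀ Δ : Finset (AWord (Letters S)),
      DecidableOnWords fun w : List Δ => EqOneInExt S (w.map Subtype.val).prod)
    (v : List (Letters S)) :
    DecidableOnWords fun u : List (Letters S) => eval u ∈ Subgroup.zpowers (eval v) := by
  have hX : ∀ g : G, g ∈ Submonoid.closure (S ∪ S⁻¹) := fun g => by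
    rw [← Subgroup.closure_toSubmonoid, hgen]; trivial
  have hd1 := decOn_one_of_decidable h1 h
  have hdec : DecOn (Subgroup.zpowers (eval v) : Set G) (S ∪ S⁻¹ : Set G) := by
    by_cases hv : ∃ n : ℕ, 1 ≤ n ∧ eval v ^ n = 1
    · obtain ⟨n, hn, hv⟩ := hv
      exact decOn_zpowers_of_finite hd1 hX hn hv
    · have hg : ∀ n : ℕ, 1 ≤ n → eval v ^ n ≠ 1 := fun n hn he => hv ⟨n, hn, he⟩
      obtain ⟨χ, L, hχ⟩ := exists_isMinimalPeriodic (v := v) (by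
        rintro rfl; exact hg 1 le_rfl (by simp))
      exact decOn_zpowers_of_virtuallyConj hd1 hX hg (hχ.conj 1)
        (hχ.decOn_zpowers hg h1 hgen h)
  have : Finite (Letters S) := (hfin.union hfin.inv).to_subtype
  obtain ⟨n, ⟨e⟩⟩ := Finite.exists_equiv_fin (Letters S)
  refine ⟨n, e.symm, ?_⟩
  have h2 := hdec n (fun i => (e.symm i : G)) fun i => (e.symm i).2
  have key : ∀ l : List (Fin n), famProd (fun i => (e.symm i : G)) l = eval (l.map e.symm) :=
    fun l => by simp [eval, famProd, Function.comp_def]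
  simp only [key] at h2
  exact h2

end Converse
end NonArch

theorem mainTheorem2 {G : Type*} [Group G] (S : Set G) (hfin : S.Finite)
    (hone : (1 : G) ∉ S) (hgen : Subgroup.closure S = ⊤) :
    (∀ v : List (NonArch.Letters S),
      NonArch.DecidableOnWords fun u : List (NonArch.Letters S) =>
        NonArch.eval u ∈ Subgroup.zpowers (NonArch.eval v)) ↔
    (∀ Δ : Finset (NonArch.AWord (NonArch.Letters S)),
      NonArch.DecidableOnWords fun w : List Δ =>
        NonArch.EqOneInExt S (w.map Subtype.val).prod) := by
  exact ⟨fun h Δ => NonArch.decidable_eqOneInExt hone hgen h Δ,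
    fun h v => NonArch.decidable_mem_zpowers hfin hone hgen h v⟩
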